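/- Let $M$ be a (connected, not necessarily compact) Riemann surface and $V=M\times\mathbb C^2$ with its trivialized determinant bundle. A triple $(\nabla,\Phi,h)$ consists of a smooth Hermitian metric $h$ on $V$, an $h$-unitary connection $\nabla=d+A$ with $\operatorname{tr}A=0$, and a trace-free $\Phi\in\Omega^{1,0}(M,\operatorname{End}V)$. It solves the self-duality equations if $$\bar\partial^\nabla\Phi=0,\qquad F^\nabla+[\Phi\wedge\Phi^{*_h}]=0 ;$$ these are the $\mathrm{SU}(2)$ equations if $h$ is positive definite with $\det h=1$, and the $\mathrm{SU}(1,1)$ equations if $h$ has signature $(1,1)$ and $\det h=-1$. Let $(\nabla,\Phi,h)$ solve the $\mathrm{SU}(2)$ self-duality equations, let $\omega$ be a smooth $(1,0)$-form with $\det\Phi=-\omega^2$, and let $L\subset V$ be the holomorphic eigenline bundle of $\Phi$ with respect to $\omega$, i.e. a smooth line subbundle, holomorphic for $\bar\partial^\nabla$, with $\Phi|_L=\omega$ (if $\Phi\equiv0$, any holomorphic line subbundle $L$ is allowed). With respect to $V=L\oplus L^\perp$ ($h$-orthogonal) write $$\nabla=\begin{pmatrix}\nabla^L&\gamma\\-\gamma^*&\nabla^{L^*}\end{pmatrix},\qquad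 \Phi=\begin{pmatrix}\omega&\alpha\\0&-\omega\end{pmatrix},$$ and set $$\hat\nabla=\begin{pmatrix}\nabla^L&\alpha\\ \alpha^*&\nabla^{L^*}\end{pmatrix},\qquad \hat\Phi=\begin{pmatrix}\omega&0\\-\gamma^*&-\omega\end{pmatrix},\qquad \hat h=h|_L\oplus(-h|_{L^\perp}),$$ where $\gamma^*,\alpha^*$ are adjoints with respect to $h$. Then: 1. $(\hat\nabla,\hat\Phi,\hat h)$ is a solution of the $\mathrm{SU}(1,1)$ self-duality equations. 2. Let $\pi:\widetilde M\to M$ be the universal covering. A map $F:\widetilde M\to \mathrm{SL}(2,\mathbb C)$ is a parallel frame for $\nabla+\Phi+\Phi^{*_h}$ if and only if it is one for $\hat\nabla+\hat\Phi+\hat\Phi^{*_{\hat h}}$. For every such $F$ let $f=F^*(h\circ\pi)F$ and $N=F^*(\hat h\circ\pi)F$ be the metrics $h$ and $\hat h$ (as Gram matrices) in the frame $F$, regarded as maps into $\mathbb R^{1,3}$ through the isometry $$(x_0,x_1,x_2,x_3)\mapsto\begin{pmatrix}x_0+x_1&x_2+ix_3\\x_2-ix_3&x_0-x_1\end{pmatrix}$$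 onto the Hermitian matrices with the quadratic form $-\det$. Then $f$ is a harmonic map into $\mathbb H^3=\{\langle x,x\rangle=-1,\ x_0>0\}$ and $N$ is a harmonic map into $\mathrm{dS}_3=\{\langle x,x\rangle=1\}$. For some homomorphism $\rho$ from the group of deck transformations to $\mathrm{SL}(2,\mathbb C)$ one has $F\circ\sigma=F\rho(\sigma^{-1})$ for all deck transformations $\sigma$, and hence $f\circ\sigma=\rho(\sigma^{-1})^*f\rho(\sigma^{-1})$ and $N\circ\sigma=\rho(\sigma^{-1})^*N\rho(\sigma^{-1})$. Moreover, $N$ is the oblique hyperbolic Gauß map of $f$ with respect to the square root $\eta=-2\pi^*\omega$ of the Hopf differential of $f$. That is, $$\langle\partial f,\partial f\rangle=\eta^2,\qquad \langle N,f\rangle=0,\qquad \langle df,N\rangle=\eta+\bar\eta,\qquad \langle N,N\rangle=1,$$ and in every holomorphic coordinate $x+iy$ one has $\det(f,N,f_x,f_y)\ge0$, with $\det(f,N,f_x,f_y)>0$ wherever $f$ is an immersion. -/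

import Mathlib

open Set Filter Topology
open scoped Manifold ContDiff Matrix ComplexConjugate ComplexOrder

noncomputable section

namespace SelfDuality

/-- Complex `2 × 2` matrices, i.e. endomorphisms of a fibre of the trivial bundle `V = M × ℂ²`. -/
abbrev Mat2 := Matrix (Fin 2) (Fin 2) ℂ

/-! ### Differential forms on a Riemann surface -/

section Forms

variable {M : Type*} [TopologicalSpace M] [ChartedSpace ℂ M]
variable {W : Type*} [AddCommGroup W] [Module ℝ W] [Module ℂ W]

/-- A (real-linear) one-form on the surface `M` with values in `W`. -/
abbrev OneForm (M : Type*) [TopologicalSpace M] [ChartedSpace ℂ M]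
    (W : Type*) [AddCommGroup W] [Module ℝ W] :=
  (x : M) → TangentSpace 𝓘(ℝ, ℂ) x →ₗ[ℝ] W

/-- The one-form `α` read in the holomorphic coordinate `z = c`: the pull-back along `c⁻¹`. -/
def OneForm.inChart (c : OpenPartialHomeomorph M ℂ) (α : OneForm M W) (z : ℂ) : ℂ →ₗ[ℝ] W :=
  (α (c.symm z)).comp
    (ContinuousLinearMap.toLinearMap (mfderiv 𝓘(ℝ, ℂ) 𝓘(ℝ, ℂ) (c.symm : ℂ → M) z))

/-- The coefficient `a` in `α = a dz + b dz̄`. -/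
def OneForm.dz (c : OpenPartialHomeomorph M ℂ) (α : OneForm M W) (z : ℂ) : W :=
  (1 / 2 : ℂ) • (α.inChart c z 1 - Complex.I • α.inChart c z Complex.I)

/-- The coefficient `b` in `α = a dz + b dz̄`. -/
def OneForm.dzbar (c : OpenPartialHomeomorph M ℂ) (α : OneForm M W) (z : ℂ) : W :=
  (1 / 2 : ℂ) • (α.inChart c z 1 + Complex.I • α.inChart c z Complex.I)

/-- `α` is a form of type `(1,0)`. -/
def OneForm.IsType10 (α : OneForm M W) : Prop :=
  ∀ c ∈ atlas ℂ M, ∀ z ∈ c.target, α.dzbar c z = 0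

/-- The one-form `x ↦ P x ∘ α x ∘ Q x` for endomorphism fields `P`, `Q`. -/
def OneForm.sandwich (P Q : M → Mat2) (α : OneForm M Mat2) : OneForm M Mat2 :=
  fun x => (LinearMap.mulLeftRight ℝ (P x, Q x)).comp (α x)

/-- The scalar one-form `θ` times the endomorphism field `S`. -/
def OneForm.scalarMul (θ : OneForm M ℂ) (S : M → Mat2) : OneForm M Mat2 :=
  fun x => ((LinearMap.toSpanSingleton ℂ Mat2 (S x)).restrictScalars ℝ).comp (θ x)

/-- The adjoint `α^{*_h}` for the Hermitian form `h(v,w) = v^* H w`: `α` followed by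
`B ↦ H⁻¹ B^* H`. -/
def OneForm.adj (H : M → Mat2) (α : OneForm M Mat2) : OneForm M Mat2 := fun x =>
  { toFun := fun v => (H x)⁻¹ * (α x v)ᴴ * H x
    map_add' := by
      intro v w
      simp [Matrix.conjTranspose_add, mul_add, add_mul]
    map_smul' := by
      intro r v
      simp [Matrix.conjTranspose_smul] }

/-- Pull-back of a one-form along `π`. -/
def OneForm.pullback {X : Type*} [TopologicalSpace X] [ChartedSpace ℂ X] (π : X → M)
    (α : OneForm M W) : OneForm X W :=
  fun y => (α (π y)).comp (ContinuousLinearMap.toLinearMap (mfderiv 𝓘(ℝ, ℂ) 𝓘(ℝ, ℂ) π y))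

/-- Smoothness of a scalar one-form: its coefficients in holomorphic charts are smooth. -/
def OneForm.Smooth (α : OneForm M ℂ) : Prop :=
  ∀ c ∈ atlas ℂ M, ∀ e : ℂ, ContDiffOn ℝ ∞ (fun z => α.inChart c z e) c.target

/-- Smoothness of an endomorphism-valued one-form, entry by entry. -/
def OneForm.MatSmooth (α : OneForm M Mat2) : Prop :=
  ∀ c ∈ atlas ℂ M, ∀ e : ℂ, ∀ i j, ContDiffOn ℝ ∞ (fun z => α.inChart c z e i j) c.target

/-- Smoothness of a matrix-valued function, entry by entry. -/
def MatSmooth (B : M → Mat2) : Prop :=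
  ∀ i j, ContMDiff 𝓘(ℝ, ℂ) 𝓘(ℝ, ℂ) ∞ (fun x => B x i j)

/-- The differential of a function with values in a normed space. -/
def differential {W : Type*} [NormedAddCommGroup W] [NormedSpace ℝ W] (s : M → W) :
    OneForm M W :=
  fun x => ContinuousLinearMap.toLinearMap (mfderiv 𝓘(ℝ, ℂ) 𝓘(ℝ, W) s x)

/-- The differential of a matrix-valued function, entry by entry. -/
def matDifferential (B : M → Mat2) : OneForm M Mat2 := fun x =>
  { toFun := fun v => Matrix.of fun i j => differential (fun y => B y i j) x v
    map_add' := by intro v w; ext i j; simp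
    map_smul' := by intro r v; ext i j; simp }

/-- The covariant derivative `∇ s = ds + A s` of a section `s` of `M × ℂ²`. -/
def covDeriv (A : OneForm M Mat2) (s : M → Fin 2 → ℂ) : OneForm M (Fin 2 → ℂ) :=
  fun x => differential s x +
    { toFun := fun v => A x v *ᵥ s x
      map_add' := by intro v w; simp [Matrix.add_mulVec]
      map_smul' := by intro r v; simp [Matrix.smul_mulVec] }

end Forms

/-- The Wirtinger derivative `∂u/∂z`, entry by entry. -/
def dWirt (u : ℂ → Mat2) (z : ℂ) : Mat2 := Matrix.of fun i j =>
  (1 / 2 : ℂ) * (fderiv ℝ (fun w => u w i j) z 1 -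
    Complex.I * fderiv ℝ (fun w => u w i j) z Complex.I)

/-- The Wirtinger derivative `∂u/∂z̄`, entry by entry. -/
def dbarWirt (u : ℂ → Mat2) (z : ℂ) : Mat2 := Matrix.of fun i j =>
  (1 / 2 : ℂ) * (fderiv ℝ (fun w => u w i j) z 1 +
    Complex.I * fderiv ℝ (fun w => u w i j) z Complex.I)

/-! ### The self-duality equations -/

section Equations

variable {M : Type*} [TopologicalSpace M] [ChartedSpace ℂ M]

/-- The Hermitian form with Gram matrix `H`, conjugate linear in the first argument. -/
def herm (H : Mat2) (v w : Fin 2 → ℂ) : ℂ := star v ⬝ᵥ (H *ᵥ w)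

/-- Coefficient of `dz ∧ dz̄` in the curvature `F = dA + A ∧ A` of `∇ = d + A`. -/
def curvature (c : OpenPartialHomeomorph M ℂ) (A : OneForm M Mat2) (z : ℂ) : Mat2 :=
  dWirt (A.dzbar c) z - dbarWirt (A.dz c) z + (A.dz c z * A.dzbar c z - A.dzbar c z * A.dz c z)

/-- Coefficient of `dz ∧ dz̄` in `[α ∧ β] = α ∧ β + β ∧ α` for `α` of type `(1,0)` and `β` of type
`(0,1)`. -/
def bracket (c : OpenPartialHomeomorph M ℂ) (α β : OneForm M Mat2) (z : ℂ) : Mat2 :=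
  α.dz c z * β.dzbar c z - β.dzbar c z * α.dz c z

/-- Coefficient of `dz̄ ∧ dz` in `∂̄^∇ Φ`, for `Φ` of type `(1,0)` and `∇ = d + A`. -/
def dbarHiggs (c : OpenPartialHomeomorph M ℂ) (A Φ : OneForm M Mat2) (z : ℂ) : Mat2 :=
  dbarWirt (Φ.dz c) z + (A.dzbar c z * Φ.dz c z - Φ.dz c z * A.dzbar c z)

/-- The self-duality equations `∂̄^∇ Φ = 0`, `F^∇ + [Φ ∧ Φ^{*_h}] = 0` on `M × ℂ²` for a
connection `∇ = d + A`, a Higgs field `Φ` and a (possibly indefinite) Hermitian metric `h` with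
Gram matrix `H`: `∇` is unitary for `h` and induces the trivial connection on the determinant
bundle, and `Φ` is a trace-free `(1,0)`-form. -/
structure IsSelfDual (A Φ : OneForm M Mat2) (H : M → Mat2) : Prop where
  smooth_conn : A.MatSmooth
  smooth_higgs : Φ.MatSmooth
  smooth_metric : MatSmooth H
  hermitian : ∀ x, (H x).IsHermitian
  unitary : ∀ x v, matDifferential H x v = (A x v)ᴴ * H x + H x * A x v
  trace_conn : ∀ x v, (A x v).trace = 0
  trace_higgs : ∀ x v, (Φ x v).trace = 0
  type_higgs : Φ.IsType10
  holomorphic : ∀ c ∈ atlas ℂ M, ∀ z ∈ c.target, dbarHiggs c A Φ z = 0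
  curvature_eq : ∀ c ∈ atlas ℂ M, ∀ z ∈ c.target,
    curvature c A z + bracket c Φ (Φ.adj H) z = 0

/-- Solutions of the `SU(2)` self-duality equations: the metric is positive definite and induces
the trivial metric on the determinant bundle. -/
structure IsSU2Solution (A Φ : OneForm M Mat2) (H : M → Mat2) : Prop
    extends IsSelfDual A Φ H where
  posDef : ∀ x, (H x).PosDef
  det_metric : ∀ x, (H x).det = 1

/-- Solutions of the `SU(1,1)` self-duality equations: the metric has signature `(1,1)` and
determinant `-1`. -/
structure IsSU11Solution (A Φ : OneForm M Mat2) (H : M → Mat2) : Prop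
    extends IsSelfDual A Φ H where
  exists_pos : ∀ x, ∃ v, 0 < (herm (H x) v v).re
  exists_neg : ∀ x, ∃ v, (herm (H x) v v).re < 0
  det_metric : ∀ x, (H x).det = -1

/-- `L` is a holomorphic eigenline bundle of `Φ` with eigenvalue `θ`: a smooth complex line
subbundle of `M × ℂ²`, holomorphic for `∂̄^∇`, on which `Φ` acts by `θ`. -/
structure IsHolomorphicEigenline (A Φ : OneForm M Mat2) (θ : OneForm M ℂ)
    (L : M → Submodule ℂ (Fin 2 → ℂ)) : Prop where
  line : ∀ x, Module.finrank ℂ (L x) = 1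
  /-- locally, there is a smooth nowhere vanishing section `s` of `L` with `∂̄^∇ s ∈ L` -/
  holomorphic : ∀ x, ∃ U : Set M, IsOpen U ∧ x ∈ U ∧ ∃ s : M → Fin 2 → ℂ,
    ContMDiffOn 𝓘(ℝ, ℂ) 𝓘(ℝ, Fin 2 → ℂ) ∞ s U ∧
    ∀ y ∈ U, s y ≠ 0 ∧ s y ∈ L y ∧
      ∀ c ∈ atlas ℂ M, y ∈ c.source → (covDeriv A s).dzbar c (c y) ∈ L y
  eigen : ∀ x v, ∀ w ∈ L x, Φ x v *ᵥ w = θ x v • w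

/-! ### The twist -/

open Classical in
/-- A non-zero vector of `ℓ`, if there is one. -/
def generator (ℓ : Submodule ℂ (Fin 2 → ℂ)) : Fin 2 → ℂ :=
  if hℓ : ∃ v ∈ ℓ, v ≠ 0 then hℓ.choose else 0

/-- The `h`-orthogonal projection `w ↦ (h(v,w) / h(v,v)) v` onto the line `ℓ = ℂ v`, for the
metric `h` with Gram matrix `H`. -/
def orthProj (H : Mat2) (ℓ : Submodule ℂ (Fin 2 → ℂ)) : Mat2 :=
  (herm H (generator ℓ) (generator ℓ))⁻¹ •
    Matrix.vecMulVec (generator ℓ) (star (generator ℓ) ᵥ* H)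

/-- The projection onto `L` along `L^⊥`. -/
def projL (H : M → Mat2) (L : M → Submodule ℂ (Fin 2 → ℂ)) : M → Mat2 :=
  fun x => orthProj (H x) (L x)

/-- The projection onto `L^⊥` along `L`. -/
def projPerp (H : M → Mat2) (L : M → Submodule ℂ (Fin 2 → ℂ)) : M → Mat2 :=
  fun x => 1 - projL H L x

/-- The upper right entry `γ = pr_L ∘ ∇|_{L^⊥}` of `∇ = d + A` with respect to `L ⊕ L^⊥`,
as an endomorphism-valued one-form on `V`. -/
def gammaForm (A : OneForm M Mat2) (H : M → Mat2) (L : M → Submodule ℂ (Fin 2 → ℂ)) :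
    OneForm M Mat2 :=
  (A - matDifferential (projL H L)).sandwich (projL H L) (projPerp H L)

/-- The upper right entry `α = pr_L ∘ Φ|_{L^⊥}` of `Φ` with respect to `L ⊕ L^⊥`. -/
def alphaForm (Φ : OneForm M Mat2) (H : M → Mat2) (L : M → Submodule ℂ (Fin 2 → ℂ)) :
    OneForm M Mat2 :=
  Φ.sandwich (projL H L) (projPerp H L)

/-- The indefinite metric `ĥ = h|_L ⊕ (-h|_{L^⊥})`. -/
def twistMetric (H : M → Mat2) (L : M → Submodule ℂ (Fin 2 → ℂ)) : M → Mat2 :=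
  fun x => H x * (projL H L x - projPerp H L x)

/-- The twisted connection: the off-diagonal part `(γ, -γ^*)` of `∇` is replaced by
`(α, α^*)`. -/
def twistConn (A Φ : OneForm M Mat2) (H : M → Mat2) (L : M → Submodule ℂ (Fin 2 → ℂ)) :
    OneForm M Mat2 :=
  A - gammaForm A H L + (gammaForm A H L).adj H + alphaForm Φ H L + (alphaForm Φ H L).adj H

/-- The twisted Higgs field `(θ, 0; -γ^*, -θ)` with respect to `L ⊕ L^⊥`. -/
def twistHiggs (A : OneForm M Mat2) (θ : OneForm M ℂ) (H : M → Mat2)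
    (L : M → Submodule ℂ (Fin 2 → ℂ)) : OneForm M Mat2 :=
  θ.scalarMul (fun x => projL H L x - projPerp H L x) - (gammaForm A H L).adj H

end Equations

/-! ### Minkowski space, hyperbolic space and de Sitter space -/

/-- The Minkowski inner product on `ℝ^{1,3}`. -/
def mink (x y : Fin 4 → ℝ) : ℝ := -(x 0 * y 0) + x 1 * y 1 + x 2 * y 2 + x 3 * y 3

/-- The Hermitian matrix `(x₀ + x₁, x₂ + i x₃; x₂ - i x₃, x₀ - x₁)` is sent to `x`; this is an
isometry from Hermitian matrices with the quadratic form `-det` to `ℝ^{1,3}`. -/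
def toMink (B : Mat2) : Fin 4 → ℝ :=
  ![((B 0 0).re + (B 1 1).re) / 2, ((B 0 0).re - (B 1 1).re) / 2, (B 0 1).re, (B 0 1).im]

section Maps

variable {X : Type*} [TopologicalSpace X] [ChartedSpace ℂ X]

/-- `g` is a harmonic map into the pseudo-Riemannian hypersurface `{⟨p, p⟩ = ε}` of `ℝ^{1,3}`
(`ε = -1`: hyperbolic space, `ε = 1`: de Sitter space): the tangential part of its Laplacian in
holomorphic coordinates vanishes. -/
structure IsHarmonicInto (ε : ℝ) (g : X → Fin 4 → ℝ) : Prop where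
  smooth : ContMDiff 𝓘(ℝ, ℂ) 𝓘(ℝ, Fin 4 → ℝ) ∞ g
  mapsTo : ∀ y, mink (g y) (g y) = ε
  harmonic : ∀ c ∈ atlas ℂ X, ∀ z ∈ c.target, ∀ T : Fin 4 → ℝ,
    mink (g (c.symm z)) T = 0 → mink (Laplacian.laplacian (g ∘ c.symm) z) T = 0

/-- Partial derivative with respect to `x`, for the holomorphic coordinate `c = x + iy`. -/
def partialX (c : OpenPartialHomeomorph X ℂ) (g : X → Fin 4 → ℝ) (z : ℂ) : Fin 4 → ℝ :=
  fderiv ℝ (g ∘ c.symm) z 1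

/-- Partial derivative with respect to `y`, for the holomorphic coordinate `c = x + iy`. -/
def partialY (c : OpenPartialHomeomorph X ℂ) (g : X → Fin 4 → ℝ) (z : ℂ) : Fin 4 → ℝ :=
  fderiv ℝ (g ∘ c.symm) z Complex.I

/-- The coefficient `⟨g_z, g_z⟩` of the Hopf differential `⟨∂g, ∂g⟩`. -/
def hopf (c : OpenPartialHomeomorph X ℂ) (g : X → Fin 4 → ℝ) (z : ℂ) : ℂ :=
  (1 / 4 : ℂ) *
    (((mink (partialX c g z) (partialX c g z) - mink (partialY c g z) (partialY c g z) : ℝ) : ℂ) -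
      2 * Complex.I * ((mink (partialX c g z) (partialY c g z) : ℝ) : ℂ))

/-- `det (f, N, f_x, f_y)`. -/
def orientationDet (c : OpenPartialHomeomorph X ℂ) (f N : X → Fin 4 → ℝ) (z : ℂ) : ℝ :=
  (Matrix.of ![f (c.symm z), N (c.symm z), partialX c f z, partialY c f z]).det

/-- `N` is an oblique hyperbolic Gauß map of `f : X → ℍ³` with respect to the square root `η` of
the Hopf differential of `f`. The orientation condition `det (f, N, f_x, f_y) > 0` makes sense
where `f` is an immersion; it is required there, and `≥ 0` elsewhere. -/
structure IsObliqueGaussMap (f N : X → Fin 4 → ℝ) (η : OneForm X ℂ) : Prop where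
  smooth_root : η.Smooth
  type_root : η.IsType10
  root : ∀ c ∈ atlas ℂ X, ∀ z ∈ c.target, (η.dz c z) ^ 2 = hopf c f z
  tangent : ∀ y, mink (N y) (f y) = 0
  diff_eq : ∀ y v, ((mink (differential f y v) (N y) : ℝ) : ℂ) = η y v + conj (η y v)
  unit : ∀ y, mink (N y) (N y) = 1
  orient_nonneg : ∀ c ∈ atlas ℂ X, ∀ z ∈ c.target, 0 ≤ orientationDet c f N z
  orient_pos : ∀ c ∈ atlas ℂ X, ∀ z ∈ c.target,
    Function.Injective (differential f (c.symm z)) → 0 < orientationDet c f N z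

/-! ### The equivariant maps associated with a solution -/

variable {M : Type*} [TopologicalSpace M] [ChartedSpace ℂ M]

/-- `π : X → M` is a universal covering of Riemann surfaces. -/
structure IsUniversalCovering (π : X → M) : Prop where
  simplyConnected : SimplyConnectedSpace X
  covering : IsCoveringMap π
  localBiholomorphic : IsLocalDiffeomorph 𝓘(ℂ) 𝓘(ℂ) ω π

/-- The group of deck transformations. -/
def deckGroup (π : X → M) : Subgroup (X ≃ₜ X) where
  carrier := {γ | ∀ y, π (γ y) = π y}
  mul_mem' := by
    intro a b ha hb y
    exact (ha (b y)).trans (hb y)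
  one_mem' := fun _ => rfl
  inv_mem' := by
    intro a ha y
    have h1 := ha (a⁻¹ y)
    have h2 : a (a⁻¹ y) = y := a.apply_symm_apply y
    rw [h2] at h1
    exact h1.symm

/-- `F : X → SL(2, ℂ)` is a parallel frame over `X` for the connection `∇ + Φ + Φ^{*_h}`. -/
structure IsParallelFrame (π : X → M) (A Φ : OneForm M Mat2) (H : M → Mat2) (F : X → Mat2) :
    Prop where
  smooth : MatSmooth F
  det : ∀ y, (F y).det = 1
  parallel : ∀ y v, matDifferential F y v + (A + Φ + Φ.adj H).pullback π y v * F y = 0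

/-- The metric `h` in the frame `F`, as a map into Hermitian matrices. -/
def metricInFrame (π : X → M) (H : M → Mat2) (F : X → Mat2) : X → Mat2 :=
  fun y => (F y)ᴴ * H (π y) * F y

/-- The map into `ℝ^{1,3}` associated with the metric `h` and a parallel frame `F`. -/
def associatedMap (π : X → M) (H : M → Mat2) (F : X → Mat2) : X → Fin 4 → ℝ :=
  fun y => toMink (metricInFrame π H F y)

/-- Equivariance `g (γ y) = ρ(γ⁻¹)^* g(y) ρ(γ⁻¹)` of a map into Hermitian matrices; the group
`SL(2, ℂ)` acts isometrically on Hermitian matrices, from the left, by `B ↦ (a⁻¹)^* B a⁻¹`. -/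
def IsEquivariant (π : X → M) (ρ : deckGroup π →* Matrix.SpecialLinearGroup (Fin 2) ℂ)
    (g : X → Mat2) : Prop :=
  ∀ (γ : deckGroup π) (y : X),
    g (γ.1 y) = ((ρ γ⁻¹ : Matrix.SpecialLinearGroup (Fin 2) ℂ) : Mat2)ᴴ * g y *
      ((ρ γ⁻¹ : Matrix.SpecialLinearGroup (Fin 2) ℂ) : Mat2)

end Maps

end SelfDuality

end

/-!
The twist `(∇, Φ, h) ↦ (∇', Φ', h')` only redistributes the entries of the connection
`∇ + Φ + Φ^*` with respect to `V = L ⊕ L^⊥`, and this is the reason for all the claims.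

Let `P` be the `h`-orthogonal projection onto `L` and `S = P - (1 - P)` the reflection in `L`, so
that `h' = h S` and the adjoint for `h'` is `B ↦ S B^* S`. Then `∇' + Φ' + Φ'^* = ∇ + Φ + Φ^*` by
linear algebra in each fibre (`twist_fibre`), so the two connections have the same parallel
frames. For a unitary connection with `∂̄^∇ Φ = 0`, the curvature of `∇ + Φ + Φ^*` is
`F^∇ + [Φ ∧ Φ^*]`, because the mixed terms are `∂̄^∇ Φ` and its adjoint (`curvature_add`,
`covZ_adj_eq_zero`). Hence the curvature equation passes from one triple to the other, once `∇'`
is unitary for `h'` (`IsSU2Solution.unitary_twistConn`) and `Φ'` is holomorphic for `∇'`. The last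
point (`LocalEigenline.covZbar_twist`) is the only one where a differential equation is used:
holomorphicity of `L` reads `(∂̄P) P = 0`, so that `γ` is of type `(0,1)` and `-γ^*` is `∂P`, and
the lower left entry of the curvature equation of the original triple is an equation for `∂̄∂P`.
Local sections of `L` serve only to see that `P` is smooth and satisfies `(∂̄P) P = 0`; everything
else is done with `P` and the covariant Wirtinger derivatives `covZ` and `covZbar` of endomorphism
fields.

In a parallel frame `F`, a section `h Y` of Hermitian forms becomes `B = F^* h Y F`, and
`∂B = F^* h (∂^∇ Y - Φ Y - Y Φ) F`, similarly for `∂̄`. So for the metric itself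
`∂B = -2 F^* h Φ F` and `∂̄∂B = 2 F^* h (Φ Φ^* + Φ^* Φ) F`. Trace-free `2 × 2` matrices
anticommute up to scalars, hence `∂̄∂B` is a multiple of `B`, that is, normal to the quadric that
contains `B`. This is harmonicity, for both triples at once (`IsSelfDual.isHarmonicInto`).

Finally `⟨F^* h Y F, F^* h Z F⟩ = ½ tr(Y Z)` for trace-free `Z`, and the determinant of four such
vectors is, up to a factor, the imaginary part of the trace of a product. With `f` given by `Y = 1`, `N` by `Y = S`
and `df` by `Y = -2 (Φ + Φ^*)`, the statements on the oblique Gauß map are traces of products of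
matrices in one fibre (`EigenFibre`); in particular `det (f, N, f_x, f_y)` is `4 |α|²`. Where
`α = 0`, the differential `df` is a multiple of the real form `Re θ`, so `f` is not an immersion
there.

The monodromy `ρ` exists because a deck transformation `γ` is holomorphic, so that `F ∘ γ` is
another parallel frame, and `F⁻¹ (F ∘ γ)` has derivative zero on the connected surface `X`.
-/

noncomputable section

namespace SelfDuality

/-! ### Wirtinger calculus for matrix-valued functions -/

/-- Differentiability of a matrix-valued function at a point, entry by entry. -/
def MatDiffAt (u : ℂ → Mat2) (z : ℂ) : Prop :=
  ∀ i j, DifferentiableAt ℝ (fun w => u w i j) z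

/-- Smoothness of a matrix-valued function at a point, entry by entry. -/
def MatContDiffAt (u : ℂ → Mat2) (z : ℂ) : Prop :=
  ∀ i j, ContDiffAt ℝ ∞ (fun w => u w i j) z

/-- The derivative of a matrix-valued function in the direction `e`, entry by entry. -/
def matFderiv (e : ℂ) (u : ℂ → Mat2) (z : ℂ) : Mat2 :=
  Matrix.of fun i j => fderiv ℝ (fun w => u w i j) z e

lemma dWirt_eq (u : ℂ → Mat2) (z : ℂ) :
    dWirt u z = (1 / 2 : ℂ) • (matFderiv 1 u z - Complex.I • matFderiv Complex.I u z) := by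
  ext i j; simp [dWirt, matFderiv]

lemma dbarWirt_eq (u : ℂ → Mat2) (z : ℂ) :
    dbarWirt u z = (1 / 2 : ℂ) • (matFderiv 1 u z + Complex.I • matFderiv Complex.I u z) := by
  ext i j; simp [dbarWirt, matFderiv]

section Smoothness

variable {u v : ℂ → Mat2} {z : ℂ}

lemma MatContDiffAt.matDiffAt (hu : MatContDiffAt u z) : MatDiffAt u z :=
  fun i j => (hu i j).differentiableAt (by simp)

lemma MatDiffAt.conjTranspose (hu : MatDiffAt u z) : MatDiffAt (fun w => (u w)ᴴ) z :=
  fun i j => by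
    have h := Complex.conjCLE.differentiableAt (x := u z j i)
    exact h.comp z (hu j i)

lemma MatDiffAt.mul (hu : MatDiffAt u z) (hv : MatDiffAt v z) :
    MatDiffAt (fun w => u w * v w) z := by
  intro i j
  simp only [Matrix.mul_apply, Fin.sum_univ_two]
  exact ((hu i 0).mul (hv 0 j)).add ((hu i 1).mul (hv 1 j))

lemma MatDiffAt.sub (hu : MatDiffAt u z) (hv : MatDiffAt v z) :
    MatDiffAt (fun w => u w - v w) z := fun i j => (hu i j).sub (hv i j)

lemma MatContDiffAt.mul (hu : MatContDiffAt u z) (hv : MatContDiffAt v z) :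
    MatContDiffAt (fun w => u w * v w) z := by
  intro i j
  simp only [Matrix.mul_apply, Fin.sum_univ_two]
  exact ((hu i 0).mul (hv 0 j)).add ((hu i 1).mul (hv 1 j))

lemma MatContDiffAt.add (hu : MatContDiffAt u z) (hv : MatContDiffAt v z) :
    MatContDiffAt (fun w => u w + v w) z := fun i j => (hu i j).add (hv i j)

lemma MatContDiffAt.sub (hu : MatContDiffAt u z) (hv : MatContDiffAt v z) :
    MatContDiffAt (fun w => u w - v w) z := fun i j => (hu i j).sub (hv i j)

lemma MatContDiffAt.const (C : Mat2) : MatContDiffAt (fun _ => C) z :=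
  fun _ _ => contDiffAt_const

lemma MatContDiffAt.smul {t : ℂ → ℂ} (ht : ContDiffAt ℝ ∞ t z) (hu : MatContDiffAt u z) :
    MatContDiffAt (fun w => t w • u w) z := fun i j => ht.mul (hu i j)

lemma MatContDiffAt.conjTranspose (hu : MatContDiffAt u z) :
    MatContDiffAt (fun w => (u w)ᴴ) z := fun i j => by
  have h := (Complex.conjCLE.contDiff (n := ∞)).contDiffAt (x := u z j i)
  exact h.comp z (hu j i)

lemma MatContDiffAt.congr_of_eventuallyEq (hu : MatContDiffAt u z) (h : v =ᶠ[𝓝 z] u) :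
    MatContDiffAt v z := fun i j =>
  (hu i j).congr_of_eventuallyEq (h.mono fun w hw => by simp only [hw])

lemma MatContDiffAt.matFderiv (hu : MatContDiffAt u z) (e : ℂ) :
    MatContDiffAt (matFderiv e u) z := fun i j =>
  ((hu i j).fderiv_right (m := ∞) (by simp)).clm_apply contDiffAt_const

lemma MatContDiffAt.const_smul (a : ℂ) (hu : MatContDiffAt u z) :
    MatContDiffAt (fun w => a • u w) z := MatContDiffAt.smul contDiffAt_const hu

lemma MatContDiffAt.dWirt (hu : MatContDiffAt u z) : MatContDiffAt (dWirt u) z := by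
  rw [show SelfDuality.dWirt u = _ from funext (dWirt_eq u)]
  exact ((hu.matFderiv 1).sub ((hu.matFderiv _).const_smul _)).const_smul _

lemma MatContDiffAt.dbarWirt (hu : MatContDiffAt u z) : MatContDiffAt (dbarWirt u) z := by
  rw [show SelfDuality.dbarWirt u = _ from funext (dbarWirt_eq u)]
  exact ((hu.matFderiv 1).add ((hu.matFderiv _).const_smul _)).const_smul _

lemma MatContDiffAt.det (hu : MatContDiffAt u z) : ContDiffAt ℝ ∞ (fun w => (u w).det) z := by
  simp only [Matrix.det_fin_two]
  exact ((hu 0 0).mul (hu 1 1)).sub ((hu 0 1).mul (hu 1 0))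

/-- Cramer's rule; the determinant condition keeps `u⁻¹` away from the junk value. -/
lemma MatContDiffAt.inv (hu : MatContDiffAt u z) (h : (u z).det ≠ 0) :
    MatContDiffAt (fun w => (u w)⁻¹) z := by
  simp only [Matrix.inv_def, Ring.inverse_eq_inv']
  refine MatContDiffAt.smul (hu.det.inv h) ?_
  intro i j
  fin_cases i <;> fin_cases j <;> simp [Matrix.adjugate_fin_two] <;>
    first | exact hu _ _ | exact (hu _ _).neg

end Smoothness

section Rules

variable {u v : ℂ → Mat2} {z : ℂ}

lemma matFderiv_mul (hu : MatDiffAt u z) (hv : MatDiffAt v z) (e : ℂ) :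
    matFderiv e (fun w => u w * v w) z = matFderiv e u z * v z + u z * matFderiv e v z := by
  ext i j
  simp only [matFderiv, Matrix.of_apply, Matrix.add_apply, Matrix.mul_apply, Fin.sum_univ_two]
  rw [fderiv_fun_add ((hu i 0).fun_mul (hv 0 j)) ((hu i 1).fun_mul (hv 1 j)),
    fderiv_fun_mul (hu i 0) (hv 0 j), fderiv_fun_mul (hu i 1) (hv 1 j)]
  simp
  ring

lemma matFderiv_add (hu : MatDiffAt u z) (hv : MatDiffAt v z) (e : ℂ) :
    matFderiv e (fun w => u w + v w) z = matFderiv e u z + matFderiv e v z := by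
  ext i j
  simp only [matFderiv, Matrix.of_apply, Matrix.add_apply]
  rw [fderiv_fun_add (hu i j) (hv i j)]; simp

lemma matFderiv_sub (hu : MatDiffAt u z) (hv : MatDiffAt v z) (e : ℂ) :
    matFderiv e (fun w => u w - v w) z = matFderiv e u z - matFderiv e v z := by
  ext i j
  simp only [matFderiv, Matrix.of_apply, Matrix.sub_apply]
  rw [fderiv_fun_sub (hu i j) (hv i j)]; simp

lemma matFderiv_conjTranspose (u : ℂ → Mat2) (z : ℂ) (e : ℂ) :
    matFderiv e (fun w => (u w)ᴴ) z = (matFderiv e u z)ᴴ := by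
  ext i j
  simp only [matFderiv, Matrix.of_apply, Matrix.conjTranspose_apply]
  have h := Complex.conjCLE.comp_fderiv (f := fun w => u w j i) (x := z)
  have h2 := congrArg (fun l => l e) h
  simpa [Function.comp_def] using h2

lemma matFderiv_const (C : Mat2) (e : ℂ) : matFderiv e (fun _ => C) z = 0 := by
  ext i j; simp [matFderiv]

lemma matFderiv_congr (h : u =ᶠ[𝓝 z] v) (e : ℂ) : matFderiv e u z = matFderiv e v z := by
  ext i j
  simp only [matFderiv, Matrix.of_apply]
  have h' : (fun w => u w i j) =ᶠ[𝓝 z] fun w => v w i j := h.mono fun w hw => by simp only [hw]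
  rw [h'.fderiv_eq]

lemma dWirt_mul (hu : MatDiffAt u z) (hv : MatDiffAt v z) :
    dWirt (fun w => u w * v w) z = dWirt u z * v z + u z * dWirt v z := by
  simp only [dWirt_eq, matFderiv_mul hu hv, Matrix.smul_mul, Matrix.mul_smul, sub_mul, mul_sub]
  module

lemma dbarWirt_mul (hu : MatDiffAt u z) (hv : MatDiffAt v z) :
    dbarWirt (fun w => u w * v w) z = dbarWirt u z * v z + u z * dbarWirt v z := by
  simp only [dbarWirt_eq, matFderiv_mul hu hv, Matrix.smul_mul, Matrix.mul_smul, add_mul, mul_add]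
  module

lemma dWirt_add (hu : MatDiffAt u z) (hv : MatDiffAt v z) :
    dWirt (fun w => u w + v w) z = dWirt u z + dWirt v z := by
  simp only [dWirt_eq, matFderiv_add hu hv]; module

lemma dbarWirt_add (hu : MatDiffAt u z) (hv : MatDiffAt v z) :
    dbarWirt (fun w => u w + v w) z = dbarWirt u z + dbarWirt v z := by
  simp only [dbarWirt_eq, matFderiv_add hu hv]; module

lemma dWirt_sub (hu : MatDiffAt u z) (hv : MatDiffAt v z) :
    dWirt (fun w => u w - v w) z = dWirt u z - dWirt v z := by
  simp only [dWirt_eq, matFderiv_sub hu hv]; module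

lemma dbarWirt_sub (hu : MatDiffAt u z) (hv : MatDiffAt v z) :
    dbarWirt (fun w => u w - v w) z = dbarWirt u z - dbarWirt v z := by
  simp only [dbarWirt_eq, matFderiv_sub hu hv]; module

lemma dWirt_conjTranspose (u : ℂ → Mat2) (z : ℂ) :
    dWirt (fun w => (u w)ᴴ) z = (dbarWirt u z)ᴴ := by
  simp [dWirt_eq, dbarWirt_eq, matFderiv_conjTranspose, Matrix.conjTranspose_smul, sub_eq_add_neg]

lemma dbarWirt_conjTranspose (u : ℂ → Mat2) (z : ℂ) :
    dbarWirt (fun w => (u w)ᴴ) z = (dWirt u z)ᴴ := by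
  simp [dWirt_eq, dbarWirt_eq, matFderiv_conjTranspose, Matrix.conjTranspose_smul, sub_eq_add_neg]

lemma dWirt_const (C : Mat2) : dWirt (fun _ => C) z = 0 := by simp [dWirt_eq, matFderiv_const]

lemma dbarWirt_const (C : Mat2) : dbarWirt (fun _ => C) z = 0 := by
  simp [dbarWirt_eq, matFderiv_const]

lemma dWirt_congr (h : u =ᶠ[𝓝 z] v) : dWirt u z = dWirt v z := by
  simp only [dWirt_eq, matFderiv_congr h]

lemma dbarWirt_congr (h : u =ᶠ[𝓝 z] v) : dbarWirt u z = dbarWirt v z := by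
  simp only [dbarWirt_eq, matFderiv_congr h]

/-- Second derivatives are symmetric. -/
lemma matFderiv_comm (hu : MatContDiffAt u z) (d e : ℂ) :
    matFderiv d (matFderiv e u) z = matFderiv e (matFderiv d u) z := by
  ext i j
  simp only [matFderiv, Matrix.of_apply]
  have hsymm : IsSymmSndFDerivAt ℝ (fun w => u w i j) z :=
    ((hu i j).of_le (m := 1 + 1) (by norm_cast)).isSymmSndFDerivAt (by norm_num)
  have hd : DifferentiableAt ℝ (fderiv ℝ (fun w => u w i j)) z :=
    ((hu i j).fderiv_right (m := 1) (by norm_cast)).differentiableAt (by simp)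
  rw [fderiv_clm_apply hd (differentiableAt_const _),
    fderiv_clm_apply hd (differentiableAt_const _)]
  simpa using hsymm d e

lemma matFderiv_const_smul (a : ℂ) (hu : MatDiffAt u z) (e : ℂ) :
    matFderiv e (fun w => a • u w) z = a • matFderiv e u z := by
  ext i j
  simp only [matFderiv, Matrix.of_apply, Matrix.smul_apply]
  rw [fderiv_fun_const_smul (hu i j)]; simp

lemma dWirt_dbarWirt_comm (hu : MatContDiffAt u z) :
    dWirt (dbarWirt u) z = dbarWirt (dWirt u) z := by
  have h1 := (hu.matFderiv 1)
  have hI := (hu.matFderiv Complex.I)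
  have h1' := h1.matDiffAt
  have hI' := (hI.const_smul Complex.I).matDiffAt
  rw [show dbarWirt u = _ from funext (dbarWirt_eq u),
    show dWirt u = _ from funext (dWirt_eq u), dWirt_eq, dbarWirt_eq]
  simp only [matFderiv_const_smul _ (h1.add (hI.const_smul Complex.I)).matDiffAt,
    matFderiv_const_smul _ (h1.sub (hI.const_smul Complex.I)).matDiffAt,
    matFderiv_add h1' hI', matFderiv_sub h1' hI', matFderiv_const_smul _ hI.matDiffAt]
  rw [matFderiv_comm hu Complex.I 1]
  module

end Rules

/-! ### Covariant Wirtinger derivatives of endomorphism fields -/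

/-- The `∂`-part of the covariant derivative of the endomorphism field `u`, for a connection whose
`dz`-coefficient is `a`. -/
def covZ (a u : ℂ → Mat2) (z : ℂ) : Mat2 := dWirt u z + (a z * u z - u z * a z)

/-- The `∂̄`-part of the covariant derivative of the endomorphism field `u`, for a connection whose
`dz̄`-coefficient is `b`. -/
def covZbar (b u : ℂ → Mat2) (z : ℂ) : Mat2 := dbarWirt u z + (b z * u z - u z * b z)

section Cov

variable {a b u v : ℂ → Mat2} {z : ℂ}

lemma covZ_mul (hu : MatDiffAt u z) (hv : MatDiffAt v z) :
    covZ a (fun w => u w * v w) z = covZ a u z * v z + u z * covZ a v z := by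
  simp only [covZ, dWirt_mul hu hv]; noncomm_ring

lemma covZbar_mul (hu : MatDiffAt u z) (hv : MatDiffAt v z) :
    covZbar b (fun w => u w * v w) z = covZbar b u z * v z + u z * covZbar b v z := by
  simp only [covZbar, dbarWirt_mul hu hv]; noncomm_ring

lemma covZ_congr (h : u =ᶠ[𝓝 z] v) : covZ a u z = covZ a v z := by
  simp only [covZ, dWirt_congr h, h.eq_of_nhds]

lemma covZbar_congr (h : u =ᶠ[𝓝 z] v) : covZbar b u z = covZbar b v z := by
  simp only [covZbar, dbarWirt_congr h, h.eq_of_nhds]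

lemma MatContDiffAt.covZ (ha : MatContDiffAt a z) (hu : MatContDiffAt u z) :
    MatContDiffAt (covZ a u) z := hu.dWirt.add ((ha.mul hu).sub (hu.mul ha))

lemma MatContDiffAt.covZbar (hb : MatContDiffAt b z) (hu : MatContDiffAt u z) :
    MatContDiffAt (covZbar b u) z := hu.dbarWirt.add ((hb.mul hu).sub (hu.mul hb))

lemma covZ_zero : covZ a (fun _ => 0) z = 0 := by simp [covZ, dWirt_const]

lemma covZbar_zero : covZbar b (fun _ => 0) z = 0 := by simp [covZbar, dbarWirt_const]

/-- The commutator of the covariant Wirtinger derivatives is the commutator with the curvature. -/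
lemma covZ_covZbar_sub (ha : MatDiffAt a z) (hb : MatDiffAt b z) (hu : MatContDiffAt u z) :
    covZ a (covZbar b u) z - covZbar b (covZ a u) z =
      (dWirt b z - dbarWirt a z + (a z * b z - b z * a z)) * u z -
        u z * (dWirt b z - dbarWirt a z + (a z * b z - b z * a z)) := by
  have hu' := hu.matDiffAt
  have h1 : dWirt (covZbar b u) z = dWirt (dbarWirt u) z +
      ((dWirt b z * u z + b z * dWirt u z) - (dWirt u z * b z + u z * dWirt b z)) := by
    rw [← dWirt_mul hb hu', ← dWirt_mul hu' hb, ← dWirt_sub (hb.mul hu') (hu'.mul hb),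
      ← dWirt_add hu.dbarWirt.matDiffAt ((hb.mul hu').sub (hu'.mul hb))]
    rfl
  have h2 : dbarWirt (covZ a u) z = dbarWirt (dWirt u) z +
      ((dbarWirt a z * u z + a z * dbarWirt u z) - (dbarWirt u z * a z + u z * dbarWirt a z)) := by
    rw [← dbarWirt_mul ha hu', ← dbarWirt_mul hu' ha, ← dbarWirt_sub (ha.mul hu') (hu'.mul ha),
      ← dbarWirt_add hu.dWirt.matDiffAt ((ha.mul hu').sub (hu'.mul ha))]
    rfl
  rw [covZ, covZbar.eq_def b (covZ a u), h1, h2, dWirt_dbarWirt_comm hu]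
  simp only [covZ, covZbar]
  noncomm_ring

/-- For a unitary connection, taking the adjoint with respect to the metric `h` exchanges the two
covariant Wirtinger derivatives; `v` is the adjoint of `u`. -/
lemma mul_covZ_adjoint {h : ℂ → Mat2} (hh : MatDiffAt h z) (hu : MatDiffAt u z)
    (hv : MatDiffAt v z) (hadj : ∀ᶠ w in 𝓝 z, h w * v w = (u w)ᴴ * h w)
    (hd : dWirt h z = (b z)ᴴ * h z + h z * a z) :
    h z * covZ a v z = (covZbar b u z)ᴴ * h z := by
  have hu' : MatDiffAt (fun w => (u w)ᴴ) z := hu.conjTranspose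
  have h1 := dWirt_congr hadj
  rw [dWirt_mul hh hv, dWirt_mul hu' hh, dWirt_conjTranspose, hd] at h1
  have h2 := hadj.self_of_nhds
  simp only [covZ, covZbar, Matrix.conjTranspose_add, Matrix.conjTranspose_sub,
    Matrix.conjTranspose_mul]
  have e1 : h z * dWirt v z = (dbarWirt u z)ᴴ * h z + (u z)ᴴ * ((b z)ᴴ * h z + h z * a z)
    - ((b z)ᴴ * h z + h z * a z) * v z := by rw [← h1]; noncomm_ring
  have e2 : h z * (v z * a z) = (u z)ᴴ * h z * a z := by rw [← h2]; noncomm_ring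
  have e3 : (b z)ᴴ * h z * v z = (b z)ᴴ * ((u z)ᴴ * h z) := by rw [← h2]; noncomm_ring
  rw [mul_add, e1, mul_sub, e2, add_mul, e3]
  noncomm_ring

end Cov

/-! ### Complex manifolds as real manifolds -/

section RealStructure

/-- A Riemann surface is a smooth real surface, with the same charts. -/
theorem isManifold_real (M : Type*) [TopologicalSpace M] [ChartedSpace ℂ M]
    [IsManifold 𝓘(ℂ) ω M] : IsManifold 𝓘(ℝ, ℂ) ∞ M := by
  refine isManifold_of_contDiffOn _ _ _ fun e e' he he' => ?_
  have h := (contDiffGroupoid ω 𝓘(ℂ)).compatible he he'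
  have h1 := (contDiffGroupoid ω 𝓘(ℂ)).mem_of_eqOnSource h (by rfl)
  rw [contDiffGroupoid, mem_groupoid_of_pregroupoid] at h1
  have h2 : ContDiffOn ℂ ω (e.symm ≫ₕ e') (e.symm ≫ₕ e').source := by
    simpa [contDiffPregroupoid] using h1.1
  simpa using (h2.restrict_scalars ℝ).of_le le_top

variable {M X : Type*} [TopologicalSpace M] [ChartedSpace ℂ M]
  [TopologicalSpace X] [ChartedSpace ℂ X]

/-- Holomorphic maps are real smooth. -/
theorem contMDiffAt_real_of_complex {f : X → M} {x : X}
    (hf : ContMDiffAt 𝓘(ℂ) 𝓘(ℂ) ω f x) : ContMDiffAt 𝓘(ℝ, ℂ) 𝓘(ℝ, ℂ) ∞ f x := by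
  rw [contMDiffAt_iff] at hf ⊢
  exact ⟨hf.1, (hf.2.restrict_scalars ℝ).of_le le_top⟩

end RealStructure

/-! ### One-forms in holomorphic charts -/

section Charts

variable {M : Type*} [TopologicalSpace M] [ChartedSpace ℂ M]

section Linear

variable {W : Type*} [AddCommGroup W] [Module ℝ W] (c : OpenPartialHomeomorph M ℂ) (z e : ℂ)

lemma OneForm.inChart_add (α β : OneForm M W) :
    (α + β).inChart c z e = α.inChart c z e + β.inChart c z e := rfl

lemma OneForm.inChart_sub (α β : OneForm M W) :
    (α - β).inChart c z e = α.inChart c z e - β.inChart c z e := rfl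

lemma OneForm.inChart_sandwich (P Q : M → Mat2) (α : OneForm M Mat2) :
    (α.sandwich P Q).inChart c z e = P (c.symm z) * α.inChart c z e * Q (c.symm z) := rfl

lemma OneForm.inChart_scalarMul (θ : OneForm M ℂ) (S : M → Mat2) :
    (θ.scalarMul S).inChart c z e = θ.inChart c z e • S (c.symm z) := rfl

lemma OneForm.inChart_adj (H : M → Mat2) (α : OneForm M Mat2) :
    (α.adj H).inChart c z e = (H (c.symm z))⁻¹ * (α.inChart c z e)ᴴ * H (c.symm z) := rfl

/-- The decomposition `α = a dz + b dz̄`, evaluated on the tangent vector `e`. -/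
lemma OneForm.inChart_eq_dz_add_dzbar [Module ℂ W] [IsScalarTower ℝ ℂ W] (α : OneForm M W) :
    α.inChart c z e = e • α.dz c z + conj e • α.dzbar c z := by
  have h : α.inChart c z e = (e.re : ℂ) • α.inChart c z 1 +
      (e.im : ℂ) • α.inChart c z Complex.I := by
    have h1 : ∀ (r : ℝ) (w : W), (r : ℂ) • w = r • w := fun r w => algebraMap_smul ℂ r w
    rw [h1, h1, ← map_smul, ← map_smul, ← map_add]
    congr 1
    simp
  rw [h, OneForm.dz, OneForm.dzbar]
  have h2 : (e.re : ℂ) = (e + conj e) / 2 := by rw [Complex.add_conj]; push_cast; ring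
  have h3 : (e.im : ℂ) = -Complex.I * (e - conj e) / 2 := by
    rw [Complex.sub_conj]; push_cast; linear_combination (e.im : ℂ) * Complex.I_sq
  rw [h2, h3]
  module

lemma OneForm.dz_add [Module ℂ W] (α β : OneForm M W) :
    (α + β).dz c z = α.dz c z + β.dz c z := by
  simp only [OneForm.dz, OneForm.inChart_add]; module

lemma OneForm.dz_sub [Module ℂ W] (α β : OneForm M W) :
    (α - β).dz c z = α.dz c z - β.dz c z := by
  simp only [OneForm.dz, OneForm.inChart_sub]; module

lemma OneForm.dzbar_add [Module ℂ W] (α β : OneForm M W) :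
    (α + β).dzbar c z = α.dzbar c z + β.dzbar c z := by
  simp only [OneForm.dzbar, OneForm.inChart_add]; module

lemma OneForm.dzbar_sub [Module ℂ W] (α β : OneForm M W) :
    (α - β).dzbar c z = α.dzbar c z - β.dzbar c z := by
  simp only [OneForm.dzbar, OneForm.inChart_sub]; module

lemma OneForm.dz_sandwich (P Q : M → Mat2) (α : OneForm M Mat2) :
    (α.sandwich P Q).dz c z = P (c.symm z) * α.dz c z * Q (c.symm z) := by
  simp only [OneForm.dz, OneForm.inChart_sandwich, Matrix.mul_smul, Matrix.smul_mul, mul_sub,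
    sub_mul]

lemma OneForm.dzbar_sandwich (P Q : M → Mat2) (α : OneForm M Mat2) :
    (α.sandwich P Q).dzbar c z = P (c.symm z) * α.dzbar c z * Q (c.symm z) := by
  simp only [OneForm.dzbar, OneForm.inChart_sandwich, Matrix.mul_smul, Matrix.smul_mul, mul_add,
    add_mul]

lemma OneForm.dz_scalarMul (θ : OneForm M ℂ) (S : M → Mat2) :
    (θ.scalarMul S).dz c z = θ.dz c z • S (c.symm z) := by
  simp only [OneForm.dz, OneForm.inChart_scalarMul, smul_eq_mul]; module

lemma OneForm.dzbar_scalarMul (θ : OneForm M ℂ) (S : M → Mat2) :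
    (θ.scalarMul S).dzbar c z = θ.dzbar c z • S (c.symm z) := by
  simp only [OneForm.dzbar, OneForm.inChart_scalarMul, smul_eq_mul]; module

/-- The adjoint exchanges the types `(1,0)` and `(0,1)`. -/
lemma OneForm.dz_adj (H : M → Mat2) (α : OneForm M Mat2) :
    (α.adj H).dz c z = (H (c.symm z))⁻¹ * (α.dzbar c z)ᴴ * H (c.symm z) := by
  simp [OneForm.dz, OneForm.dzbar, OneForm.inChart_adj, mul_add, add_mul,
    Matrix.conjTranspose_smul, sub_eq_add_neg]

lemma OneForm.dzbar_adj (H : M → Mat2) (α : OneForm M Mat2) :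
    (α.adj H).dzbar c z = (H (c.symm z))⁻¹ * (α.dz c z)ᴴ * H (c.symm z) := by
  simp [OneForm.dz, OneForm.dzbar, OneForm.inChart_adj, mul_add, add_mul,
    Matrix.conjTranspose_smul, sub_eq_add_neg]

end Linear

variable {c : OpenPartialHomeomorph M ℂ} {z : ℂ}

lemma OneForm.matSmooth_iff {α : OneForm M Mat2} :
    α.MatSmooth ↔ ∀ c ∈ atlas ℂ M, ∀ e, ∀ z ∈ c.target,
      MatContDiffAt (fun w => α.inChart c w e) z :=
  ⟨fun h c hc e _ hz i j => (h c hc e i j).contDiffAt (c.open_target.mem_nhds hz),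
    fun h c hc e i j _ hz => (h c hc e _ hz i j).contDiffWithinAt⟩

lemma OneForm.MatSmooth.dz {α : OneForm M Mat2} (hα : α.MatSmooth) (hc : c ∈ atlas ℂ M)
    (hz : z ∈ c.target) : MatContDiffAt (α.dz c) z := by
  rw [OneForm.matSmooth_iff] at hα
  exact ((hα c hc 1 z hz).sub ((hα c hc Complex.I z hz).const_smul _)).const_smul _

lemma OneForm.MatSmooth.dzbar {α : OneForm M Mat2} (hα : α.MatSmooth) (hc : c ∈ atlas ℂ M)
    (hz : z ∈ c.target) : MatContDiffAt (α.dzbar c) z := by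
  rw [OneForm.matSmooth_iff] at hα
  exact ((hα c hc 1 z hz).add ((hα c hc Complex.I z hz).const_smul _)).const_smul _

variable [IsManifold 𝓘(ℂ) ω M]

lemma contMDiffAt_chart_symm (hc : c ∈ atlas ℂ M) (hz : z ∈ c.target) :
    ContMDiffAt 𝓘(ℝ, ℂ) 𝓘(ℝ, ℂ) ∞ (c.symm : ℂ → M) z := by
  have := isManifold_real M
  exact contMDiffAt_symm_of_mem_maximalAtlas (IsManifold.subset_maximalAtlas hc) hz

lemma contMDiffAt_chart (hc : c ∈ atlas ℂ M) {x : M} (hx : x ∈ c.source) :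
    ContMDiffAt 𝓘(ℝ, ℂ) 𝓘(ℝ, ℂ) ∞ (c : M → ℂ) x := by
  have := isManifold_real M
  exact contMDiffAt_of_mem_maximalAtlas (IsManifold.subset_maximalAtlas hc) hx

lemma contMDiffAt_chart_symm_complex (hc : c ∈ atlas ℂ M) (hz : z ∈ c.target) :
    ContMDiffAt 𝓘(ℂ) 𝓘(ℂ) ω (c.symm : ℂ → M) z :=
  contMDiffAt_symm_of_mem_maximalAtlas (IsManifold.subset_maximalAtlas hc) hz

lemma contMDiffAt_chart_complex (hc : c ∈ atlas ℂ M) {x : M} (hx : x ∈ c.source) :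
    ContMDiffAt 𝓘(ℂ) 𝓘(ℂ) ω (c : M → ℂ) x :=
  contMDiffAt_of_mem_maximalAtlas (IsManifold.subset_maximalAtlas hc) hx

/-- Smoothness of a function on a surface, read in the charts of the atlas. -/
lemma contMDiff_iff_chart {E : Type*} [NormedAddCommGroup E] [NormedSpace ℝ E] {g : M → E} :
    ContMDiff 𝓘(ℝ, ℂ) 𝓘(ℝ, E) ∞ g ↔
      ∀ c ∈ atlas ℂ M, ∀ z ∈ c.target, ContDiffAt ℝ ∞ (fun w => g (c.symm w)) z := by
  constructor
  · intro h c hc z hz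
    exact ((h (c.symm z)).comp z (contMDiffAt_chart_symm hc hz)).contDiffAt
  · intro h x
    have hx := mem_chart_source ℂ x
    have h1 := (h _ (chart_mem_atlas ℂ x) _ (mem_chart_target ℂ x)).contMDiffAt.comp x
      (contMDiffAt_chart (chart_mem_atlas ℂ x) hx)
    refine h1.congr_of_eventuallyEq ?_
    filter_upwards [(chartAt ℂ x).open_source.mem_nhds hx] with y hy
    simp [(chartAt ℂ x).left_inv hy]

lemma matSmooth_iff_chart {B : M → Mat2} :
    MatSmooth B ↔ ∀ c ∈ atlas ℂ M, ∀ z ∈ c.target, MatContDiffAt (fun w => B (c.symm w)) z :=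
  ⟨fun h c hc z hz i j => contMDiff_iff_chart.1 (h i j) c hc z hz,
    fun h i j => contMDiff_iff_chart.2 fun c hc z hz => h c hc z hz i j⟩

/-- The differential of a function in a chart is the derivative of its local representative. -/
lemma inChart_differential {E : Type*} [NormedAddCommGroup E] [NormedSpace ℝ E] {g : M → E}
    (hc : c ∈ atlas ℂ M) (hz : z ∈ c.target)
    (hg : MDifferentiableAt 𝓘(ℝ, ℂ) 𝓘(ℝ, E) g (c.symm z)) (e : ℂ) :
    OneForm.inChart c (differential g) z e = fderiv ℝ (fun w => g (c.symm w)) z e := by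
  have h := mfderiv_comp z hg ((contMDiffAt_chart_symm hc hz).mdifferentiableAt (by simp))
  rw [mfderiv_eq_fderiv] at h
  exact (congrArg (fun l => l e) h).symm

lemma inChart_matDifferential {B : M → Mat2} (hB : MatSmooth B) (hc : c ∈ atlas ℂ M)
    (hz : z ∈ c.target) (e : ℂ) :
    OneForm.inChart c (matDifferential B) z e = matFderiv e (fun w => B (c.symm w)) z := by
  ext i j
  exact inChart_differential hc hz (((hB i j) _).mdifferentiableAt (by simp)) e

lemma dz_matDifferential {B : M → Mat2} (hB : MatSmooth B) (hc : c ∈ atlas ℂ M)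
    (hz : z ∈ c.target) :
    OneForm.dz c (matDifferential B) z = dWirt (fun w => B (c.symm w)) z := by
  simp only [OneForm.dz, inChart_matDifferential hB hc hz, dWirt_eq]

lemma dzbar_matDifferential {B : M → Mat2} (hB : MatSmooth B) (hc : c ∈ atlas ℂ M)
    (hz : z ∈ c.target) :
    OneForm.dzbar c (matDifferential B) z = dbarWirt (fun w => B (c.symm w)) z := by
  simp only [OneForm.dzbar, inChart_matDifferential hB hc hz, dbarWirt_eq]

/-- Every tangent vector is a coordinate vector, so pointwise statements about one-forms can be
checked in charts. -/
lemma exists_inChart (x : M) (v : TangentSpace 𝓘(ℝ, ℂ) x) :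
    ∃ c ∈ atlas ℂ M, ∃ z ∈ c.target, ∃ e : ℂ, c.symm z = x ∧
      ∀ (W : Type) [AddCommGroup W] [Module ℝ W] (α : OneForm M W),
        α x v = α.inChart c z e := by
  have hx := mem_chart_source ℂ x
  set c := chartAt ℂ x with hcdef
  have hc : c ∈ atlas ℂ M := chart_mem_atlas ℂ x
  have hz : c x ∈ c.target := mem_chart_target ℂ x
  have hxx : c.symm (c x) = x := c.left_inv hx
  refine ⟨c, hc, c x, hz, mfderiv 𝓘(ℝ, ℂ) 𝓘(ℝ, ℂ) c x v, hxx, ?_⟩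
  intro W _ _ α
  have h1 := mfderiv_comp x ((contMDiffAt_chart_symm hc hz).mdifferentiableAt (by simp))
    ((contMDiffAt_chart hc hx).mdifferentiableAt (by simp))
  have h2 : (c.symm ∘ c : M → M) =ᶠ[𝓝 x] id := by
    filter_upwards [c.open_source.mem_nhds hx] with y hy
    simp [c.left_inv hy]
  rw [h2.mfderiv_eq, mfderiv_id] at h1
  have h3 := congrArg (fun l => l v) h1
  have key : ∀ y : M, y = x → ∀ (u : ℂ), u = v → (α x : ℂ →ₗ[ℝ] W) v = (α y : ℂ →ₗ[ℝ] W) u := by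
    rintro y rfl u rfl; rfl
  exact key _ hxx _ h3.symm

end Charts

/-! ### The twist in a holomorphic coordinate -/

/-- Cayley–Hamilton for `B * X`, divided by `X`. -/
lemma mul_mul_self_of_det_eq_zero {B : Mat2} (hB : B.det = 0) (X : Mat2) :
    B * X * B = (B * X).trace • B := by
  rw [Matrix.det_fin_two] at hB
  ext i j
  fin_cases i <;> fin_cases j <;>
    simp [Matrix.mul_apply, Fin.sum_univ_two, Matrix.trace_fin_two]
  · linear_combination (-X 1 1) * hB
  · linear_combination (X 0 1) * hB
  · linear_combination (X 1 0) * hB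
  · linear_combination (-X 0 0) * hB

/-- A trace-free endomorphism acting by `t` on the image of a rank one projection `p` acts by `-t`
on the quotient. -/
lemma one_sub_mul_of_eigen {p φ : Mat2} {t : ℂ} (hp : p * p = p) (htr : p.trace = 1)
    (hdet : p.det = 0) (hφ : φ * p = t • p) (hφ0 : φ.trace = 0) :
    (1 - p) * φ = -(t • (1 - p)) := by
  have hq : (1 - p).det = 0 := by
    rw [Matrix.det_fin_two] at hdet ⊢
    rw [Matrix.trace_fin_two] at htr
    simp
    linear_combination hdet - htr
  have h1 := mul_mul_self_of_det_eq_zero hq φ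
  have h2 : (1 - p) * φ * p = 0 := by
    rw [mul_assoc, hφ, Matrix.mul_smul, sub_mul, one_mul, hp, sub_self, smul_zero]
  have h3 : ((1 - p) * φ).trace = -t := by
    rw [Matrix.trace_mul_comm, mul_sub, hφ, mul_one, Matrix.trace_sub, Matrix.trace_smul, htr, hφ0]
    simp
  rw [h3, mul_sub, h2] at h1
  simpa using h1

/-- A Higgs field with holomorphic eigenline, written in a holomorphic coordinate on `U`: `a`, `b`
are the coefficients of the unitary connection for the metric `h`, `φ` and `ψ` those of the Higgs
field and of its adjoint, `p` is the orthogonal projection onto the eigenline and `t` the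
coefficient of the eigenvalue. The field `dbar_p` says that the eigenline is holomorphic. -/
structure LocalEigenline (U : Set ℂ) (a b h φ ψ p : ℂ → Mat2) (t : ℂ → ℂ) : Prop where
  isOpen : IsOpen U
  smooth_a : ∀ z ∈ U, MatContDiffAt a z
  smooth_b : ∀ z ∈ U, MatContDiffAt b z
  smooth_h : ∀ z ∈ U, MatContDiffAt h z
  smooth_φ : ∀ z ∈ U, MatContDiffAt φ z
  smooth_p : ∀ z ∈ U, MatContDiffAt p z
  det_h : ∀ z ∈ U, (h z).det ≠ 0
  unitary : ∀ z ∈ U, dWirt h z = (b z)ᴴ * h z + h z * a z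
  idem : ∀ z ∈ U, p z * p z = p z
  selfAdjoint : ∀ z ∈ U, h z * p z = (p z)ᴴ * h z
  eigen : ∀ z ∈ U, φ z * p z = t z • p z
  coeigen : ∀ z ∈ U, (1 - p z) * φ z = -(t z • (1 - p z))
  dbar_p : ∀ z ∈ U, covZbar b p z * p z = 0
  holomorphic : ∀ z ∈ U, covZbar b φ z = 0
  curvature : ∀ z ∈ U, dWirt b z - dbarWirt a z + (a z * b z - b z * a z) +
    (φ z * ψ z - ψ z * φ z) = 0

namespace LocalEigenline

variable {U : Set ℂ} {a b h φ ψ p : ℂ → Mat2} {t : ℂ → ℂ} {z : ℂ}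

lemma isUnit_h (D : LocalEigenline U a b h φ ψ p t) (hz : z ∈ U) : IsUnit (h z) :=
  (Matrix.isUnit_iff_isUnit_det _).2 (isUnit_iff_ne_zero.2 (D.det_h z hz))

/-- The adjoint of `∂̄p` is `∂p`. -/
lemma mul_covZ_p (D : LocalEigenline U a b h φ ψ p t) (hz : z ∈ U) :
    h z * covZ a p z = (covZbar b p z)ᴴ * h z := by
  refine mul_covZ_adjoint (D.smooth_h z hz).matDiffAt (D.smooth_p z hz).matDiffAt
    (D.smooth_p z hz).matDiffAt ?_ (D.unitary z hz)
  filter_upwards [D.isOpen.mem_nhds hz] with w hw using D.selfAdjoint w hw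

/-- The line `L^⊥` is preserved by `∂`, being orthogonal to the holomorphic line `L`. -/
lemma p_mul_covZ (D : LocalEigenline U a b h φ ψ p t) (hz : z ∈ U) :
    p z * covZ a p z = 0 := by
  have h1 : h z * (p z * covZ a p z) = (covZbar b p z * p z)ᴴ * h z := by
    rw [← mul_assoc, D.selfAdjoint z hz, mul_assoc, D.mul_covZ_p hz, Matrix.conjTranspose_mul,
      mul_assoc]
  rw [D.dbar_p z hz, Matrix.conjTranspose_zero, zero_mul] at h1
  exact (D.isUnit_h hz).mul_right_eq_zero.1 h1

/-- Together with `p_mul_covZ`: `∂p` maps `L` to `L^⊥` and annihilates `L^⊥`, so that it is the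
second fundamental form of `L`, up to sign `γ^*`. -/
lemma covZ_mul_p (D : LocalEigenline U a b h φ ψ p t) (hz : z ∈ U) :
    covZ a p z * p z = covZ a p z := by
  have h1 : covZ a (fun w => p w * p w) z = covZ a p z := by
    refine covZ_congr ?_
    filter_upwards [D.isOpen.mem_nhds hz] with w hw using D.idem w hw
  rwa [covZ_mul (D.smooth_p z hz).matDiffAt (D.smooth_p z hz).matDiffAt, D.p_mul_covZ hz,
    add_zero] at h1

lemma p_mul_covZbar (D : LocalEigenline U a b h φ ψ p t) (hz : z ∈ U) :
    p z * covZbar b p z = covZbar b p z := by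
  have h1 : covZbar b (fun w => p w * p w) z = covZbar b p z := by
    refine covZbar_congr ?_
    filter_upwards [D.isOpen.mem_nhds hz] with w hw using D.idem w hw
  rwa [covZbar_mul (D.smooth_p z hz).matDiffAt (D.smooth_p z hz).matDiffAt, D.dbar_p z hz,
    zero_add] at h1

/-- The lower left entry of the curvature equation, as an equation for the second fundamental form
of the eigenline. -/
lemma covZbar_covZ (D : LocalEigenline U a b h φ ψ p t) (hz : z ∈ U) :
    covZbar b (covZ a p) z +
      (covZbar b p z * covZ a p z - covZ a p z * covZbar b p z) +
      (2 * t z) • ((1 - p z) * ψ z * p z) = 0 := by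
  have ha := D.smooth_a z hz
  have hb := D.smooth_b z hz
  have hp := D.smooth_p z hz
  have hU := D.isOpen.mem_nhds hz
  have hd := (ha.covZ hp).matDiffAt
  have he := (hb.covZbar hp).matDiffAt
  have hF := covZ_covZbar_sub ha.matDiffAt hb.matDiffAt hp
  rw [eq_neg_of_add_eq_zero_left (D.curvature z hz)] at hF
  have k1 : covZbar b (covZ a p) z = covZbar b (covZ a p) z * p z + covZ a p z * covZbar b p z := by
    rw [← covZbar_mul hd hp.matDiffAt]
    refine covZbar_congr ?_
    filter_upwards [hU] with w hw using (D.covZ_mul_p hw).symm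
  have k2 : covZbar b p z * covZ a p z + p z * covZbar b (covZ a p) z = 0 := by
    rw [← covZbar_mul hp.matDiffAt hd, ← covZbar_zero (b := b) (z := z)]
    refine covZbar_congr ?_
    filter_upwards [hU] with w hw using D.p_mul_covZ hw
  have k3 : covZ a (covZbar b p) z * p z + covZbar b p z * covZ a p z = 0 := by
    rw [← covZ_mul he hp.matDiffAt, ← covZ_zero (a := a) (z := z)]
    refine covZ_congr ?_
    filter_upwards [hU] with w hw using D.dbar_p w hw
  have k4 := D.covZ_mul_p hz
  have k5 := D.p_mul_covZbar hz
  have k6 := D.eigen z hz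
  have k7 := D.coeigen z hz
  have k8 := D.idem z hz
  generalize covZbar b (covZ a p) z = ed at *
  generalize covZ a (covZbar b p) z = de at *
  generalize covZ a p z = d at *
  generalize covZbar b p z = e at *
  generalize p z = p at *
  generalize φ z = f at *
  generalize ψ z = g at *
  generalize t z = s at *
  have q1 : (1 - p) * ed * p = (1 - p) * (f * g - g * f) * p := by
    have : ed = de - (-(f * g - g * f) * p - p * -(f * g - g * f)) := by rw [← hF]; abel
    have h1 : (1 - p) * de * p = 0 := by
      rw [mul_assoc, eq_neg_of_add_eq_zero_left k3, mul_neg, ← mul_assoc, sub_mul, one_mul, k5,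
        sub_self, zero_mul, neg_zero]
    have h2 : (1 - p) * p = 0 := by rw [sub_mul, one_mul, k8, sub_self]
    calc (1 - p) * ed * p = (1 - p) * de * p + (1 - p) * (f * g - g * f) * (p * p)
          - ((1 - p) * p) * (f * g - g * f) * p := by rw [this]; noncomm_ring
      _ = _ := by rw [h1, h2, k8]; simp
  have q2 : (1 - p) * (f * g - g * f) * p = -((2 * s) • ((1 - p) * g * p)) := by
    calc (1 - p) * (f * g - g * f) * p = ((1 - p) * f) * g * p - (1 - p) * g * (f * p) := by
          noncomm_ring
      _ = _ := by
        rw [k6, k7]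
        simp only [Matrix.smul_mul, Matrix.mul_smul, neg_mul]
        module
  have q3 : p * ed * p = -(e * d) := by
    rw [eq_neg_of_add_eq_zero_right k2, neg_mul, mul_assoc, k4]
  have q4 : ed * p = -(e * d) - (2 * s) • ((1 - p) * g * p) := by
    have : ed * p = p * ed * p + (1 - p) * ed * p := by noncomm_ring
    rw [this, q3, q1, q2]; abel
  rw [k1, q4]
  abel

/-- The twisted Higgs field `(t, 0; ∂p, -t)` is holomorphic for the twisted connection, whose
`dz̄`-coefficient is `b + ∂̄p + α^*`. -/
theorem covZbar_twist (D : LocalEigenline U a b h φ ψ p t) (hz : z ∈ U) {b' φ' : ℂ → Mat2}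
    (hb' : b' z = b z + covZbar b p z + (1 - p z) * ψ z * p z)
    (hφ' : ∀ w ∈ U, φ' w = t w • (p w - (1 - p w)) + covZ a p w) :
    covZbar b' φ' z = 0 := by
  have ha := D.smooth_a z hz
  have hp := D.smooth_p z hz
  have hf := D.smooth_φ z hz
  have hU := D.isOpen.mem_nhds hz
  -- `t • (p - q)` is rewritten through `φ`, so that no derivative of `t` is needed
  have h2 : φ' =ᶠ[𝓝 z] fun w => φ w * p w + (1 - p w) * φ w + covZ a p w := by
    filter_upwards [hU] with w hw
    rw [hφ' w hw, D.eigen w hw, D.coeigen w hw]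
    module
  have hq : MatContDiffAt (fun w => 1 - p w) z := (MatContDiffAt.const 1).sub hp
  have h3 : dbarWirt φ' z = dbarWirt φ z * p z + φ z * dbarWirt p z +
      (-dbarWirt p z * φ z + (1 - p z) * dbarWirt φ z) + dbarWirt (covZ a p) z := by
    rw [dbarWirt_congr h2,
      dbarWirt_add ((hf.mul hp).add (hq.mul hf)).matDiffAt (ha.covZ hp).matDiffAt,
      dbarWirt_add (hf.mul hp).matDiffAt (hq.mul hf).matDiffAt,
      dbarWirt_mul hf.matDiffAt hp.matDiffAt, dbarWirt_mul hq.matDiffAt hf.matDiffAt,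
      dbarWirt_sub (MatContDiffAt.const 1).matDiffAt hp.matDiffAt, dbarWirt_const, zero_sub]
  have h4 : dbarWirt φ z = -(b z * φ z - φ z * b z) :=
    eq_neg_of_add_eq_zero_left (D.holomorphic z hz)
  have h5 : dbarWirt p z = covZbar b p z - (b z * p z - p z * b z) := by rw [covZbar]; abel
  have h6 : dbarWirt (covZ a p) z =
      covZbar b (covZ a p) z - (b z * covZ a p z - covZ a p z * b z) := by
    rw [covZbar.eq_def b (covZ a p)]; abel
  have key := D.covZbar_covZ hz
  have k4 := D.covZ_mul_p hz
  have k9 := D.p_mul_covZ hz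
  have k5 := D.p_mul_covZbar hz
  have k10 := D.dbar_p z hz
  have k6 := D.eigen z hz
  have k7 := D.coeigen z hz
  have k8 := D.idem z hz
  have h7 : φ' z = φ z * p z + (1 - p z) * φ z + covZ a p z := h2.self_of_nhds
  rw [covZbar, h3, h7, h4, h5, h6, hb']
  generalize covZbar b (covZ a p) z = ed at *
  generalize covZ a p z = d at *
  generalize covZbar b p z = e at *
  generalize p z = p at *
  generalize φ z = f at *
  generalize ψ z = g at *
  generalize t z = s at *
  have m1 : f * e = s • e := by rw [← k5, ← mul_assoc, k6, Matrix.smul_mul]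
  have m2 : e * f = -(s • e) := by
    have : e * f = e * p * f + e * ((1 - p) * f) := by noncomm_ring
    rw [this, k7, k10, mul_neg, Matrix.mul_smul, mul_sub, k10]
    simp
  have m3 : (1 - p) * p = 0 := by rw [sub_mul, one_mul, k8, sub_self]
  have m4 : p * (1 - p) = 0 := by rw [mul_sub, mul_one, k8, sub_self]
  have m5 : (1 - p) * (1 - p) = 1 - p := by rw [mul_sub, m3, mul_one, sub_zero]
  set β := (1 - p) * g * p with hβ
  have n1 : β * p = β := by rw [hβ, mul_assoc, k8]
  have n2 : (1 - p) * β = β := by rw [hβ, ← mul_assoc, ← mul_assoc, m5]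
  have n3 : p * β = 0 := by rw [hβ, ← mul_assoc, ← mul_assoc, m4]; simp
  have n4 : β * d = 0 := by rw [← n1, mul_assoc, k9, mul_zero]
  have n5 : d * β = 0 := by rw [← k4, mul_assoc, n3, mul_zero]
  have n6 : β * (f * p) = s • β := by rw [k6, Matrix.mul_smul, n1]
  have n7 : β * ((1 - p) * f) = 0 := by rw [k7, mul_neg, Matrix.mul_smul, mul_sub, n1]; simp
  have n8 : f * p * β = 0 := by rw [mul_assoc, n3, mul_zero]
  have n9 : (1 - p) * f * β = -(s • β) := by rw [k7, neg_mul, Matrix.smul_mul, n2]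
  have n10 : e * (f * p) = 0 := by rw [k6, Matrix.mul_smul, k10, smul_zero]
  have n11 : e * ((1 - p) * f) = e * f := by
    rw [← mul_assoc, mul_sub, k10]; simp
  have n12 : f * p * e = f * e := by rw [mul_assoc, k5]
  have n13 : (1 - p) * f * e = 0 := by
    rw [k7, neg_mul, Matrix.smul_mul, sub_mul, k5]; simp
  calc _ = ed + (e * d - d * e) + f * e - e * f + (β * d - d * β)
        + (β * (f * p) + β * ((1 - p) * f) - f * p * β - (1 - p) * f * β)
        + (e * (f * p) + e * ((1 - p) * f) - f * p * e - (1 - p) * f * e) := by noncomm_ring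
    _ = ed + (e * d - d * e) + (2 * s) • β := by
      rw [n4, n5, n6, n7, n8, n9, n10, n11, n12, n13]
      module
    _ = 0 := key

end LocalEigenline

/-! ### Hermitian matrices and Minkowski space -/

lemma toMink_add (B C : Mat2) : toMink (B + C) = toMink B + toMink C := by
  ext i; fin_cases i <;> simp [toMink] <;> ring

lemma toMink_smul (r : ℝ) (B : Mat2) : toMink ((r : ℂ) • B) = r • toMink B := by
  ext i; fin_cases i <;> simp [toMink] <;> ring

lemma exists_eq_of_isHermitian {B : Mat2} (hB : B.IsHermitian) : ∃ x0 x1 x2 x3 : ℝ,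
    B = !![(x0 + x1 : ℂ), x2 + x3 * Complex.I; x2 - x3 * Complex.I, (x0 - x1 : ℂ)] := by
  refine ⟨((B 0 0).re + (B 1 1).re) / 2, ((B 0 0).re - (B 1 1).re) / 2, (B 0 1).re, (B 0 1).im, ?_⟩
  have b0 := Complex.conj_eq_iff_re.1 (hB.apply 0 0)
  have b1 := Complex.conj_eq_iff_re.1 (hB.apply 1 1)
  have b2 := hB.apply 1 0
  ext i j
  fin_cases i <;> fin_cases j
  · simp [b0, b1]; ring
  · simp
  · change B 1 0 = _
    rw [← b2]
    apply Complex.ext <;> simp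
  · simp [b0, b1]; ring

/-- The Minkowski product is the polarization of `-det`. -/
lemma mink_toMink {B C : Mat2} (hB : B.IsHermitian) (hC : C.IsHermitian) :
    ((mink (toMink B) (toMink C) : ℝ) : ℂ) = -(1 / 2) * (B * C.adjugate).trace := by
  obtain ⟨x0, x1, x2, x3, rfl⟩ := exists_eq_of_isHermitian hB
  obtain ⟨y0, y1, y2, y3, rfl⟩ := exists_eq_of_isHermitian hC
  simp [mink, toMink, Matrix.trace_fin_two, Matrix.adjugate_fin_two]
  linear_combination (x3 * y3 : ℂ) * Complex.I_sq

/-- Congruence by a matrix of determinant one preserves `tr (B adj C)`. -/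
lemma trace_congruence {F h Y Z : Mat2} (hF : F.det = 1) :
    ((Fᴴ * (h * Y) * F) * (Fᴴ * (h * Z) * F).adjugate).trace =
      h.det * (Y * Z.adjugate).trace := by
  have h1 : F * F.adjugate = 1 := by rw [Matrix.mul_adjugate, hF, one_smul]
  have h2 : Fᴴ.adjugate * Fᴴ = 1 := by
    rw [Matrix.adjugate_mul, Matrix.det_conjTranspose, hF]; simp
  rw [Matrix.adjugate_mul_distrib, Matrix.adjugate_mul_distrib, Matrix.adjugate_mul_distrib]
  calc _ = ((Fᴴ * (h * Y) * (F * F.adjugate) * (Z.adjugate * h.adjugate)) * Fᴴ.adjugate).trace := by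
        congr 1; noncomm_ring
    _ = ((Fᴴ.adjugate * Fᴴ) * (h * Y) * (Z.adjugate * h.adjugate)).trace := by
        rw [h1, Matrix.trace_mul_comm]; congr 1; noncomm_ring
    _ = (h.adjugate * h * (Y * Z.adjugate)).trace := by
        rw [h2, show (1 : Mat2) * (h * Y) * (Z.adjugate * h.adjugate) =
            (h * Y * Z.adjugate) * h.adjugate by noncomm_ring, Matrix.trace_mul_comm]
        congr 1; noncomm_ring
    _ = _ := by rw [Matrix.adjugate_mul, Matrix.smul_mul, one_mul, Matrix.trace_smul, smul_eq_mul]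

lemma adjugate_of_trace_eq_zero {Y : Mat2} (hY : Y.trace = 0) : Y.adjugate = -Y := by
  rw [Matrix.trace_fin_two] at hY
  ext i j
  fin_cases i <;> fin_cases j <;> simp [Matrix.adjugate_fin_two]
  · linear_combination hY
  · linear_combination hY

/-- Trace-free matrices anticommute up to scalars. -/
lemma mul_add_mul_of_trace_eq_zero {B C : Mat2} (hB : B.trace = 0) (hC : C.trace = 0) :
    B * C + C * B = (B * C).trace • 1 := by
  rw [Matrix.trace_fin_two] at hB hC
  ext i j
  fin_cases i <;> fin_cases j <;>
    simp [Matrix.mul_apply, Fin.sum_univ_two, Matrix.trace_fin_two]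
  · linear_combination C 0 0 * hB - B 1 1 * hC
  · linear_combination C 0 1 * hB + B 0 1 * hC
  · linear_combination C 1 0 * hB + B 1 0 * hC
  · linear_combination C 1 1 * hB - B 0 0 * hC

/-- The determinant of four Hermitian matrices, as vectors of `ℝ^{1,3}`. -/
lemma det_toMink {B₀ B₁ B₂ B₃ : Mat2} (h₀ : B₀.IsHermitian) (h₁ : B₁.IsHermitian)
    (h₂ : B₂.IsHermitian) (h₃ : B₃.IsHermitian) :
    (Matrix.of ![toMink B₀, toMink B₁, toMink B₂, toMink B₃]).det =
      -(1 / 2) * ((B₀ * B₁.adjugate * B₂ * B₃.adjugate).trace).im := by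
  obtain ⟨x0, x1, x2, x3, rfl⟩ := exists_eq_of_isHermitian h₀
  obtain ⟨y0, y1, y2, y3, rfl⟩ := exists_eq_of_isHermitian h₁
  obtain ⟨z0, z1, z2, z3, rfl⟩ := exists_eq_of_isHermitian h₂
  obtain ⟨w0, w1, w2, w3, rfl⟩ := exists_eq_of_isHermitian h₃
  simp [Matrix.det_succ_row_zero, Fin.sum_univ_succ, toMink, Matrix.adjugate_fin_two,
    Matrix.trace_fin_two, Fin.succAbove]
  ring

/-! ### Derivatives of maps into Minkowski space -/

section Deriv

variable {B : ℂ → Mat2} {z : ℂ}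

lemma MatDiffAt.toMink (hB : MatDiffAt B z) :
    DifferentiableAt ℝ (fun w => toMink (B w)) z := by
  have hre : ∀ i j, DifferentiableAt ℝ (fun w => (B w i j).re) z := fun i j =>
    Complex.reCLM.differentiableAt.comp z (hB i j)
  have him : ∀ i j, DifferentiableAt ℝ (fun w => (B w i j).im) z := fun i j =>
    Complex.imCLM.differentiableAt.comp z (hB i j)
  rw [differentiableAt_pi]
  intro k
  fin_cases k
  · exact ((hre 0 0).fun_add (hre 1 1)).mul_const (2 : ℝ)⁻¹
  · exact ((hre 0 0).fun_sub (hre 1 1)).mul_const (2 : ℝ)⁻¹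
  · exact hre 0 1
  · exact him 0 1

lemma MatContDiffAt.toMink (hB : MatContDiffAt B z) :
    ContDiffAt ℝ ∞ (fun w => toMink (B w)) z := by
  have hre : ∀ i j, ContDiffAt ℝ ∞ (fun w => (B w i j).re) z := fun i j =>
    Complex.reCLM.contDiff.contDiffAt.comp z (hB i j)
  have him : ∀ i j, ContDiffAt ℝ ∞ (fun w => (B w i j).im) z := fun i j =>
    Complex.imCLM.contDiff.contDiffAt.comp z (hB i j)
  rw [contDiffAt_pi]
  intro k
  fin_cases k
  · exact ((hre 0 0).add (hre 1 1)).div_const 2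
  · exact ((hre 0 0).sub (hre 1 1)).div_const 2
  · exact hre 0 1
  · exact him 0 1

lemma fderiv_toMink (hB : MatDiffAt B z) (e : ℂ) :
    fderiv ℝ (fun w => toMink (B w)) z e = toMink (matFderiv e B z) := by
  have hre : ∀ i j, HasFDerivAt (fun w => (B w i j).re)
      (Complex.reCLM.comp (fderiv ℝ (fun w => B w i j) z)) z := fun i j =>
    Complex.reCLM.hasFDerivAt.comp z (hB i j).hasFDerivAt
  have him : ∀ i j, HasFDerivAt (fun w => (B w i j).im)
      (Complex.imCLM.comp (fderiv ℝ (fun w => B w i j) z)) z := fun i j =>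
    Complex.imCLM.hasFDerivAt.comp z (hB i j).hasFDerivAt
  have h0 := (((hre 0 0).fun_add (hre 1 1)).mul_const (2 : ℝ)⁻¹).fderiv
  have h1 := (((hre 0 0).fun_sub (hre 1 1)).mul_const (2 : ℝ)⁻¹).fderiv
  ext k
  have hk := fderiv_apply hB.toMink k
  rw [show (fderiv ℝ (fun w => SelfDuality.toMink (B w)) z e) k
    = fderiv ℝ (fun w => SelfDuality.toMink (B w) k) z e by rw [hk]; rfl]
  fin_cases k
  · refine (congrArg (fun l => l e) h0).trans ?_
    simp [SelfDuality.toMink, matFderiv]; ring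
  · refine (congrArg (fun l => l e) h1).trans ?_
    simp [SelfDuality.toMink, matFderiv]; ring
  · exact congrArg (fun l => l e) (hre 0 1).fderiv
  · exact congrArg (fun l => l e) (him 0 1).fderiv

/-- The Laplacian is `4 ∂̄∂`. -/
lemma laplacian_toMink {U : Set ℂ} (hU : IsOpen U) (hB : ∀ w ∈ U, MatContDiffAt B w)
    (hz : z ∈ U) :
    Laplacian.laplacian (fun w => toMink (B w)) z = toMink ((4 : ℂ) • dbarWirt (dWirt B) z) := by
  have h1 : ∀ e : ℂ, (fun w => fderiv ℝ (fun w => toMink (B w)) w e) =ᶠ[𝓝 z]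
      fun w => toMink (matFderiv e B w) := fun e => by
    filter_upwards [hU.mem_nhds hz] with w hw using fderiv_toMink (hB w hw).matDiffAt e
  have hd : DifferentiableAt ℝ (fderiv ℝ (fun w => toMink (B w))) z :=
    ((hB z hz).toMink.fderiv_right (m := 1) (by norm_cast)).differentiableAt (by simp)
  have h2 : ∀ e : ℂ, iteratedFDeriv ℝ 2 (fun w => toMink (B w)) z ![e, e] =
      toMink (matFderiv e (matFderiv e B) z) := fun e => by
    rw [iteratedFDeriv_two_apply, ← fderiv_toMink ((hB z hz).matFderiv e).matDiffAt,
      ← (h1 e).fderiv_eq, fderiv_clm_apply hd (differentiableAt_const _)]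
    simp
  rw [InnerProductSpace.laplacian_eq_iteratedFDeriv_complexPlane]
  simp only [h2, ← toMink_add]
  congr 1
  have k1 := (hB z hz).matFderiv 1
  have kI := (hB z hz).matFderiv Complex.I
  rw [show dWirt B = _ from funext (dWirt_eq B), dbarWirt_eq]
  simp only [matFderiv_const_smul _ (k1.sub (kI.const_smul Complex.I)).matDiffAt,
    matFderiv_sub k1.matDiffAt (kI.const_smul Complex.I).matDiffAt,
    matFderiv_const_smul _ kI.matDiffAt]
  rw [matFderiv_comm (hB z hz) Complex.I 1]
  ext i j
  simp
  linear_combination (matFderiv Complex.I (matFderiv Complex.I B) z i j) * Complex.I_sq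

end Deriv

/-! ### Parallel frames in a holomorphic coordinate -/

section Frame

variable {a b h φ ψ F X : ℂ → Mat2} {z : ℂ}

/-- The derivative of an endomorphism field, made into a form by the metric and read in a parallel
frame. -/
lemma dWirt_frame (hF : MatDiffAt F z) (hh : MatDiffAt h z) (hX : MatDiffAt X z)
    (dF : dWirt F z = -((a z + φ z) * F z)) (dF' : dbarWirt F z = -((b z + ψ z) * F z))
    (dh : dWirt h z = (b z)ᴴ * h z + h z * a z) (hψ : (ψ z)ᴴ * h z = h z * φ z) :
    dWirt (fun w => (F w)ᴴ * (h w * X w) * F w) z =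
      (F z)ᴴ * (h z * (covZ a X z - φ z * X z - X z * φ z)) * F z := by
  rw [dWirt_mul (hF.conjTranspose.mul (hh.mul hX)) hF, dWirt_mul hF.conjTranspose (hh.mul hX),
    dWirt_mul hh hX, dWirt_conjTranspose, dF, dF', dh, covZ]
  simp only [Matrix.conjTranspose_neg, Matrix.conjTranspose_mul, Matrix.conjTranspose_add]
  have : (F z)ᴴ * (ψ z)ᴴ * (h z * X z) * F z = (F z)ᴴ * (h z * (φ z * X z)) * F z := by
    rw [mul_assoc (F z)ᴴ, ← mul_assoc (ψ z)ᴴ, hψ]; noncomm_ring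
  calc _ = (F z)ᴴ * (h z * (dWirt X z + (a z * X z - X z * a z) - X z * φ z)) * F z
        - (F z)ᴴ * (ψ z)ᴴ * (h z * X z) * F z := by noncomm_ring
    _ = _ := by rw [this]; noncomm_ring

lemma dbarWirt_frame (hF : MatDiffAt F z) (hh : MatDiffAt h z) (hX : MatDiffAt X z)
    (dF : dWirt F z = -((a z + φ z) * F z)) (dF' : dbarWirt F z = -((b z + ψ z) * F z))
    (dh : dbarWirt h z = (a z)ᴴ * h z + h z * b z) (hφ : (φ z)ᴴ * h z = h z * ψ z) :
    dbarWirt (fun w => (F w)ᴴ * (h w * X w) * F w) z =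
      (F z)ᴴ * (h z * (covZbar b X z - ψ z * X z - X z * ψ z)) * F z := by
  rw [dbarWirt_mul (hF.conjTranspose.mul (hh.mul hX)) hF,
    dbarWirt_mul hF.conjTranspose (hh.mul hX),
    dbarWirt_mul hh hX, dbarWirt_conjTranspose, dF, dF', dh, covZbar]
  simp only [Matrix.conjTranspose_neg, Matrix.conjTranspose_mul, Matrix.conjTranspose_add]
  have : (F z)ᴴ * (φ z)ᴴ * (h z * X z) * F z = (F z)ᴴ * (h z * (ψ z * X z)) * F z := by
    rw [mul_assoc (F z)ᴴ, ← mul_assoc (φ z)ᴴ, hφ]; noncomm_ring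
  calc _ = (F z)ᴴ * (h z * (dbarWirt X z + (b z * X z - X z * b z) - X z * ψ z)) * F z
        - (F z)ᴴ * (φ z)ᴴ * (h z * X z) * F z := by noncomm_ring
    _ = _ := by rw [this]; noncomm_ring

end Frame

/-! ### Pull-back of one-forms along holomorphic maps -/

section Conformal

lemma fderiv_real_of_complex {u : ℂ → ℂ} {z : ℂ} (hu : DifferentiableAt ℂ u z) (v : ℂ) :
    fderiv ℝ u z v = deriv u z * v := by
  rw [(hu.hasFDerivAt.restrictScalars ℝ).fderiv]
  simp [mul_comm]

/-- Transformation of `∂̄` of a `(1,0)`-coefficient under a holomorphic change of coordinate. -/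
lemma dbarWirt_deriv_smul_comp {u : ℂ → ℂ} {g : ℂ → Mat2} {z : ℂ} (hu : ContDiffAt ℂ ω u z)
    (hg : MatDiffAt g (u z)) :
    dbarWirt (fun w => deriv u w • g (u w)) z =
      (deriv u z * conj (deriv u z)) • dbarWirt g (u z) := by
  have hu1 : DifferentiableAt ℂ u z := hu.differentiableAt (by simp)
  have hu2 : DifferentiableAt ℂ (deriv u) z :=
    hu.analyticAt.deriv.differentiableAt
  have hlin : ∀ (l : ℂ →L[ℝ] ℂ) (v : ℂ), l v = v.re * l 1 + v.im * l Complex.I := by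
    intro l v
    have : v = v.re • (1 : ℂ) + v.im • Complex.I := by simp
    conv_lhs => rw [this, map_add, map_smul, map_smul]
    simp
  ext i j
  have h1 : ∀ v, fderiv ℝ (fun w => deriv u w * g (u w) i j) z v =
      deriv (deriv u) z * v * g (u z) i j +
        deriv u z * fderiv ℝ (fun w => g w i j) (u z) (deriv u z * v) := by
    intro v
    have hc : DifferentiableAt ℝ (fun w => g (u w) i j) z :=
      DifferentiableAt.comp (g := fun w => g w i j) z (hg i j) (hu1.restrictScalars ℝ)
    rw [fderiv_fun_mul (hu2.restrictScalars ℝ) hc]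
    have h2 := fderiv_comp (g := fun w => g w i j) z (hg i j) (hu1.restrictScalars ℝ)
    rw [Function.comp_def] at h2
    simp [h2, fderiv_real_of_complex hu1, fderiv_real_of_complex hu2]
    ring
  simp only [dbarWirt, Matrix.of_apply, Matrix.smul_apply, smul_eq_mul]
  rw [h1, h1, hlin _ (deriv u z * 1), hlin _ (deriv u z * Complex.I)]
  generalize deriv u z = d
  generalize deriv (deriv u) z = d2
  have e1 : (d.re : ℂ) = (d + conj d) / 2 := by rw [Complex.add_conj]; push_cast; ring
  have e2 : (d.im : ℂ) = -Complex.I * (d - conj d) / 2 := by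
    rw [Complex.sub_conj]; push_cast; linear_combination (d.im : ℂ) * Complex.I_sq
  simp only [mul_one, Complex.mul_re, Complex.mul_im, Complex.I_re, Complex.I_im, mul_zero,
    zero_sub, add_zero, Complex.ofReal_neg, e1, e2]
  generalize (fderiv ℝ (fun w => g w i j) (u z)) 1 = l1
  generalize (fderiv ℝ (fun w => g w i j) (u z)) Complex.I = l2
  have hI := Complex.I_sq
  grind

end Conformal

section Pullback

variable {M X : Type*} [TopologicalSpace M] [ChartedSpace ℂ M]
  [TopologicalSpace X] [ChartedSpace ℂ X] {π : X → M} {c : OpenPartialHomeomorph X ℂ} {z : ℂ}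

lemma MatSmooth.comp_holomorphic {B : M → Mat2} (hB : MatSmooth B)
    (hπ : ContMDiff 𝓘(ℂ) 𝓘(ℂ) ω π) : MatSmooth (fun y => B (π y)) := fun i j y =>
  ContMDiffAt.comp (g := fun x => B x i j) y (hB i j (π y)) (contMDiffAt_real_of_complex (hπ y))

/-- The differential is natural under pull-back. -/
lemma matDifferential_comp {B : M → Mat2} (hB : MatSmooth B)
    (hπ : ContMDiff 𝓘(ℂ) 𝓘(ℂ) ω π) :
    matDifferential (fun y => B (π y)) = (matDifferential B).pullback π := by
  funext y
  ext v i j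
  have h := mfderiv_comp (g := fun x => B x i j) y ((hB i j (π y)).mdifferentiableAt (by simp))
    ((contMDiffAt_real_of_complex (hπ y)).mdifferentiableAt (by simp))
  exact congrArg (fun l => l v) h

variable {W : Type} [AddCommGroup W] [Module ℝ W] [Module ℂ W] [IsScalarTower ℝ ℂ W]

/-- The coefficients of a pulled back one-form. -/
lemma coeff_of_inChart_comp {α : OneForm M W} {β : OneForm X W} {e : OpenPartialHomeomorph M ℂ}
    {y d : ℂ} (h : ∀ v : ℂ, β.inChart c z v = α.inChart e y (d * v)) :
    β.dz c z = d • α.dz e y ∧ β.dzbar c z = conj d • α.dzbar e y := by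
  have h1 : ∀ v : ℂ, β.inChart c z v =
      (d * v) • α.dz e y + conj (d * v) • α.dzbar e y := fun v => by
    rw [h, OneForm.inChart_eq_dz_add_dzbar]
  constructor
  · rw [OneForm.dz, h1, h1]
    simp only [map_mul, Complex.conj_I, map_one]
    match_scalars
    · linear_combination (-d / 2) * Complex.I_sq
    · linear_combination (conj d / 2) * Complex.I_sq
  · rw [OneForm.dzbar, h1, h1]
    simp only [map_mul, Complex.conj_I, map_one]
    match_scalars
    · linear_combination (d / 2) * Complex.I_sq
    · linear_combination (-conj d / 2) * Complex.I_sq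

variable [IsManifold 𝓘(ℂ) ω M] [IsManifold 𝓘(ℂ) ω X]

/-- Near `z`, the pull-back of one-forms along a holomorphic map is given by a holomorphic change
of coordinate `u`. -/
lemma exists_pullback_coordinate (hπ : ContMDiff 𝓘(ℂ) 𝓘(ℂ) ω π) (hc : c ∈ atlas ℂ X)
    (hz : z ∈ c.target) :
    ∃ e ∈ atlas ℂ M, ∃ u : ℂ → ℂ, ContDiffAt ℂ ω u z ∧ u z ∈ e.target ∧
      ∀ᶠ w in 𝓝 z, e.symm (u w) = π (c.symm w) ∧
        ∀ (W : Type) [AddCommGroup W] [Module ℝ W] (α : OneForm M W) (v : ℂ),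
          (α.pullback π).inChart c w v = α.inChart e (u w) (deriv u w * v) := by
  set x := π (c.symm z) with hx
  set e := chartAt ℂ x with he
  have hea : e ∈ atlas ℂ M := chart_mem_atlas ℂ x
  have hxe : x ∈ e.source := mem_chart_source ℂ x
  have hsm : ContMDiffAt 𝓘(ℂ) 𝓘(ℂ) ω (fun w => π (c.symm w)) z :=
    (hπ _).comp z (contMDiffAt_chart_symm_complex hc hz)
  have hpre : ∀ᶠ w in 𝓝 z, π (c.symm w) ∈ e.source :=
    hsm.continuousAt.eventually (e.open_source.mem_nhds hxe)
  have hu : ContDiffAt ℂ ω (fun w => e (π (c.symm w))) z :=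
    ((contMDiffAt_chart_complex hea hxe).comp z hsm).contDiffAt
  refine ⟨e, hea, fun w => e (π (c.symm w)), hu, e.map_source hxe, ?_⟩
  filter_upwards [hpre.eventually_nhds, c.open_target.mem_nhds hz,
    hu.analyticAt.eventually_analyticAt] with w hw hwc hwa
  have hww : π (c.symm w) ∈ e.source := hw.self_of_nhds
  refine ⟨e.left_inv hww, fun W _ _ α v => ?_⟩
  have hdu : DifferentiableAt ℂ (fun w => e (π (c.symm w))) w := hwa.differentiableAt
  have hπ' : MDifferentiableAt 𝓘(ℝ, ℂ) 𝓘(ℝ, ℂ) π (c.symm w) :=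
    (contMDiffAt_real_of_complex (hπ _)).mdifferentiableAt (by simp)
  have hcs : MDifferentiableAt 𝓘(ℝ, ℂ) 𝓘(ℝ, ℂ) (c.symm : ℂ → X) w :=
    (contMDiffAt_chart_symm hc hwc).mdifferentiableAt (by simp)
  have hes : MDifferentiableAt 𝓘(ℝ, ℂ) 𝓘(ℝ, ℂ) (e.symm : ℂ → M) (e (π (c.symm w))) :=
    (contMDiffAt_chart_symm hea (e.map_source hww)).mdifferentiableAt (by simp)
  have h1 := mfderiv_comp w hπ' hcs
  have h2 := mfderiv_comp w hes (hdu.restrictScalars ℝ).mdifferentiableAt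
  have h3 : (e.symm ∘ fun w => e (π (c.symm w))) =ᶠ[𝓝 w] π ∘ c.symm := by
    filter_upwards [hw] with y hy using e.left_inv hy
  rw [h3.mfderiv_eq, mfderiv_eq_fderiv] at h2
  have h4 := congrArg (fun l => l v) (h1.symm.trans h2)
  have key : ∀ y y' : M, y = y' → ∀ (u u' : ℂ), u = u' →
      (α y : ℂ →ₗ[ℝ] W) u = (α y' : ℂ →ₗ[ℝ] W) u' := by
    rintro y _ rfl u _ rfl; rfl
  refine key _ _ (e.left_inv hww).symm _ _ ?_
  rw [← fderiv_real_of_complex hdu]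
  exact h4

lemma OneForm.IsType10.pullback (hπ : ContMDiff 𝓘(ℂ) 𝓘(ℂ) ω π) {α : OneForm M W}
    (hα : α.IsType10) : (α.pullback π).IsType10 := by
  intro c hc z hz
  obtain ⟨e, he, u, -, huz, hev⟩ := exists_pullback_coordinate hπ hc hz
  rw [(coeff_of_inChart_comp (hev.self_of_nhds.2 W α)).2, hα e he _ huz, smul_zero]

/-- Smoothness of the coefficients of a pulled back form, for a form with coefficients `g w` that
are real linear in the tangent vector. -/
lemma contDiffAt_pullback {u : ℂ → ℂ} (hu : ContDiffAt ℂ ω u z) (v : ℂ) {g : ℂ → ℂ → ℂ}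
    (hg : ∀ d, ContDiffAt ℝ ∞ (fun w => g w d) (u z))
    (hlin : ∀ w d, g w d = d.re * g w 1 + d.im * g w Complex.I) :
    ContDiffAt ℝ ∞ (fun w => g (u w) (deriv u w * v)) z := by
  have hu' : ContDiffAt ℝ ∞ u z := (hu.restrict_scalars ℝ).of_le le_top
  have hd : ContDiffAt ℂ ω (deriv u) z :=
    hu.analyticAt.deriv.contDiffAt
  have hd' : ContDiffAt ℝ ∞ (fun w => deriv u w * v) z :=
    ((hd.restrict_scalars ℝ).of_le le_top).mul contDiffAt_const
  have hc : ∀ d, ContDiffAt ℝ ∞ (fun w => g (u w) d) z := fun d =>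
    ContDiffAt.comp (g := fun w => g w d) z (hg d) hu'
  have hre : ContDiffAt ℝ ∞ (fun w => (((deriv u w * v).re : ℝ) : ℂ)) z :=
    (Complex.ofRealCLM.comp Complex.reCLM).contDiff.contDiffAt.comp z hd'
  have him : ContDiffAt ℝ ∞ (fun w => (((deriv u w * v).im : ℝ) : ℂ)) z :=
    (Complex.ofRealCLM.comp Complex.imCLM).contDiff.contDiffAt.comp z hd'
  refine ((hre.mul (hc 1)).add (him.mul (hc Complex.I))).congr_of_eventuallyEq ?_
  filter_upwards with w using hlin _ _

lemma OneForm.Smooth.pullback (hπ : ContMDiff 𝓘(ℂ) 𝓘(ℂ) ω π) {α : OneForm M ℂ}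
    (hα : α.Smooth) : (α.pullback π).Smooth := by
  intro c hc v z hz
  obtain ⟨e, he, u, hu, huz, hev⟩ := exists_pullback_coordinate hπ hc hz
  have h := contDiffAt_pullback hu v (g := fun w d => α.inChart e w d)
    (fun d => (hα e he d).contDiffAt (e.open_target.mem_nhds huz)) (fun w d => by
      have : d = d.re • (1 : ℂ) + d.im • Complex.I := by simp
      conv_lhs => rw [this]
      rw [map_add, map_smul, map_smul]; simp)
  refine (h.congr_of_eventuallyEq ?_).contDiffWithinAt
  filter_upwards [hev] with w hw using hw.2 ℂ α v

lemma OneForm.MatSmooth.pullback (hπ : ContMDiff 𝓘(ℂ) 𝓘(ℂ) ω π) {α : OneForm M Mat2}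
    (hα : α.MatSmooth) : (α.pullback π).MatSmooth := by
  intro c hc v i j z hz
  obtain ⟨e, he, u, hu, huz, hev⟩ := exists_pullback_coordinate hπ hc hz
  have h := contDiffAt_pullback hu v (g := fun w d => α.inChart e w d i j)
    (fun d => (hα e he d i j).contDiffAt (e.open_target.mem_nhds huz)) (fun w d => by
      have : d = d.re • (1 : ℂ) + d.im • Complex.I := by simp
      conv_lhs => rw [this]
      rw [map_add, map_smul, map_smul]; simp)
  refine (h.congr_of_eventuallyEq ?_).contDiffWithinAt
  filter_upwards [hev] with w hw
  rw [hw.2 Mat2 α v]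

/-- Holomorphicity of a Higgs field is preserved by pull-back along holomorphic maps. -/
lemma dbarHiggs_pullback (hπ : ContMDiff 𝓘(ℂ) 𝓘(ℂ) ω π) {A Φ : OneForm M Mat2}
    (hΦ : Φ.MatSmooth)
    (hol : ∀ c ∈ atlas ℂ M, ∀ z ∈ c.target, dbarHiggs c A Φ z = 0)
    (hc : c ∈ atlas ℂ X) (hz : z ∈ c.target) :
    dbarHiggs c (A.pullback π) (Φ.pullback π) z = 0 := by
  obtain ⟨e, he, u, hu, huz, hev⟩ := exists_pullback_coordinate hπ hc hz
  have hA := (coeff_of_inChart_comp (hev.self_of_nhds.2 Mat2 A)).2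
  have hΦ0 := (coeff_of_inChart_comp (hev.self_of_nhds.2 Mat2 Φ)).1
  have hΦ1 : (Φ.pullback π).dz c =ᶠ[𝓝 z] fun w => deriv u w • Φ.dz e (u w) := by
    filter_upwards [hev] with w hw using (coeff_of_inChart_comp (hw.2 Mat2 Φ)).1
  have h := hol e he _ huz
  rw [dbarHiggs] at h ⊢
  rw [dbarWirt_congr hΦ1, dbarWirt_deriv_smul_comp hu (hΦ.dz he huz).matDiffAt, hA, hΦ0,
    eq_neg_of_add_eq_zero_left h]
  simp only [Matrix.smul_mul, Matrix.mul_smul]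
  module

end Pullback

/-! ### The orthogonal projection onto the eigenline -/

section Projection

/-- The matrix with first column `s` and second column zero. -/
def colMat (s : Fin 2 → ℂ) : Mat2 := Matrix.of fun i j => if j = 0 then s i else 0

lemma colMat_add (s t : Fin 2 → ℂ) : colMat (s + t) = colMat s + colMat t := by
  ext i j; fin_cases j <;> simp [colMat]

lemma mul_colMat (B : Mat2) (s : Fin 2 → ℂ) : B * colMat s = colMat (B *ᵥ s) := by
  ext i j; fin_cases j <;> simp [colMat, Matrix.mul_apply, Matrix.mulVec, dotProduct]

lemma herm_smul_self (H : Mat2) (k : ℂ) (s : Fin 2 → ℂ) :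
    herm H (k • s) (k • s) = (conj k * k) * herm H s s := by
  simp [herm, Matrix.mulVec_smul]; ring

/-- The form `h(s, s)` as an entry of a matrix product, so that the product rule for
matrices applies. -/
lemma herm_self_eq (H : Mat2) (s : Fin 2 → ℂ) :
    herm H s s = ((colMat s)ᴴ * (H * colMat s)) 0 0 := by
  rw [mul_colMat, Matrix.mul_apply]
  simp [herm, colMat, dotProduct]

lemma herm_self_pos {H : Mat2} (hH : H.PosDef) {s : Fin 2 → ℂ} (hs : s ≠ 0) :
    0 < herm H s s := hH.dotProduct_mulVec_pos hs

variable {H : Mat2} {ℓ : Submodule ℂ (Fin 2 → ℂ)} {s : Fin 2 → ℂ}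

/-- The chosen generator of a line is not the default value `0`. -/
lemma generator_spec (hℓ : Module.finrank ℂ ℓ = 1) : generator ℓ ∈ ℓ ∧ generator ℓ ≠ 0 := by
  have h : ∃ v ∈ ℓ, v ≠ 0 := by
    refine ℓ.exists_mem_ne_zero_of_ne_bot ?_
    rintro rfl
    simp at hℓ
  rw [generator, dif_pos h]
  exact h.choose_spec

lemma exists_smul_eq_of_mem (hℓ : Module.finrank ℂ ℓ = 1) (hs : s ∈ ℓ) (hs0 : s ≠ 0)
    {w : Fin 2 → ℂ} (hw : w ∈ ℓ) : ∃ k : ℂ, w = k • s := by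
  obtain ⟨k, hk⟩ := exists_smul_eq_of_finrank_eq_one hℓ (x := (⟨s, hs⟩ : ℓ))
    (by simpa using hs0) ⟨w, hw⟩
  exact ⟨k, (congrArg Subtype.val hk).symm⟩

/-- The orthogonal projection does not depend on the vector spanning the line. -/
lemma orthProj_eq (hℓ : Module.finrank ℂ ℓ = 1) (hs : s ∈ ℓ) (hs0 : s ≠ 0) :
    orthProj H ℓ = (herm H s s)⁻¹ • (colMat s * (colMat s)ᴴ * H) := by
  obtain ⟨hg, hg0⟩ := generator_spec hℓ
  obtain ⟨k, hk⟩ := exists_smul_eq_of_mem hℓ hs hs0 hg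
  have hk0 : k ≠ 0 := by rintro rfl; simp at hk; exact hg0 hk
  have h1 : colMat s * (colMat s)ᴴ * H = Matrix.vecMulVec s (star s ᵥ* H) := by
    ext i j
    simp [Matrix.mul_apply, Matrix.vecMulVec, Matrix.vecMul, dotProduct, colMat]
    ring
  have h2 : Matrix.vecMulVec (k • s) (star (k • s) ᵥ* H) =
      (conj k * k) • Matrix.vecMulVec s (star s ᵥ* H) := by
    ext i j
    simp [Matrix.vecMulVec, Matrix.vecMul, dotProduct]
    ring
  have hkk : conj k * k ≠ 0 := mul_ne_zero (by simpa using hk0) hk0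
  rw [orthProj, hk, herm_smul_self, h1, h2, smul_smul, mul_inv, mul_assoc, mul_comm _ (conj k * k),
    ← mul_assoc, inv_mul_cancel₀ hkk, one_mul]

lemma orthProj_mulVec_self (hH : H.PosDef) (hℓ : Module.finrank ℂ ℓ = 1) (hs : s ∈ ℓ) :
    orthProj H ℓ *ᵥ s = s := by
  by_cases hs0 : s = 0
  · simp [hs0]
  have h1 : (colMat s * (colMat s)ᴴ * H) *ᵥ s = herm H s s • s := by
    rw [herm_self_eq, mul_assoc, ← Matrix.mulVec_mulVec]
    ext i
    simp [Matrix.mulVec, dotProduct, Matrix.mul_apply, colMat]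
    ring
  rw [orthProj_eq hℓ hs hs0, Matrix.smul_mulVec, h1, smul_smul,
    inv_mul_cancel₀ (herm_self_pos hH hs0).ne', one_smul]

lemma orthProj_mulVec_mem (hℓ : Module.finrank ℂ ℓ = 1) (w : Fin 2 → ℂ) :
    orthProj H ℓ *ᵥ w ∈ ℓ := by
  obtain ⟨hg, hg0⟩ := generator_spec hℓ
  rw [orthProj, Matrix.smul_mulVec, Matrix.vecMulVec_mulVec, op_smul_eq_smul]
  exact ℓ.smul_mem _ (ℓ.smul_mem _ hg)

lemma mul_orthProj_of_forall {B C : Mat2} (hℓ : Module.finrank ℂ ℓ = 1)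
    (h : ∀ w ∈ ℓ, B *ᵥ w = C *ᵥ w) : B * orthProj H ℓ = C * orthProj H ℓ := by
  refine Matrix.ext_of_mulVec_single fun i => ?_
  rw [← Matrix.mulVec_mulVec, ← Matrix.mulVec_mulVec]
  exact h _ (orthProj_mulVec_mem hℓ _)

lemma orthProj_mul_self (hH : H.PosDef) (hℓ : Module.finrank ℂ ℓ = 1) :
    orthProj H ℓ * orthProj H ℓ = orthProj H ℓ := by
  have h := mul_orthProj_of_forall (H := H) (B := orthProj H ℓ) (C := 1) hℓ fun w hw => by
    rw [orthProj_mulVec_self hH hℓ hw, Matrix.one_mulVec]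
  rwa [one_mul] at h

lemma trace_orthProj (hH : H.PosDef) (hℓ : Module.finrank ℂ ℓ = 1) :
    (orthProj H ℓ).trace = 1 := by
  obtain ⟨hg, hg0⟩ := generator_spec hℓ
  rw [orthProj_eq hℓ hg hg0, Matrix.trace_smul, mul_assoc, Matrix.trace_mul_comm, mul_assoc,
    Matrix.trace_fin_two, ← herm_self_eq]
  have : ((colMat (generator ℓ))ᴴ * (H * colMat (generator ℓ))) 1 1 = 0 := by
    rw [mul_colMat, Matrix.mul_apply]; simp [colMat]
  rw [this, add_zero, smul_eq_mul, inv_mul_cancel₀ (herm_self_pos hH hg0).ne']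

lemma det_orthProj (hℓ : Module.finrank ℂ ℓ = 1) : (orthProj H ℓ).det = 0 := by
  obtain ⟨hg, hg0⟩ := generator_spec hℓ
  have : (colMat (generator ℓ)).det = 0 := by simp [Matrix.det_fin_two, colMat]
  rw [orthProj_eq hℓ hg hg0, Matrix.det_smul, Matrix.det_mul, Matrix.det_mul, this]
  simp

lemma mul_orthProj_eq (hH : H.PosDef) (hℓ : Module.finrank ℂ ℓ = 1) :
    H * orthProj H ℓ = (orthProj H ℓ)ᴴ * H := by
  obtain ⟨hg, hg0⟩ := generator_spec hℓ
  have h1 : star (herm H (generator ℓ) (generator ℓ)) = herm H (generator ℓ) (generator ℓ) :=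
    (IsSelfAdjoint.of_nonneg (herm_self_pos hH hg0).le).star_eq
  rw [orthProj_eq hℓ hg hg0]
  simp only [Matrix.conjTranspose_smul, Matrix.conjTranspose_mul,
    Matrix.conjTranspose_conjTranspose, hH.isHermitian.eq, star_inv₀, h1, Matrix.mul_smul,
    Matrix.smul_mul, mul_assoc]

end Projection

section Eigenline

variable {M : Type*} [TopologicalSpace M] [ChartedSpace ℂ M] [IsManifold 𝓘(ℂ) ω M]
  {A Φ : OneForm M Mat2} {H : M → Mat2} {θ : OneForm M ℂ}
  {L : M → Submodule ℂ (Fin 2 → ℂ)} {c : OpenPartialHomeomorph M ℂ} {z : ℂ}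

/-- A local section of the eigenline in a chart, as the matrix-valued function with this column. -/
lemma exists_colMat_section (hL : IsHolomorphicEigenline A Φ θ L) (hc : c ∈ atlas ℂ M)
    (hz : z ∈ c.target) :
    ∃ σ : ℂ → Fin 2 → ℂ, MatContDiffAt (fun w => colMat (σ w)) z ∧
      (∀ᶠ w in 𝓝 z, σ w ≠ 0 ∧ σ w ∈ L (c.symm w)) ∧
      ∃ τ ∈ L (c.symm z),
        dbarWirt (fun w => colMat (σ w)) z + A.dzbar c z * colMat (σ z) = colMat τ := by
  obtain ⟨U, hU, hxU, s, hs, hsU⟩ := hL.holomorphic (c.symm z)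
  have hsz : ContMDiffAt 𝓘(ℝ, ℂ) 𝓘(ℝ, Fin 2 → ℂ) ∞ s (c.symm z) :=
    hs.contMDiffAt (hU.mem_nhds hxU)
  have hσ : ContDiffAt ℝ ∞ (fun w => s (c.symm w)) z :=
    (hsz.comp z (contMDiffAt_chart_symm hc hz)).contDiffAt
  have hσi : ∀ i, ContDiffAt ℝ ∞ (fun w => s (c.symm w) i) z := contDiffAt_pi.1 hσ
  refine ⟨fun w => s (c.symm w), ?_, ?_, ?_⟩
  · intro i j
    fin_cases j
    · simpa [colMat] using hσi i
    · simpa [colMat] using (contDiffAt_const : ContDiffAt ℝ ∞ (fun _ => (0 : ℂ)) z)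
  · filter_upwards [(contMDiffAt_chart_symm hc hz).continuousAt.eventually (hU.mem_nhds hxU)]
      with w hw using ⟨(hsU _ hw).1, (hsU _ hw).2.1⟩
  · have h := (hsU _ hxU).2.2 c hc (c.map_target hz)
    rw [c.right_inv hz] at h
    refine ⟨_, h, ?_⟩
    have hd : ∀ e, OneForm.inChart c (covDeriv A s) z e =
        fderiv ℝ (fun w => s (c.symm w)) z e + A.inChart c z e *ᵥ s (c.symm z) := fun e => by
      rw [← inChart_differential hc hz (hsz.mdifferentiableAt (by simp))]; rfl
    have hdi : ∀ e i, fderiv ℝ (fun w => s (c.symm w)) z e i =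
        fderiv ℝ (fun w => s (c.symm w) i) z e := fun e i => by
      rw [fderiv_apply (hσ.differentiableAt (by simp)) i]; rfl
    have e1 : dbarWirt (fun w => colMat (s (c.symm w))) z = colMat ((1 / 2 : ℂ) •
        (fderiv ℝ (fun w => s (c.symm w)) z 1 +
          Complex.I • fderiv ℝ (fun w => s (c.symm w)) z Complex.I)) := by
      ext i j
      fin_cases j <;> simp [dbarWirt, colMat, hdi]
    have e2 : OneForm.dzbar c (covDeriv A s) z = (1 / 2 : ℂ) •
        (fderiv ℝ (fun w => s (c.symm w)) z 1 +
          Complex.I • fderiv ℝ (fun w => s (c.symm w)) z Complex.I) +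
        A.dzbar c z *ᵥ s (c.symm z) := by
      simp only [OneForm.dzbar, hd, Matrix.smul_mulVec, Matrix.add_mulVec]
      module
    rw [e1, mul_colMat, e2, colMat_add]

lemma IsSU2Solution.projL_matContDiffAt (hsol : IsSU2Solution A Φ H)
    (hL : IsHolomorphicEigenline A Φ θ L) (hc : c ∈ atlas ℂ M) (hz : z ∈ c.target) :
    MatContDiffAt (fun w => projL H L (c.symm w)) z := by
  obtain ⟨σ, hσ, hev, -⟩ := exists_colMat_section hL hc hz
  have hH := matSmooth_iff_chart.1 hsol.smooth_metric c hc z hz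
  have h1 : (fun w => projL H L (c.symm w)) =ᶠ[𝓝 z] fun w =>
      (((colMat (σ w))ᴴ * (H (c.symm w) * colMat (σ w))) 0 0)⁻¹ •
        (colMat (σ w) * (colMat (σ w))ᴴ * H (c.symm w)) := by
    filter_upwards [hev] with w hw
    rw [projL, orthProj_eq (hL.line _) hw.2 hw.1, herm_self_eq]
  refine MatContDiffAt.congr_of_eventuallyEq (MatContDiffAt.smul ?_ ?_) h1
  · refine ((hσ.conjTranspose.mul (hH.mul hσ)) 0 0).inv ?_
    change ((colMat (σ z))ᴴ * (H (c.symm z) * colMat (σ z))) 0 0 ≠ 0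
    rw [← herm_self_eq]
    exact (herm_self_pos (hsol.posDef _) hev.self_of_nhds.1).ne'
  · exact (hσ.mul hσ.conjTranspose).mul hH

/-- Holomorphicity of the eigenline, as an equation for the orthogonal projection onto it. -/
lemma IsSU2Solution.covZbar_projL (hsol : IsSU2Solution A Φ H)
    (hL : IsHolomorphicEigenline A Φ θ L) (hc : c ∈ atlas ℂ M) (hz : z ∈ c.target) :
    covZbar (A.dzbar c) (fun w => projL H L (c.symm w)) z * projL H L (c.symm z) = 0 := by
  obtain ⟨σ, hσ, hev, τ, hτ, hτeq⟩ := exists_colMat_section hL hc hz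
  have hp := hsol.projL_matContDiffAt hL hc hz
  have h0 : ∀ y, ∀ w ∈ L y, projL H L y * colMat w = colMat w := fun y w hw => by
    rw [mul_colMat, projL, orthProj_mulVec_self (hsol.posDef y) (hL.line y) hw]
  have h1 : dbarWirt (fun w => projL H L (c.symm w) * colMat (σ w)) z =
      dbarWirt (fun w => colMat (σ w)) z := by
    refine dbarWirt_congr ?_
    filter_upwards [hev] with w hw using h0 _ _ hw.2
  rw [dbarWirt_mul hp.matDiffAt hσ.matDiffAt] at h1
  have h2 := h0 _ _ hev.self_of_nhds.2
  have h3 := h0 _ _ hτ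
  rw [← hτeq] at h3
  have h4 : covZbar (A.dzbar c) (fun w => projL H L (c.symm w)) z * colMat (σ z) = 0 := by
    rw [covZbar, add_mul, sub_mul, mul_assoc (A.dzbar c z), h2, eq_sub_of_add_eq h1, mul_assoc]
    rw [mul_add] at h3
    have h5 := sub_eq_zero.2 h3
    rw [← neg_eq_zero, ← h5]
    abel
  have h6 : projL H L (c.symm z) = _ := orthProj_eq (hL.line _) hev.self_of_nhds.2
    hev.self_of_nhds.1
  rw [h6, Matrix.mul_smul, mul_assoc, ← mul_assoc, h4, zero_mul, smul_zero]

end Eigenline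

/-! ### Adjoints with respect to a Hermitian metric -/

section MetricAdjoint

/-- The adjoint of the endomorphism `B` for the Hermitian form with Gram matrix `H`. -/
def metricAdj (H B : Mat2) : Mat2 := H⁻¹ * Bᴴ * H

lemma OneForm.adj_apply {M : Type*} [TopologicalSpace M] [ChartedSpace ℂ M] (H : M → Mat2)
    (α : OneForm M Mat2) (x : M) (v : TangentSpace 𝓘(ℝ, ℂ) x) :
    α.adj H x v = metricAdj (H x) (α x v) := rfl

variable {H B C : Mat2}

lemma metricAdj_add (H B C : Mat2) : metricAdj H (B + C) = metricAdj H B + metricAdj H C := by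
  simp [metricAdj, mul_add, add_mul]

lemma metricAdj_sub (H B C : Mat2) : metricAdj H (B - C) = metricAdj H B - metricAdj H C := by
  simp [metricAdj, mul_sub, sub_mul]

lemma metricAdj_neg (H B : Mat2) : metricAdj H (-B) = -metricAdj H B := by simp [metricAdj]

lemma metricAdj_smul (H B : Mat2) (t : ℂ) : metricAdj H (t • B) = conj t • metricAdj H B := by
  simp [metricAdj, Matrix.conjTranspose_smul]

lemma mul_metricAdj (hH : IsUnit H.det) (B : Mat2) : H * metricAdj H B = Bᴴ * H := by
  rw [metricAdj, mul_assoc, Matrix.mul_nonsing_inv_cancel_left _ _ hH]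

lemma metricAdj_mul (hH : IsUnit H.det) (B C : Mat2) :
    metricAdj H (B * C) = metricAdj H C * metricAdj H B := by
  rw [metricAdj, metricAdj, mul_assoc _ H, mul_metricAdj hH, Matrix.conjTranspose_mul]
  noncomm_ring

lemma metricAdj_one (hH : IsUnit H.det) : metricAdj H 1 = 1 := by
  rw [metricAdj, Matrix.conjTranspose_one, mul_one, Matrix.nonsing_inv_mul _ hH]

/-- The adjoint is characterised by `h(B v, w) = h(v, C w)`. -/
lemma eq_metricAdj (hH : IsUnit H.det) (h : H * C = Bᴴ * H) : C = metricAdj H B := by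
  rw [metricAdj, mul_assoc, ← h, Matrix.nonsing_inv_mul_cancel_left _ _ hH]

lemma metricAdj_metricAdj (hH : IsUnit H.det) (hH' : H.IsHermitian) (B : Mat2) :
    metricAdj H (metricAdj H B) = B := by
  symm
  apply eq_metricAdj hH
  have h := congrArg Matrix.conjTranspose (mul_metricAdj hH B)
  rw [Matrix.conjTranspose_mul, Matrix.conjTranspose_mul, Matrix.conjTranspose_conjTranspose,
    hH'.eq] at h
  exact h.symm

lemma trace_metricAdj (hH : IsUnit H.det) (B : Mat2) :
    (metricAdj H B).trace = conj B.trace := by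
  rw [metricAdj, mul_assoc, Matrix.trace_mul_comm, mul_assoc, Matrix.mul_nonsing_inv _ hH, mul_one,
    Matrix.trace_conjTranspose]
  rfl

/-- The adjoint for the metric twisted by an involution `S`. -/
lemma metricAdj_mul_involution {S : Mat2} (hS : S * S = 1) (B : Mat2) :
    metricAdj (H * S) B = S * metricAdj H B * S := by
  have hi : S⁻¹ = S := Matrix.inv_eq_left_inv hS
  rw [metricAdj, Matrix.mul_inv_rev, hi, metricAdj]
  noncomm_ring

/-- The algebra of the twist in one fibre: for `X = (t, α; 0, -t)` and `g` strictly upper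
triangular, `X + X^*` is the sum of the off-diagonal part `(α, α^*)` and of `(t, 0; -g^*, -t)`,
its adjoint for the twisted metric, and `-g + g^*`. -/
lemma twist_fibre {P X Y : Mat2} {t : ℂ} (hH : IsUnit H.det) (hH' : H.IsHermitian)
    (hP : P * P = P) (hPH : metricAdj H P = P) (he : X * P = t • P)
    (hc : (1 - P) * X = -(t • (1 - P))) :
    -(P * Y * (1 - P)) + metricAdj H (P * Y * (1 - P)) + P * X * (1 - P) +
        metricAdj H (P * X * (1 - P)) +
        (t • (P - (1 - P)) - metricAdj H (P * Y * (1 - P))) +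
        metricAdj (H * (P - (1 - P))) (t • (P - (1 - P)) - metricAdj H (P * Y * (1 - P))) =
      X + metricAdj H X := by
  have hQ : metricAdj H (1 - P) = 1 - P := by rw [metricAdj_sub, metricAdj_one hH, hPH]
  have m3 : (1 - P) * P = 0 := by rw [sub_mul, one_mul, hP, sub_self]
  have m4 : P * (1 - P) = 0 := by rw [mul_sub, mul_one, hP, sub_self]
  have m5 : (1 - P) * (1 - P) = 1 - P := by rw [mul_sub, m3, mul_one, sub_zero]
  set Q := 1 - P with hQdef
  have hPQ : P + Q = 1 := by rw [hQdef]; abel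
  have hSS : (P - Q) * (P - Q) = 1 := by
    calc (P - Q) * (P - Q) = P * P - P * Q - Q * P + Q * Q := by noncomm_ring
      _ = 1 := by rw [hP, m3, m4, m5, ← hPQ]; abel
  have hX : X = t • (P - Q) + P * X * Q := by
    have h1 : X = X * P + (P * X * Q + Q * X * Q) := by
      calc X = (P + Q) * X * (P + Q) := by rw [hPQ]; simp
        _ = (P + Q) * (X * P) + (P * X * Q + Q * X * Q) := by noncomm_ring
        _ = _ := by rw [hPQ, one_mul]
    conv_lhs => rw [h1, he, hc, neg_mul, Matrix.smul_mul, m5]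
    module
  have hS : metricAdj H (P - Q) = P - Q := by rw [metricAdj_sub, hPH, hQ]
  rw [metricAdj_mul_involution hSS, metricAdj_sub H (t • (P - Q)), metricAdj_metricAdj hH hH',
    metricAdj_smul, hS]
  have h2 : (P - Q) * (conj t • (P - Q) - P * Y * Q) * (P - Q) =
      conj t • (P - Q) + P * Y * Q := by
    have h3 : (P - Q) * (P * Y * Q) * (P - Q) = -(P * Y * Q) := by
      calc _ = (P * P) * Y * (Q * P) - (P * P) * Y * (Q * Q) - (Q * P) * Y * (Q * P)
            + (Q * P) * Y * (Q * Q) := by noncomm_ring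
        _ = _ := by rw [hP, m3, m5]; simp
    rw [mul_sub (P - Q), sub_mul _ _ (P - Q), h3, Matrix.mul_smul, Matrix.smul_mul, hSS, one_mul]
    abel
  rw [h2]
  have h4 : metricAdj H X = conj t • (P - Q) + metricAdj H (P * X * Q) := by
    conv_lhs => rw [hX, metricAdj_add, metricAdj_smul, hS]
  rw [h4]
  calc _ = t • (P - Q) + P * X * Q + (conj t • (P - Q) + metricAdj H (P * X * Q)) := by abel
    _ = _ := by rw [← hX]

/-- The unitarity of the twisted connection in one fibre; `dP` is the derivative of the projection
`P`, so that `dP + [X, P]` is its covariant derivative. -/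
lemma twist_unitary_fibre {P X dP dH N : Mat2} (hH : IsUnit H.det) (hH' : H.IsHermitian)
    (hP : P * P = P) (hPH : metricAdj H P = P) (hdH : dH = Xᴴ * H + H * X)
    (hdP : dP * P + P * dP = dP)
    (hdPH : dH * P + H * dP = dPᴴ * H + Pᴴ * dH) (hN : metricAdj H N = N)
    (hN' : N * (P - (1 - P)) + (P - (1 - P)) * N = 0) :
    dH * (P - (1 - P)) + H * (dP + dP) =
      (X - P * (X - dP) * (1 - P) + metricAdj H (P * (X - dP) * (1 - P)) + N)ᴴ *
          (H * (P - (1 - P))) +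
        (H * (P - (1 - P))) *
          (X - P * (X - dP) * (1 - P) + metricAdj H (P * (X - dP) * (1 - P)) + N) := by
  have hQ : metricAdj H (1 - P) = 1 - P := by rw [metricAdj_sub, metricAdj_one hH, hPH]
  have m3 : (1 - P) * P = 0 := by rw [sub_mul, one_mul, hP, sub_self]
  have m4 : P * (1 - P) = 0 := by rw [mul_sub, mul_one, hP, sub_self]
  have m5 : (1 - P) * (1 - P) = 1 - P := by rw [mul_sub, m3, mul_one, sub_zero]
  have hdH' : dH = H * (metricAdj H X + X) := by rw [mul_add, mul_metricAdj hH, hdH]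
  -- the covariant derivative of `P` is self-adjoint and off-diagonal
  set D := dP + (X * P - P * X) with hD
  have hDadj : metricAdj H D = D := by
    symm
    apply eq_metricAdj hH
    have h1 : Pᴴ * H = H * P := by rw [← mul_metricAdj hH, hPH]
    rw [hD, Matrix.conjTranspose_add, Matrix.conjTranspose_sub, Matrix.conjTranspose_mul,
      Matrix.conjTranspose_mul, add_mul]
    have h2 : dPᴴ * H = dH * P + H * dP - Pᴴ * dH := by rw [hdPH]; abel
    have h3 : (Pᴴ * Xᴴ - Xᴴ * Pᴴ) * H = Pᴴ * (Xᴴ * H) - Xᴴ * (H * P) := by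
      rw [← h1]; noncomm_ring
    have h4 : Pᴴ * (H * X) = H * P * X := by rw [← mul_assoc, h1]
    rw [h2, h3, hdH, mul_add, mul_add Pᴴ, h4]
    noncomm_ring
  have hPDP : P * D * P = 0 := by
    have h1 : P * dP * P = 0 := by
      have := congrArg (fun B => P * B) hdP
      simp only [mul_add, ← mul_assoc, hP] at this
      simpa using this
    calc P * D * P = P * dP * P + P * X * (P * P) - (P * P) * X * P := by rw [hD]; noncomm_ring
      _ = 0 := by rw [h1, hP]; abel
  have hQDQ : (1 - P) * D * (1 - P) = 0 := by
    calc (1 - P) * D * (1 - P) = (1 - P) * (dP * P + P * dP) * (1 - P) +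
          ((1 - P) * X * (P * (1 - P)) - ((1 - P) * P) * X * (1 - P)) := by
          rw [hdP, hD]; noncomm_ring
      _ = (1 - P) * dP * (P * (1 - P)) + ((1 - P) * P) * dP * (1 - P) +
          ((1 - P) * X * (P * (1 - P)) - ((1 - P) * P) * X * (1 - P)) := by noncomm_ring
      _ = 0 := by rw [m3, m4]; simp
  have hγ : P * (X - dP) * (1 - P) = -(P * D * (1 - P)) := by
    calc P * (X - dP) * (1 - P) = -(P * D * (1 - P)) + P * X * (P * (1 - P)) +
          (P - P * P) * X * (1 - P) := by rw [hD]; noncomm_ring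
      _ = _ := by rw [m4, hP]; simp
  have hγ' : metricAdj H (P * (X - dP) * (1 - P)) = -((1 - P) * D * P) := by
    rw [hγ, metricAdj_neg, metricAdj_mul hH, metricAdj_mul hH, hQ, hDadj, hPH, ← mul_assoc]
  rw [hγ', hγ]
  set Q := 1 - P with hQdef
  have hPQ : P + Q = 1 := by rw [hQdef]; abel
  set E := P * D * Q with hE
  set G := Q * D * P with hG
  have hDEG : D = E + G := by
    calc D = (P + Q) * D * (P + Q) := by rw [hPQ]; simp
      _ = P * D * P + E + (G + Q * D * Q) := by rw [hE, hG]; noncomm_ring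
      _ = _ := by rw [hPDP, hQDQ]; abel
  have hGadj : metricAdj H E = G := by
    rw [hE, metricAdj_mul hH, metricAdj_mul hH, hQ, hDadj, hPH, ← mul_assoc]
  have hEadj : metricAdj H G = E := by rw [← hGadj, metricAdj_metricAdj hH hH']
  have h5 : (X - -E + -G + N)ᴴ * (H * (P - Q)) =
      H * ((metricAdj H X + G - E + N) * (P - Q)) := by
    rw [← mul_assoc, ← mul_metricAdj hH, metricAdj_add, metricAdj_add, metricAdj_sub,
      metricAdj_neg, metricAdj_neg, hGadj, hEadj, hN]
    noncomm_ring
  rw [h5, hdH', mul_assoc, mul_assoc H (P - Q), ← mul_add, ← mul_add]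
  congr 1
  have e1 : E * P = 0 := by rw [hE, mul_assoc, m3, mul_zero]
  have e2 : E * Q = E := by rw [hE, mul_assoc, m5]
  have e3 : P * E = E := by rw [hE, ← mul_assoc, ← mul_assoc, hP]
  have e4 : Q * E = 0 := by rw [hE, ← mul_assoc, ← mul_assoc, m3]; simp
  have g1 : G * P = G := by rw [hG, mul_assoc, hP]
  have g2 : G * Q = 0 := by rw [hG, mul_assoc, m4, mul_zero]
  have g3 : P * G = 0 := by rw [hG, ← mul_assoc, ← mul_assoc, m4]; simp
  have g4 : Q * G = G := by rw [hG, ← mul_assoc, ← mul_assoc, m5]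
  have h6 : dP = E + G - (X * P - P * X) := by rw [← hDEG, hD]; abel
  have h7 : X * (P - Q) - (P - Q) * X = (X * P - P * X) + (X * P - P * X) := by
    rw [hQdef]; noncomm_ring
  have h8 : X * (P - Q) = (X * P - P * X) + (X * P - P * X) + (P - Q) * X := by rw [← h7]; abel
  have h9 : N * (P - Q) = -((P - Q) * N) := eq_neg_of_add_eq_zero_left hN'
  have lhs : (metricAdj H X + X) * (P - Q) + (dP + dP) =
      metricAdj H X * (P - Q) + (P - Q) * X + (E + E + G + G) := by
    rw [add_mul, h8, h6]; abel
  have rhs : (metricAdj H X + G - E + N) * (P - Q) + (P - Q) * (X - -E + -G + N) =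
      metricAdj H X * (P - Q) + (P - Q) * X + (E + E + G + G) := by
    rw [add_mul, h9]
    have : (metricAdj H X + G - E) * (P - Q) = metricAdj H X * (P - Q) + G * P - G * Q
      - E * P + E * Q := by noncomm_ring
    rw [this, e1, e2, g1, g2]
    have : (P - Q) * (X - -E + -G + N) = (P - Q) * X + P * E - Q * E - P * G + Q * G
      + (P - Q) * N := by noncomm_ring
    rw [this, e3, e4, g3, g4]
    abel
  rw [lhs, rhs]

end MetricAdjoint

/-! ### Self-dual triples in charts -/

section SmoothForms

variable {M : Type*} [TopologicalSpace M] [ChartedSpace ℂ M]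
  {α β : OneForm M Mat2}

lemma OneForm.MatSmooth.add (hα : α.MatSmooth) (hβ : β.MatSmooth) : (α + β).MatSmooth := by
  rw [OneForm.matSmooth_iff] at *
  exact fun c hc e z hz => (hα c hc e z hz).add (hβ c hc e z hz)

lemma OneForm.MatSmooth.sub (hα : α.MatSmooth) (hβ : β.MatSmooth) : (α - β).MatSmooth := by
  rw [OneForm.matSmooth_iff] at *
  exact fun c hc e z hz => (hα c hc e z hz).sub (hβ c hc e z hz)

lemma trace_dz (h : ∀ x v, (α x v).trace = 0)
    (c : OpenPartialHomeomorph M ℂ) (z : ℂ) : (α.dz c z).trace = 0 := by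
  have : ∀ e, (α.inChart c z e).trace = 0 := fun e => h _ _
  rw [OneForm.dz, Matrix.trace_smul, Matrix.trace_sub, Matrix.trace_smul, this, this]
  simp

variable [IsManifold 𝓘(ℂ) ω M] {P Q H : M → Mat2} {θ : OneForm M ℂ}

lemma OneForm.MatSmooth.sandwich (hα : α.MatSmooth) (hP : SelfDuality.MatSmooth P)
    (hQ : SelfDuality.MatSmooth Q) : (α.sandwich P Q).MatSmooth := by
  rw [OneForm.matSmooth_iff] at *
  rw [matSmooth_iff_chart] at hP hQ
  exact fun c hc e z hz => ((hP c hc z hz).mul (hα c hc e z hz)).mul (hQ c hc z hz)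

lemma OneForm.MatSmooth.adj (hα : α.MatSmooth) (hH : SelfDuality.MatSmooth H)
    (hdet : ∀ x, (H x).det ≠ 0) :
    (α.adj H).MatSmooth := by
  rw [OneForm.matSmooth_iff] at *
  rw [matSmooth_iff_chart] at hH
  exact fun c hc e z hz => (((hH c hc z hz).inv (hdet _)).mul
    (hα c hc e z hz).conjTranspose).mul (hH c hc z hz)

lemma OneForm.Smooth.scalarMul (hθ : θ.Smooth) (hP : SelfDuality.MatSmooth P) :
    (θ.scalarMul P).MatSmooth := by
  rw [OneForm.matSmooth_iff]
  rw [matSmooth_iff_chart] at hP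
  exact fun c hc e z hz => MatContDiffAt.smul ((hθ c hc e).contDiffAt (c.open_target.mem_nhds hz))
    (hP c hc z hz)

lemma MatSmooth.matDifferential (hP : MatSmooth P) : (matDifferential P).MatSmooth := by
  rw [OneForm.matSmooth_iff]
  intro c hc e z hz
  refine ((matSmooth_iff_chart.1 hP c hc z hz).matFderiv e).congr_of_eventuallyEq ?_
  filter_upwards [c.open_target.mem_nhds hz] with w hw using inChart_matDifferential hP hc hw e

lemma MatSmooth.sub (hP : MatSmooth P) (hQ : MatSmooth Q) : MatSmooth (fun x => P x - Q x) := by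
  rw [matSmooth_iff_chart] at *
  exact fun c hc z hz => (hP c hc z hz).sub (hQ c hc z hz)

lemma MatSmooth.mul (hP : MatSmooth P) (hQ : MatSmooth Q) : MatSmooth (fun x => P x * Q x) := by
  rw [matSmooth_iff_chart] at *
  exact fun c hc z hz => (hP c hc z hz).mul (hQ c hc z hz)

lemma MatSmooth.const (C : Mat2) : MatSmooth (fun _ : M => C) := by
  rw [matSmooth_iff_chart]
  exact fun c hc z hz => MatContDiffAt.const C

end SmoothForms

section Charts

variable {M : Type*} [TopologicalSpace M] [ChartedSpace ℂ M] [IsManifold 𝓘(ℂ) ω M]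
  {A Φ : OneForm M Mat2} {H : M → Mat2} {c : OpenPartialHomeomorph M ℂ} {z : ℂ}

lemma matFderiv_metric (hH : MatSmooth H)
    (hu : ∀ x v, matDifferential H x v = (A x v)ᴴ * H x + H x * A x v)
    (hc : c ∈ atlas ℂ M) (hz : z ∈ c.target) (e : ℂ) :
    matFderiv e (fun w => H (c.symm w)) z =
      (A.inChart c z e)ᴴ * H (c.symm z) + H (c.symm z) * A.inChart c z e := by
  rw [← inChart_matDifferential hH hc hz]
  exact hu _ _

lemma dWirt_metric (hH : MatSmooth H)
    (hu : ∀ x v, matDifferential H x v = (A x v)ᴴ * H x + H x * A x v)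
    (hc : c ∈ atlas ℂ M) (hz : z ∈ c.target) :
    dWirt (fun w => H (c.symm w)) z =
      (A.dzbar c z)ᴴ * H (c.symm z) + H (c.symm z) * A.dz c z := by
  rw [dWirt_eq, matFderiv_metric hH hu hc hz, matFderiv_metric hH hu hc hz, OneForm.dz,
    OneForm.dzbar]
  simp [Matrix.conjTranspose_smul, mul_sub, add_mul]
  module

lemma dbarWirt_metric (hH : MatSmooth H)
    (hu : ∀ x v, matDifferential H x v = (A x v)ᴴ * H x + H x * A x v)
    (hc : c ∈ atlas ℂ M) (hz : z ∈ c.target) :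
    dbarWirt (fun w => H (c.symm w)) z =
      (A.dz c z)ᴴ * H (c.symm z) + H (c.symm z) * A.dzbar c z := by
  rw [dbarWirt_eq, matFderiv_metric hH hu hc hz, matFderiv_metric hH hu hc hz, OneForm.dz,
    OneForm.dzbar]
  simp [Matrix.conjTranspose_smul, mul_add, add_mul, sub_eq_add_neg]
  module

/-- The adjoint of the equation `∂̄^∇ Φ = 0`. -/
lemma covZ_adj_eq_zero (hΦ : Φ.MatSmooth) (hH : MatSmooth H)
    (hdet : ∀ x, (H x).det ≠ 0)
    (hu : ∀ x v, matDifferential H x v = (A x v)ᴴ * H x + H x * A x v)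
    (hol : ∀ c ∈ atlas ℂ M, ∀ z ∈ c.target, dbarHiggs c A Φ z = 0)
    (hc : c ∈ atlas ℂ M) (hz : z ∈ c.target) :
    covZ (A.dz c) ((Φ.adj H).dzbar c) z = 0 := by
  have hdetu : IsUnit (H (c.symm z)).det := isUnit_iff_ne_zero.2 (hdet _)
  have h1 := mul_covZ_adjoint (a := A.dz c) (b := A.dzbar c) (u := Φ.dz c)
    (v := (Φ.adj H).dzbar c) (h := fun w => H (c.symm w))
    (matSmooth_iff_chart.1 hH c hc z hz).matDiffAt (hΦ.dz hc hz).matDiffAt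
    ((hΦ.adj hH hdet).dzbar hc hz).matDiffAt
    (Eventually.of_forall fun w => by
      rw [OneForm.dzbar_adj]
      exact mul_metricAdj (isUnit_iff_ne_zero.2 (hdet _)) _) (dWirt_metric hH hu hc hz)
  rw [show covZbar (A.dzbar c) (Φ.dz c) z = 0 from hol c hc z hz, Matrix.conjTranspose_zero,
    zero_mul] at h1
  exact ((Matrix.isUnit_iff_isUnit_det _).2 hdetu).mul_right_eq_zero.1 h1

/-- The curvature of the sum of a connection with coefficients `a`, `b` and of a form with
coefficients `φ`, `ψ`. -/
lemma curvature_add {a b φ ψ : ℂ → Mat2} (ha : MatDiffAt a z) (hb : MatDiffAt b z)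
    (hφ : MatDiffAt φ z) (hψ : MatDiffAt ψ z) :
    dWirt (fun w => b w + ψ w) z - dbarWirt (fun w => a w + φ w) z +
        ((a z + φ z) * (b z + ψ z) - (b z + ψ z) * (a z + φ z)) =
      (dWirt b z - dbarWirt a z + (a z * b z - b z * a z)) + (φ z * ψ z - ψ z * φ z) +
        covZ a ψ z - covZbar b φ z := by
  rw [dWirt_add hb hψ, dbarWirt_add ha hφ, covZ, covZbar]
  noncomm_ring

end Charts

/-! ### The twisted triple -/

section Twist

variable {M : Type*} [TopologicalSpace M] [ChartedSpace ℂ M]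
  {A Φ : OneForm M Mat2} {H : M → Mat2} {θ : OneForm M ℂ}
  {L : M → Submodule ℂ (Fin 2 → ℂ)} {c : OpenPartialHomeomorph M ℂ} {z : ℂ}

lemma IsHolomorphicEigenline.higgs_mul_projL (hL : IsHolomorphicEigenline A Φ θ L) (x : M)
    (v : TangentSpace 𝓘(ℝ, ℂ) x) :
    Φ x v * projL H L x = θ x v • projL H L x := by
  have h := mul_orthProj_of_forall (H := H x) (B := Φ x v) (C := θ x v • 1) (hL.line x)
    fun w hw => by rw [hL.eigen x v w hw, Matrix.smul_mulVec, Matrix.one_mulVec]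
  rwa [Matrix.smul_mul, one_mul] at h

namespace IsSU2Solution

lemma isUnit_det (hsol : IsSU2Solution A Φ H) (x : M) : IsUnit (H x).det := by
  rw [hsol.det_metric]; exact isUnit_one

lemma det_ne_zero (hsol : IsSU2Solution A Φ H) (x : M) : (H x).det ≠ 0 := by
  rw [hsol.det_metric]; exact one_ne_zero

lemma projL_mul_self (hsol : IsSU2Solution A Φ H)
    (hL : IsHolomorphicEigenline A Φ θ L) (x : M) : projL H L x * projL H L x = projL H L x :=
  orthProj_mul_self (hsol.posDef x) (hL.line x)

lemma mul_projL (hsol : IsSU2Solution A Φ H)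
    (hL : IsHolomorphicEigenline A Φ θ L) (x : M) : H x * projL H L x = (projL H L x)ᴴ * H x :=
  mul_orthProj_eq (hsol.posDef x) (hL.line x)

lemma metricAdj_projL (hsol : IsSU2Solution A Φ H)
    (hL : IsHolomorphicEigenline A Φ θ L) (x : M) : metricAdj (H x) (projL H L x) = projL H L x :=
  (eq_metricAdj (hsol.isUnit_det x) (hsol.mul_projL hL x)).symm

lemma projPerp_mul_higgs (hsol : IsSU2Solution A Φ H)
    (hL : IsHolomorphicEigenline A Φ θ L) (x : M) (v : TangentSpace 𝓘(ℝ, ℂ) x) :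
    (1 - projL H L x) * Φ x v = -(θ x v • (1 - projL H L x)) :=
  one_sub_mul_of_eigen (hsol.projL_mul_self hL x) (trace_orthProj (hsol.posDef x) (hL.line x))
    (det_orthProj (hL.line x)) (hL.higgs_mul_projL x v) (hsol.trace_higgs x v)

/-- The connection `∇ + Φ + Φ^*` is unchanged by the twist. -/
theorem twist_add_eq (hsol : IsSU2Solution A Φ H)
    (hL : IsHolomorphicEigenline A Φ θ L) :
    twistConn A Φ H L + twistHiggs A θ H L + (twistHiggs A θ H L).adj (twistMetric H L) =
      A + Φ + Φ.adj H := by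
  funext x
  ext1 v
  have h := twist_fibre (Y := (A - matDifferential (projL H L)) x v) (hsol.isUnit_det x)
    (hsol.hermitian x) (hsol.projL_mul_self hL x)
    (hsol.metricAdj_projL hL x) (hL.higgs_mul_projL x v) (hsol.projPerp_mul_higgs hL x v)
  have key : ∀ a g g' l l' T T' r s : Mat2, -g + g' + l + l' + T + T' = r + s →
      a - g + g' + l + l' + T + T' = a + r + s := by
    intro a g g' l l' T T' r s h
    rw [add_assoc a, ← h]
    abel
  exact key _ _ _ _ _ _ _ _ _ h

lemma alpha_adj_dzbar (hsol : IsSU2Solution A Φ H)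
    (hL : IsHolomorphicEigenline A Φ θ L) (z : ℂ) :
    ((alphaForm Φ H L).adj H).dzbar c z =
      (1 - projL H L (c.symm z)) * (Φ.adj H).dzbar c z * projL H L (c.symm z) := by
  have hu := hsol.isUnit_det (c.symm z)
  have hP := hsol.metricAdj_projL hL (c.symm z)
  have hQ : metricAdj (H (c.symm z)) (1 - projL H L (c.symm z)) = 1 - projL H L (c.symm z) := by
    rw [metricAdj_sub, metricAdj_one hu, hP]
  rw [OneForm.dzbar_adj, OneForm.dzbar_adj, alphaForm, OneForm.dz_sandwich]
  change metricAdj _ (projL H L (c.symm z) * Φ.dz c z * (1 - projL H L (c.symm z))) =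
    _ * metricAdj _ _ * _
  rw [metricAdj_mul hu, metricAdj_mul hu, hP, hQ, ← mul_assoc]

variable [IsManifold 𝓘(ℂ) ω M]

lemma smooth_projL (hsol : IsSU2Solution A Φ H) (hL : IsHolomorphicEigenline A Φ θ L) :
    MatSmooth (projL H L) :=
  matSmooth_iff_chart.2 fun _ hc _ hz => hsol.projL_matContDiffAt hL hc hz

lemma smooth_projPerp (hsol : IsSU2Solution A Φ H) (hL : IsHolomorphicEigenline A Φ θ L) :
    MatSmooth (projPerp H L) :=
  (MatSmooth.const 1).sub (hsol.smooth_projL hL)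

/-- A solution with its eigenline, read in a chart. -/
lemma localEigenline (hsol : IsSU2Solution A Φ H)
    (hL : IsHolomorphicEigenline A Φ θ L) (hc : c ∈ atlas ℂ M) :
    LocalEigenline c.target (A.dz c) (A.dzbar c) (fun w => H (c.symm w)) (Φ.dz c)
      ((Φ.adj H).dzbar c) (fun w => projL H L (c.symm w)) (θ.dz c) where
  isOpen := c.open_target
  smooth_a _ hz := hsol.smooth_conn.dz hc hz
  smooth_b _ hz := hsol.smooth_conn.dzbar hc hz
  smooth_h _ hz := matSmooth_iff_chart.1 hsol.smooth_metric c hc _ hz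
  smooth_φ _ hz := hsol.smooth_higgs.dz hc hz
  smooth_p _ hz := hsol.projL_matContDiffAt hL hc hz
  det_h _ _ := hsol.det_ne_zero _
  unitary _ hz := dWirt_metric hsol.smooth_metric hsol.unitary hc hz
  idem _ _ := hsol.projL_mul_self hL _
  selfAdjoint _ _ := hsol.mul_projL hL _
  eigen z _ := by
    have h : ∀ e, Φ.inChart c z e * projL H L (c.symm z) = θ.inChart c z e • projL H L (c.symm z) :=
      fun e => hL.higgs_mul_projL _ _
    rw [OneForm.dz, OneForm.dz, Matrix.smul_mul, sub_mul, Matrix.smul_mul, h, h]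
    simp only [smul_eq_mul]
    module
  coeigen z _ := by
    have h : ∀ e, (1 - projL H L (c.symm z)) * Φ.inChart c z e =
        -(θ.inChart c z e • (1 - projL H L (c.symm z))) :=
      fun e => hsol.projPerp_mul_higgs hL _ _
    rw [OneForm.dz, OneForm.dz, Matrix.mul_smul, mul_sub, Matrix.mul_smul, h, h]
    simp only [smul_eq_mul]
    module
  dbar_p _ hz := hsol.covZbar_projL hL hc hz
  holomorphic _ hz := hsol.holomorphic c hc _ hz
  curvature _ hz := hsol.curvature_eq c hc _ hz

/-- The form `γ` is of type `(0,1)`, because `L` is holomorphic. -/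
lemma gamma_dz (hsol : IsSU2Solution A Φ H)
    (hL : IsHolomorphicEigenline A Φ θ L) (hc : c ∈ atlas ℂ M) (hz : z ∈ c.target) :
    (gammaForm A H L).dz c z = 0 := by
  have D := hsol.localEigenline hL hc
  have h := D.p_mul_covZ hz
  have hp := D.idem z hz
  have h4 : projL H L (c.symm z) * (1 - projL H L (c.symm z)) = 0 := by
    rw [mul_sub, mul_one, hp, sub_self]
  rw [gammaForm, OneForm.dz_sandwich, OneForm.dz_sub,
    dz_matDifferential (hsol.smooth_projL hL) hc hz]
  rw [covZ] at h
  change projL H L (c.symm z) * (A.dz c z - dWirt (fun w => projL H L (c.symm w)) z) *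
    (1 - projL H L (c.symm z)) = 0
  generalize dWirt (fun w => projL H L (c.symm w)) z = d at *
  generalize projL H L (c.symm z) = p at *
  calc p * (A.dz c z - d) * (1 - p) = -(p * (d + (A.dz c z * p - p * A.dz c z))) * (1 - p) +
        p * A.dz c z * (p * (1 - p)) + (p - p * p) * A.dz c z * (1 - p) := by noncomm_ring
    _ = 0 := by rw [h, h4, hp]; simp

lemma gamma_dzbar (hsol : IsSU2Solution A Φ H)
    (hL : IsHolomorphicEigenline A Φ θ L) (hc : c ∈ atlas ℂ M) (hz : z ∈ c.target) :
    (gammaForm A H L).dzbar c z = -covZbar (A.dzbar c) (fun w => projL H L (c.symm w)) z := by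
  have D := hsol.localEigenline hL hc
  have h := D.p_mul_covZbar hz
  have h' := D.dbar_p z hz
  have hp := D.idem z hz
  have h4 : projL H L (c.symm z) * (1 - projL H L (c.symm z)) = 0 := by
    rw [mul_sub, mul_one, hp, sub_self]
  rw [gammaForm, OneForm.dzbar_sandwich, OneForm.dzbar_sub,
    dzbar_matDifferential (hsol.smooth_projL hL) hc hz]
  have e : covZbar (A.dzbar c) (fun w => projL H L (c.symm w)) z =
      dbarWirt (fun w => projL H L (c.symm w)) z +
        (A.dzbar c z * projL H L (c.symm z) - projL H L (c.symm z) * A.dzbar c z) := rfl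
  change projL H L (c.symm z) * (A.dzbar c z - dbarWirt (fun w => projL H L (c.symm w)) z) *
    (1 - projL H L (c.symm z)) = _
  generalize covZbar (A.dzbar c) (fun w => projL H L (c.symm w)) z = E at *
  generalize dbarWirt (fun w => projL H L (c.symm w)) z = d at *
  generalize projL H L (c.symm z) = p at *
  calc p * (A.dzbar c z - d) * (1 - p) =
        -(p * (d + (A.dzbar c z * p - p * A.dzbar c z))) * (1 - p) +
        p * A.dzbar c z * (p * (1 - p)) + (p - p * p) * A.dzbar c z * (1 - p) := by noncomm_ring
    _ = -E := by rw [← e, h, h4, hp, neg_mul, mul_sub, h']; simp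

lemma gamma_adj_dz (hsol : IsSU2Solution A Φ H)
    (hL : IsHolomorphicEigenline A Φ θ L) (hc : c ∈ atlas ℂ M) (hz : z ∈ c.target) :
    ((gammaForm A H L).adj H).dz c z =
      -covZ (A.dz c) (fun w => projL H L (c.symm w)) z := by
  rw [OneForm.dz_adj, hsol.gamma_dzbar hL hc hz]
  have h := eq_metricAdj (hsol.isUnit_det (c.symm z)) ((hsol.localEigenline hL hc).mul_covZ_p hz)
  rw [h]
  exact metricAdj_neg _ _

lemma gamma_adj_dzbar (hsol : IsSU2Solution A Φ H)
    (hL : IsHolomorphicEigenline A Φ θ L) (hc : c ∈ atlas ℂ M) (hz : z ∈ c.target) :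
    ((gammaForm A H L).adj H).dzbar c z = 0 := by
  rw [OneForm.dzbar_adj, hsol.gamma_dz hL hc hz]; simp

/-- The lower left entry `-γ^*` of the twisted Higgs field is `∂p`. -/
lemma twistHiggs_dz (hsol : IsSU2Solution A Φ H)
    (hL : IsHolomorphicEigenline A Φ θ L) (hc : c ∈ atlas ℂ M) (hz : z ∈ c.target) :
    (twistHiggs A θ H L).dz c z =
      θ.dz c z • (projL H L (c.symm z) - (1 - projL H L (c.symm z))) +
        covZ (A.dz c) (fun w => projL H L (c.symm w)) z := by
  rw [twistHiggs, OneForm.dz_sub, OneForm.dz_scalarMul, hsol.gamma_adj_dz hL hc hz, sub_neg_eq_add]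
  rfl

lemma twistConn_dzbar (hsol : IsSU2Solution A Φ H)
    (hL : IsHolomorphicEigenline A Φ θ L) (hc : c ∈ atlas ℂ M) (hz : z ∈ c.target) :
    (twistConn A Φ H L).dzbar c z =
      A.dzbar c z + covZbar (A.dzbar c) (fun w => projL H L (c.symm w)) z +
        (1 - projL H L (c.symm z)) * (Φ.adj H).dzbar c z * projL H L (c.symm z) := by
  have hα : (alphaForm Φ H L).dzbar c z = 0 := by
    rw [alphaForm, OneForm.dzbar_sandwich, hsol.type_higgs c hc z hz]; simp
  rw [twistConn, OneForm.dzbar_add, OneForm.dzbar_add, OneForm.dzbar_add, OneForm.dzbar_sub,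
    hsol.gamma_dzbar hL hc hz, hsol.gamma_adj_dzbar hL hc hz, hα, hsol.alpha_adj_dzbar hL]
  abel

end IsSU2Solution

end Twist

section Twisted

variable {M : Type*} [TopologicalSpace M] [ChartedSpace ℂ M]
  {A Φ : OneForm M Mat2} {H : M → Mat2} {θ : OneForm M ℂ}
  {L : M → Submodule ℂ (Fin 2 → ℂ)}

lemma det_reflection {P : Mat2} (htr : P.trace = 1) (hdet : P.det = 0) :
    (P - (1 - P)).det = -1 := by
  rw [Matrix.det_fin_two] at hdet ⊢
  rw [Matrix.trace_fin_two] at htr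
  simp
  linear_combination 4 * hdet - 2 * htr

lemma trace_mul_mul_one_sub {P : Mat2} (hP : P * P = P) (X : Mat2) :
    (P * X * (1 - P)).trace = 0 := by
  rw [mul_assoc, Matrix.trace_mul_comm, mul_assoc, sub_mul, one_mul, hP, sub_self, mul_zero,
    Matrix.trace_zero]

namespace IsSU2Solution

lemma trace_projL (hsol : IsSU2Solution A Φ H) (hL : IsHolomorphicEigenline A Φ θ L) (x : M) :
    (projL H L x).trace = 1 := trace_orthProj (hsol.posDef x) (hL.line x)

lemma trace_gammaForm (hsol : IsSU2Solution A Φ H) (hL : IsHolomorphicEigenline A Φ θ L) (x : M)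
    (v : TangentSpace 𝓘(ℝ, ℂ) x) : (gammaForm A H L x v).trace = 0 :=
  trace_mul_mul_one_sub (hsol.projL_mul_self hL x) _

lemma trace_alphaForm (hsol : IsSU2Solution A Φ H) (hL : IsHolomorphicEigenline A Φ θ L) (x : M)
    (v : TangentSpace 𝓘(ℝ, ℂ) x) : (alphaForm Φ H L x v).trace = 0 :=
  trace_mul_mul_one_sub (hsol.projL_mul_self hL x) _

lemma trace_adj (hsol : IsSU2Solution A Φ H) {α : OneForm M Mat2} {x : M}
    {v : TangentSpace 𝓘(ℝ, ℂ) x} (h : (α x v).trace = 0) : (α.adj H x v).trace = 0 := by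
  rw [OneForm.adj_apply, trace_metricAdj (hsol.isUnit_det x), h, map_zero]

lemma twistMetric_isHermitian (hsol : IsSU2Solution A Φ H)
    (hL : IsHolomorphicEigenline A Φ θ L) (x : M) : (twistMetric H L x).IsHermitian := by
  have h := hsol.mul_projL hL x
  have h' := (hsol.hermitian x).eq
  change (H x * (projL H L x - (1 - projL H L x)))ᴴ = H x * (projL H L x - (1 - projL H L x))
  rw [Matrix.conjTranspose_mul, Matrix.conjTranspose_sub, Matrix.conjTranspose_sub, h',
    Matrix.conjTranspose_one, sub_mul, sub_mul, one_mul, ← h]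
  noncomm_ring

lemma det_twistMetric (hsol : IsSU2Solution A Φ H)
    (hL : IsHolomorphicEigenline A Φ θ L) (x : M) : (twistMetric H L x).det = -1 := by
  change (H x * (projL H L x - (1 - projL H L x))).det = -1
  rw [Matrix.det_mul, hsol.det_metric, one_mul,
    det_reflection (hsol.trace_projL hL x) (det_orthProj (hL.line x))]

lemma exists_twistMetric_pos (hsol : IsSU2Solution A Φ H)
    (hL : IsHolomorphicEigenline A Φ θ L) (x : M) :
    ∃ v, 0 < (herm (twistMetric H L x) v v).re := by
  obtain ⟨hg, hg0⟩ := generator_spec (hL.line x)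
  refine ⟨generator (L x), ?_⟩
  have h1 : projL H L x *ᵥ generator (L x) = generator (L x) :=
    orthProj_mulVec_self (hsol.posDef x) (hL.line x) hg
  have h2 : twistMetric H L x *ᵥ generator (L x) = H x *ᵥ generator (L x) := by
    change (H x * (projL H L x - (1 - projL H L x))) *ᵥ generator (L x) = _
    rw [← Matrix.mulVec_mulVec, Matrix.sub_mulVec, Matrix.sub_mulVec, h1, Matrix.one_mulVec,
      sub_self, sub_zero]
  have h3 : 0 < herm (twistMetric H L x) (generator (L x)) (generator (L x)) := by
    rw [herm, h2]; exact herm_self_pos (hsol.posDef x) hg0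
  exact (Complex.pos_iff.1 h3).1

lemma exists_twistMetric_neg (hsol : IsSU2Solution A Φ H)
    (hL : IsHolomorphicEigenline A Φ θ L) (x : M) :
    ∃ v, (herm (twistMetric H L x) v v).re < 0 := by
  obtain ⟨w, hw0, hw⟩ := Matrix.exists_mulVec_eq_zero_iff.2
    (det_orthProj (H := H x) (hL.line x))
  refine ⟨w, ?_⟩
  have h2 : twistMetric H L x *ᵥ w = -(H x *ᵥ w) := by
    change (H x * (orthProj (H x) (L x) - (1 - orthProj (H x) (L x)))) *ᵥ w = _
    rw [← Matrix.mulVec_mulVec, Matrix.sub_mulVec, Matrix.sub_mulVec, hw, Matrix.one_mulVec,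
      zero_sub, sub_zero, Matrix.mulVec_neg]
  have h3 : herm (twistMetric H L x) w w = -herm (H x) w w := by
    rw [herm, h2, dotProduct_neg, herm]
  rw [h3, Complex.neg_re, neg_lt_zero]
  exact (Complex.pos_iff.1 (herm_self_pos (hsol.posDef x) hw0)).1

variable [IsManifold 𝓘(ℂ) ω M]

lemma smooth_twistMetric (hsol : IsSU2Solution A Φ H)
    (hL : IsHolomorphicEigenline A Φ θ L) : MatSmooth (twistMetric H L) :=
  hsol.smooth_metric.mul ((hsol.smooth_projL hL).sub (hsol.smooth_projPerp hL))

lemma smooth_gammaForm (hsol : IsSU2Solution A Φ H)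
    (hL : IsHolomorphicEigenline A Φ θ L) : (gammaForm A H L).MatSmooth :=
  (hsol.smooth_conn.sub (hsol.smooth_projL hL).matDifferential).sandwich (hsol.smooth_projL hL)
    (hsol.smooth_projPerp hL)

lemma smooth_alphaForm (hsol : IsSU2Solution A Φ H)
    (hL : IsHolomorphicEigenline A Φ θ L) : (alphaForm Φ H L).MatSmooth :=
  hsol.smooth_higgs.sandwich (hsol.smooth_projL hL) (hsol.smooth_projPerp hL)

lemma smooth_twistConn (hsol : IsSU2Solution A Φ H)
    (hL : IsHolomorphicEigenline A Φ θ L) : (twistConn A Φ H L).MatSmooth :=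
  (((hsol.smooth_conn.sub (hsol.smooth_gammaForm hL)).add
    ((hsol.smooth_gammaForm hL).adj hsol.smooth_metric hsol.det_ne_zero)).add
    (hsol.smooth_alphaForm hL)).add
    ((hsol.smooth_alphaForm hL).adj hsol.smooth_metric hsol.det_ne_zero)

lemma smooth_twistHiggs (hsol : IsSU2Solution A Φ H) (hθ : θ.Smooth)
    (hL : IsHolomorphicEigenline A Φ θ L) : (twistHiggs A θ H L).MatSmooth :=
  (hθ.scalarMul ((hsol.smooth_projL hL).sub (hsol.smooth_projPerp hL))).sub
    ((hsol.smooth_gammaForm hL).adj hsol.smooth_metric hsol.det_ne_zero)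

/-- The twisted connection is unitary for the twisted metric: passing from `∇` to it removes the
off-diagonal part of `∇`, which exchanges `L` and `L^⊥`, and inserts `α + α^*`, which is skew for
the indefinite metric. -/
lemma unitary_twistConn (hsol : IsSU2Solution A Φ H)
    (hL : IsHolomorphicEigenline A Φ θ L) (x : M) (v : TangentSpace 𝓘(ℝ, ℂ) x) :
    matDifferential (twistMetric H L) x v =
      (twistConn A Φ H L x v)ᴴ * twistMetric H L x + twistMetric H L x * twistConn A Φ H L x v := by
  obtain ⟨c, hc, z, hz, e, rfl, hform⟩ := exists_inChart x v
  have hsP := hsol.smooth_projL hL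
  have hp := (hsol.projL_matContDiffAt hL hc hz).matDiffAt
  have hh := (matSmooth_iff_chart.1 hsol.smooth_metric c hc z hz).matDiffAt
  set P := projL H L (c.symm z) with hPdef
  set dP := matFderiv e (fun w => projL H L (c.symm w)) z with hdPdef
  set dH := matFderiv e (fun w => H (c.symm w)) z with hdHdef
  set X := A.inChart c z e with hX
  set Y := Φ.inChart c z e with hY
  have hPP : P * P = P := hsol.projL_mul_self hL _
  have hu := hsol.isUnit_det (c.symm z)
  have hPadj : metricAdj (H (c.symm z)) P = P := hsol.metricAdj_projL hL _
  have h1 : dP * P + P * dP = dP := by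
    rw [hdPdef, hPdef, ← matFderiv_mul hp hp]
    congr 1
    funext w
    exact hsol.projL_mul_self hL _
  have h2 : dH * P + H (c.symm z) * dP = dPᴴ * H (c.symm z) + Pᴴ * dH := by
    rw [hdPdef, hPdef, hdHdef, ← matFderiv_mul hh hp, ← matFderiv_conjTranspose,
      ← matFderiv_mul hp.conjTranspose hh]
    congr 1
    funext w
    exact hsol.mul_projL hL _
  have hQ : metricAdj (H (c.symm z)) (1 - P) = 1 - P := by
    rw [metricAdj_sub, metricAdj_one hu, hPadj]
  have m3 : (1 - P) * P = 0 := by rw [sub_mul, one_mul, hPP, sub_self]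
  have m4 : P * (1 - P) = 0 := by rw [mul_sub, mul_one, hPP, sub_self]
  have hN : metricAdj (H (c.symm z))
      (P * Y * (1 - P) + metricAdj (H (c.symm z)) (P * Y * (1 - P))) =
      P * Y * (1 - P) + metricAdj (H (c.symm z)) (P * Y * (1 - P)) := by
    rw [metricAdj_add, metricAdj_metricAdj hu (hsol.hermitian _), add_comm]
  have hN' : (P * Y * (1 - P) + metricAdj (H (c.symm z)) (P * Y * (1 - P))) * (P - (1 - P)) +
      (P - (1 - P)) * (P * Y * (1 - P) + metricAdj (H (c.symm z)) (P * Y * (1 - P))) = 0 := by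
    rw [metricAdj_mul hu, metricAdj_mul hu, hQ, hPadj]
    generalize metricAdj (H (c.symm z)) Y = Z
    generalize hQd : 1 - P = Q at *
    have m5 : Q * Q = Q := by rw [← hQd, mul_sub, hQd, mul_one, m3, sub_zero]
    calc _ = P * Y * (Q * P) - P * Y * (Q * Q) + Q * (Z * (P * P)) - Q * (Z * (P * Q))
          + (P * P) * Y * Q - (Q * P) * Y * Q + (P * Q) * (Z * P) - (Q * Q) * (Z * P) := by
          noncomm_ring
      _ = 0 := by
        rw [m3, m4, m5, hPP]
        noncomm_ring
  have key := twist_unitary_fibre hu (hsol.hermitian _) hPP hPadj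
    (matFderiv_metric hsol.smooth_metric hsol.unitary hc hz e) h1 h2 hN hN'
  have hl : matDifferential (twistMetric H L) (c.symm z) v =
      dH * (P - (1 - P)) + H (c.symm z) * (dP + dP) := by
    rw [hform, inChart_matDifferential (hsol.smooth_twistMetric hL) hc hz]
    have h1 : MatDiffAt (fun w => 1 - projL H L (c.symm w)) z :=
      (MatContDiffAt.const 1).matDiffAt.sub hp
    refine (matFderiv_mul hh (hp.sub h1) e).trans ?_
    rw [matFderiv_sub hp h1, matFderiv_sub (MatContDiffAt.const 1).matDiffAt hp, matFderiv_const,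
      zero_sub, sub_neg_eq_add]
  have hA : twistConn A Φ H L (c.symm z) v =
      X - P * (X - dP) * (1 - P) + metricAdj (H (c.symm z)) (P * (X - dP) * (1 - P)) +
        (P * Y * (1 - P) + metricAdj (H (c.symm z)) (P * Y * (1 - P))) := by
    rw [hform, hdPdef, ← inChart_matDifferential hsP hc hz, ← add_assoc]
    rfl
  rw [hl, hA]
  exact key

/-- The triple obtained from a solution of the `SU(2)` self-duality equations by the twist solves
the `SU(1,1)` self-duality equations. -/
theorem isSU11Solution_twist (hsol : IsSU2Solution A Φ H) (hθ : θ.Smooth) (hθ10 : θ.IsType10)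
    (hL : IsHolomorphicEigenline A Φ θ L) :
    IsSU11Solution (twistConn A Φ H L) (twistHiggs A θ H L) (twistMetric H L) := by
  have hdet : ∀ x, (twistMetric H L x).det ≠ 0 := fun x => by
    rw [hsol.det_twistMetric hL]; simp
  have htype : (twistHiggs A θ H L).IsType10 := fun c hc z hz => by
    rw [twistHiggs, OneForm.dzbar_sub, OneForm.dzbar_scalarMul, hθ10 c hc z hz,
      hsol.gamma_adj_dzbar hL hc hz, zero_smul, sub_zero]
  have hol : ∀ c ∈ atlas ℂ M, ∀ z ∈ c.target,
      dbarHiggs c (twistConn A Φ H L) (twistHiggs A θ H L) z = 0 := fun c hc z hz =>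
    (hsol.localEigenline hL hc).covZbar_twist hz (hsol.twistConn_dzbar hL hc hz)
      fun w hw => hsol.twistHiggs_dz hL hc hw
  refine
    { smooth_conn := hsol.smooth_twistConn hL
      smooth_higgs := hsol.smooth_twistHiggs hθ hL
      smooth_metric := hsol.smooth_twistMetric hL
      hermitian := hsol.twistMetric_isHermitian hL
      unitary := hsol.unitary_twistConn hL
      trace_conn := ?_
      trace_higgs := ?_
      type_higgs := htype
      holomorphic := hol
      curvature_eq := ?_
      exists_pos := hsol.exists_twistMetric_pos hL
      exists_neg := hsol.exists_twistMetric_neg hL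
      det_metric := hsol.det_twistMetric hL }
  · intro x v
    change (A x v - gammaForm A H L x v + (gammaForm A H L).adj H x v + alphaForm Φ H L x v +
      (alphaForm Φ H L).adj H x v).trace = 0
    simp only [Matrix.trace_add, Matrix.trace_sub]
    rw [hsol.trace_adj (hsol.trace_gammaForm hL x v), hsol.trace_adj (hsol.trace_alphaForm hL x v),
      hsol.trace_gammaForm hL, hsol.trace_alphaForm hL, hsol.trace_conn]
    simp
  · intro x v
    change (θ x v • (projL H L x - (1 - projL H L x)) - (gammaForm A H L).adj H x v).trace = 0
    rw [Matrix.trace_sub, Matrix.trace_smul, Matrix.trace_sub, Matrix.trace_sub,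
      hsol.trace_adj (hsol.trace_gammaForm hL x v), hsol.trace_projL hL]
    simp
    right; norm_num
  · -- both triples have the same connection `∇ + Φ + Φ^*`, whose flatness is equivalent to the
    -- curvature equation once the Higgs field and its adjoint are holomorphic
    intro c hc z hz
    have hsum := hsol.twist_add_eq hL
    set A' := twistConn A Φ H L with hA'
    set Φ' := twistHiggs A θ H L with hΦ'
    set H' := twistMetric H L with hH'
    have hsA' : A'.MatSmooth := hsol.smooth_twistConn hL
    have hsΦ' : Φ'.MatSmooth := hsol.smooth_twistHiggs hθ hL
    have hsH' : MatSmooth H' := hsol.smooth_twistMetric hL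
    have hadj' := covZ_adj_eq_zero hsΦ' hsH' hdet (hsol.unitary_twistConn hL) hol hc hz
    have hadj := covZ_adj_eq_zero hsol.smooth_higgs hsol.smooth_metric hsol.det_ne_zero
      hsol.unitary hsol.holomorphic hc hz
    have k := curvature_add (hsol.smooth_conn.dz hc hz).matDiffAt
      (hsol.smooth_conn.dzbar hc hz).matDiffAt (hsol.smooth_higgs.dz hc hz).matDiffAt
      ((hsol.smooth_higgs.adj hsol.smooth_metric hsol.det_ne_zero).dzbar hc hz).matDiffAt
    have k' := curvature_add (hsA'.dz hc hz).matDiffAt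
      (hsA'.dzbar hc hz).matDiffAt (hsΦ'.dz hc hz).matDiffAt
      ((hsΦ'.adj hsH' hdet).dzbar hc hz).matDiffAt
    rw [hadj, show covZbar (A.dzbar c) (Φ.dz c) z = 0 from hsol.holomorphic c hc z hz] at k
    rw [hadj', show covZbar (A'.dzbar c) (Φ'.dz c) z = 0 from hol c hc z hz] at k'
    have hz1 : ∀ w ∈ c.target, A'.dz c w + Φ'.dz c w = A.dz c w + Φ.dz c w := fun w hw => by
      have h := congrArg (fun β => OneForm.dz c β w) hsum
      simp only [OneForm.dz_add, OneForm.dz_adj, hsol.type_higgs c hc w hw,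
        htype c hc w hw] at h
      simpa using h
    have hz2 : ∀ w ∈ c.target, A'.dzbar c w + (Φ'.adj H').dzbar c w =
        A.dzbar c w + (Φ.adj H).dzbar c w := fun w hw => by
      have h := congrArg (fun β => OneForm.dzbar c β w) hsum
      simp only [OneForm.dzbar_add, hsol.type_higgs c hc w hw, htype c hc w hw] at h
      simpa using h
    have hU := c.open_target.mem_nhds hz
    rw [hz1 z hz, hz2 z hz, dWirt_congr (eventually_of_mem hU hz2),
      dbarWirt_congr (eventually_of_mem hU hz1), k] at k'
    have h0 := hsol.curvature_eq c hc z hz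
    rw [curvature, bracket] at h0 ⊢
    rw [h0] at k'
    simpa using k'.symm

end IsSU2Solution

end Twisted

/-! ### Parallel frames and harmonic maps -/

section Frames

/-- Endomorphisms that are self-adjoint for `h` are Hermitian forms, here read in a frame `F`. -/
lemma isHermitian_congruence {F h Y : Mat2} (hu : IsUnit h.det) (hh : h.IsHermitian)
    (hY : metricAdj h Y = Y) : (Fᴴ * (h * Y) * F).IsHermitian := by
  have h1 : Yᴴ * h = h * Y := by rw [← mul_metricAdj hu, hY]
  rw [Matrix.IsHermitian, Matrix.conjTranspose_mul, Matrix.conjTranspose_mul,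
    Matrix.conjTranspose_mul, Matrix.conjTranspose_conjTranspose, hh.eq, h1]
  simp only [mul_assoc]

/-- The metric itself belongs to the identity endomorphism. -/
lemma metricInFrame_eq {M X : Type*} {H : M → Mat2} {π : X → M} {F : X → Mat2} (y : X) :
    metricInFrame π H F y = (F y)ᴴ * (H (π y) * 1) * F y := by
  rw [metricInFrame, mul_one]

/-- In a parallel frame, `∂̄∂` of the metric is a scalar multiple of the metric. -/
lemma dbarWirt_dWirt_frame {U : Set ℂ} {a b h φ ψ f : ℂ → Mat2} {z : ℂ} (hU : IsOpen U)
    (hz : z ∈ U) (hf : ∀ w ∈ U, MatDiffAt f w) (hh : ∀ w ∈ U, MatDiffAt h w)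
    (hφ : MatDiffAt φ z)
    (dF : ∀ w ∈ U, dWirt f w = -((a w + φ w) * f w))
    (dF' : ∀ w ∈ U, dbarWirt f w = -((b w + ψ w) * f w))
    (dh : ∀ w ∈ U, dWirt h w = (b w)ᴴ * h w + h w * a w)
    (dh' : dbarWirt h z = (a z)ᴴ * h z + h z * b z)
    (hφh : (φ z)ᴴ * h z = h z * ψ z) (hψh : ∀ w ∈ U, (ψ w)ᴴ * h w = h w * φ w)
    (hol : covZbar b φ z = 0) (hφtr : (φ z).trace = 0) (hψtr : (ψ z).trace = 0) :
    dbarWirt (dWirt fun w => (f w)ᴴ * (h w * 1) * f w) z =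
      (2 * (φ z * ψ z).trace) • ((f z)ᴴ * (h z * 1) * f z) := by
  have c2 : MatDiffAt (fun _ => (-2 : Mat2)) z := (MatContDiffAt.const _).matDiffAt
  have d1 : dWirt (fun w => (f w)ᴴ * (h w * 1) * f w) =ᶠ[𝓝 z]
      fun w => (f w)ᴴ * (h w * (-2 * φ w)) * f w := by
    filter_upwards [hU.mem_nhds hz] with w hw
    rw [dWirt_frame (hf w hw) (hh w hw) (MatContDiffAt.const 1).matDiffAt (dF w hw)
      (dF' w hw) (dh w hw) (hψh w hw)]
    have : covZ a (fun _ => (1 : Mat2)) w = 0 := by simp [covZ, dWirt_const]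
    rw [this]
    congr 3
    noncomm_ring
  rw [dbarWirt_congr d1, dbarWirt_frame (hf z hz) (hh z hz) (c2.mul hφ) (dF z hz)
    (dF' z hz) dh' hφh]
  have e1 : covZbar b (fun _ => (-2 : Mat2)) z = 0 := by
    rw [covZbar, dbarWirt_const]; noncomm_ring
  have e3 := mul_add_mul_of_trace_eq_zero hφtr hψtr
  rw [covZbar_mul c2 hφ, e1, hol]
  have e4 : (0 * φ z + -2 * 0 - ψ z * (-2 * φ z) - -2 * φ z * ψ z) =
      (2 * (φ z * ψ z).trace) • (1 : Mat2) := by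
    rw [mul_smul, ← e3, two_smul]
    noncomm_ring
  rw [e4]
  simp only [Matrix.mul_smul, Matrix.smul_mul]

variable {M X : Type*} [TopologicalSpace M] [ChartedSpace ℂ M]
  [TopologicalSpace X] [ChartedSpace ℂ X]
  {A Φ : OneForm M Mat2} {H : M → Mat2} {π : X → M} {F : X → Mat2}

/-- Unitarity of the pulled back connection. -/
lemma unitary_pullback (hπ : ContMDiff 𝓘(ℂ) 𝓘(ℂ) ω π) (hH : MatSmooth H)
    (hu : ∀ x v, matDifferential H x v = (A x v)ᴴ * H x + H x * A x v) (y : X)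
    (v : TangentSpace 𝓘(ℝ, ℂ) y) :
    matDifferential (fun y => H (π y)) y v =
      (A.pullback π y v)ᴴ * H (π y) + H (π y) * A.pullback π y v := by
  rw [matDifferential_comp hH hπ]
  exact hu _ _

lemma mink_smul_left (r : ℝ) (x y : Fin 4 → ℝ) : mink (r • x) y = r * mink x y := by
  simp [mink]; ring

variable [IsManifold 𝓘(ℂ) ω X] {c : OpenPartialHomeomorph X ℂ} {z : ℂ}

lemma IsParallelFrame.matFderiv_eq (hF : IsParallelFrame π A Φ H F) (hc : c ∈ atlas ℂ X)
    (hz : z ∈ c.target) (e : ℂ) :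
    matFderiv e (fun w => F (c.symm w)) z =
      -(((A.pullback π).inChart c z e + (Φ.pullback π).inChart c z e +
        ((Φ.adj H).pullback π).inChart c z e) * F (c.symm z)) := by
  rw [← inChart_matDifferential hF.smooth hc hz]
  exact eq_neg_of_add_eq_zero_left (hF.parallel _ _)

lemma IsParallelFrame.dWirt_eq (hF : IsParallelFrame π A Φ H F) (hc : c ∈ atlas ℂ X)
    (hz : z ∈ c.target) :
    dWirt (fun w => F (c.symm w)) z =
      -(((A.pullback π).dz c z + (Φ.pullback π).dz c z +
        ((Φ.adj H).pullback π).dz c z) * F (c.symm z)) := by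
  rw [SelfDuality.dWirt_eq, hF.matFderiv_eq hc hz, hF.matFderiv_eq hc hz]
  simp only [OneForm.dz, add_mul, Matrix.smul_mul, sub_mul]
  module

lemma IsParallelFrame.dbarWirt_eq (hF : IsParallelFrame π A Φ H F) (hc : c ∈ atlas ℂ X)
    (hz : z ∈ c.target) :
    dbarWirt (fun w => F (c.symm w)) z =
      -(((A.pullback π).dzbar c z + (Φ.pullback π).dzbar c z +
        ((Φ.adj H).pullback π).dzbar c z) * F (c.symm z)) := by
  rw [SelfDuality.dbarWirt_eq, hF.matFderiv_eq hc hz, hF.matFderiv_eq hc hz]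
  simp only [OneForm.dzbar, add_mul, Matrix.smul_mul]
  module

/-- The derivative of the metric in a parallel frame is `-2 h(Φ + Φ^*)`. -/
lemma matFderiv_metricInFrame (hπ : ContMDiff 𝓘(ℂ) 𝓘(ℂ) ω π) (hH : MatSmooth H)
    (hu : ∀ x v, matDifferential H x v = (A x v)ᴴ * H x + H x * A x v)
    (hdet : ∀ x, IsUnit (H x).det) (hherm : ∀ x, (H x).IsHermitian)
    (hF : IsParallelFrame π A Φ H F) (hc : c ∈ atlas ℂ X) (hz : z ∈ c.target) (e : ℂ) :
    matFderiv e (fun w => metricInFrame π H F (c.symm w)) z =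
      (F (c.symm z))ᴴ * (H (π (c.symm z)) * ((-2 : ℂ) • ((Φ.pullback π).inChart c z e +
        ((Φ.adj H).pullback π).inChart c z e))) * F (c.symm z) := by
  have hFz := (matSmooth_iff_chart.1 hF.smooth c hc z hz).matDiffAt
  have hHs : MatSmooth (fun y => H (π y)) := hH.comp_holomorphic hπ
  have hHz := (matSmooth_iff_chart.1 hHs c hc z hz).matDiffAt
  have h1 := matFderiv_metric (A := A.pullback π) hHs (unitary_pullback hπ hH hu) hc hz e
  refine (matFderiv_mul (hFz.conjTranspose.mul hHz) hFz e).trans ?_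
  rw [matFderiv_mul hFz.conjTranspose hHz, matFderiv_conjTranspose, hF.matFderiv_eq hc hz, h1]
  have h2 : ((Φ.adj H).pullback π).inChart c z e =
      metricAdj (H (π (c.symm z))) ((Φ.pullback π).inChart c z e) := rfl
  have h3 := mul_metricAdj (hdet (π (c.symm z))) ((Φ.pullback π).inChart c z e)
  have h4 := mul_metricAdj (hdet (π (c.symm z)))
    (metricAdj (H (π (c.symm z))) ((Φ.pullback π).inChart c z e))
  rw [metricAdj_metricAdj (hdet _) (hherm _)] at h4
  rw [← h2] at h3 h4
  generalize (A.pullback π).inChart c z e = a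
  generalize ((Φ.adj H).pullback π).inChart c z e = ψ at *
  generalize (Φ.pullback π).inChart c z e = φ at *
  simp only [Matrix.conjTranspose_neg, Matrix.conjTranspose_mul, Matrix.conjTranspose_add]
  generalize H (π (c.symm z)) = h at *
  generalize F (c.symm z) = f
  calc _ = -(fᴴ * (φᴴ * h + ψᴴ * h) * f) - fᴴ * (h * (φ + ψ)) * f := by noncomm_ring
    _ = _ := by
      rw [← h3, ← h4]
      simp only [Matrix.mul_smul, Matrix.smul_mul, mul_add, add_mul]
      module

variable [IsManifold 𝓘(ℂ) ω M]

/-- The metric of a self-dual triple in a parallel frame is a harmonic map: by the frame equations,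
its `∂̄∂`-derivative is `2 h{Φ, Φ^*}`, and trace-free matrices anticommute up to scalars, so that
the Laplacian is normal to the quadric `{⟨p, p⟩ = ε}`. -/
theorem IsSelfDual.isHarmonicInto (hS : IsSelfDual A Φ H) (hπ : ContMDiff 𝓘(ℂ) 𝓘(ℂ) ω π)
    {ε : ℝ} (hε : ε ≠ 0) (hdet : ∀ x, (H x).det = -ε) (hF : IsParallelFrame π A Φ H F) :
    IsHarmonicInto ε (associatedMap π H F) := by
  have hdet0 : ∀ x, (H x).det ≠ 0 := fun x => by rw [hdet]; simpa using hε
  have hu : ∀ x, IsUnit (H x).det := fun x => isUnit_iff_ne_zero.2 (hdet0 x)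
  have hHs : MatSmooth (fun y => H (π y)) := hS.smooth_metric.comp_holomorphic hπ
  have hBs : ∀ c ∈ atlas ℂ X, ∀ z ∈ c.target,
      MatContDiffAt (fun w => metricInFrame π H F (c.symm w)) z := fun c hc z hz => by
    have h1 := matSmooth_iff_chart.1 hF.smooth c hc z hz
    exact (h1.conjTranspose.mul (matSmooth_iff_chart.1 hHs c hc z hz)).mul h1
  refine ⟨contMDiff_iff_chart.2 fun c hc z hz => (hBs c hc z hz).toMink, fun y => ?_, ?_⟩
  · have hB : (metricInFrame π H F y).IsHermitian := by
      rw [metricInFrame_eq]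
      exact isHermitian_congruence (hu _) (hS.hermitian _) (metricAdj_one (hu _))
    have h := mink_toMink hB hB
    rw [metricInFrame_eq, trace_congruence (hF.det y), hdet, Matrix.adjugate_one, one_mul,
      Matrix.trace_one, Fintype.card_fin] at h
    have h' : ((mink (associatedMap π H F y) (associatedMap π H F y) : ℝ) : ℂ) = (ε : ℂ) := by
      rw [associatedMap, metricInFrame_eq, h]; push_cast; ring
    exact_mod_cast h'
  · intro c hc z hz T hT
    set a := (A.pullback π).dz c with ha
    set b := (A.pullback π).dzbar c with hb
    set φ := (Φ.pullback π).dz c with hφ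
    set ψ := ((Φ.adj H).pullback π).dzbar c with hψ
    set h : ℂ → Mat2 := fun w => H (π (c.symm w)) with hh
    set f : ℂ → Mat2 := fun w => F (c.symm w) with hf
    have htype : ∀ w ∈ c.target, (Φ.pullback π).dzbar c w = 0 := fun w hw =>
      hS.type_higgs.pullback hπ c hc w hw
    have hadj : (Φ.adj H).pullback π = (Φ.pullback π).adj (fun y => H (π y)) := rfl
    have hψ' : ∀ w, ψ w = metricAdj (h w) (φ w) := fun w => by
      rw [hψ, hadj, OneForm.dzbar_adj]; rfl
    have htype' : ∀ w ∈ c.target, ((Φ.adj H).pullback π).dz c w = 0 := fun w hw => by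
      rw [hadj, OneForm.dz_adj, htype w hw]; simp
    have hfs : ∀ w ∈ c.target, MatDiffAt f w := fun w hw =>
      (matSmooth_iff_chart.1 hF.smooth c hc w hw).matDiffAt
    have hhs : ∀ w ∈ c.target, MatDiffAt h w := fun w hw =>
      (matSmooth_iff_chart.1 hHs c hc w hw).matDiffAt
    have hφs : MatDiffAt φ z := ((hS.smooth_higgs.pullback hπ).dz hc hz).matDiffAt
    have dF : ∀ w ∈ c.target, dWirt f w = -((a w + φ w) * f w) := fun w hw => by
      rw [hf, hF.dWirt_eq hc hw, htype' w hw, add_zero]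
    have dF' : ∀ w ∈ c.target, dbarWirt f w = -((b w + ψ w) * f w) := fun w hw => by
      rw [hf, hF.dbarWirt_eq hc hw, htype w hw, add_zero]
    have hup := unitary_pullback hπ hS.smooth_metric hS.unitary (A := A)
    have hφh : ∀ w, (φ w)ᴴ * h w = h w * ψ w := fun w => by
      rw [hψ', mul_metricAdj (hu _)]
    have hψh : ∀ w, (ψ w)ᴴ * h w = h w * φ w := fun w => by
      rw [hψ', ← mul_metricAdj (hu _), metricAdj_metricAdj (hu _) (hS.hermitian _)]
    have hφ0 : ∀ y v, (Φ.pullback π y v).trace = 0 := fun y v => hS.trace_higgs (π y) _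
    have hφtr : (φ z).trace = 0 := trace_dz hφ0 _ _
    have hψtr : (ψ z).trace = 0 := by
      rw [hψ', trace_metricAdj (hu _), hφtr, map_zero]
    have d2 := dbarWirt_dWirt_frame c.open_target hz hfs hhs hφs dF dF'
      (fun w hw => dWirt_metric (A := A.pullback π) hHs hup hc hw)
      (dbarWirt_metric (A := A.pullback π) hHs hup hc hz) (hφh z) (fun w _ => hψh w)
      (dbarHiggs_pullback hπ hS.smooth_higgs hS.holomorphic hc hz) hφtr hψtr
    have hB : (fun w => (f w)ᴴ * (h w * 1) * f w) = fun w => metricInFrame π H F (c.symm w) :=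
      funext fun w => (metricInFrame_eq (H := H) (π := π) (F := F) (c.symm w)).symm
    have hBz : (f z)ᴴ * (h z * 1) * f z = metricInFrame π H F (c.symm z) := congrFun hB z
    rw [hB, hBz] at d2
    have hreal : ((((φ z * ψ z).trace).re : ℝ) : ℂ) = (φ z * ψ z).trace := by
      rw [← Complex.conj_eq_iff_re, ← trace_metricAdj (hu (π (c.symm z)))]
      change (metricAdj (h z) _).trace = _
      rw [metricAdj_mul (hu _), hψ', metricAdj_metricAdj (hu _) (hS.hermitian _)]
    have hlap : Laplacian.laplacian (associatedMap π H F ∘ c.symm) z =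
        (8 * ((φ z * ψ z).trace).re) • associatedMap π H F (c.symm z) := by
      refine (laplacian_toMink c.open_target (fun w hw => hBs c hc w hw) hz).trans ?_
      rw [d2, associatedMap, ← toMink_smul]
      congr 1
      rw [smul_smul]
      congr 1
      rw [Complex.ofReal_mul, hreal]
      push_cast
      ring
    rw [hlap, mink_smul_left, hT, mul_zero]

end Frames

/-! ### The oblique Gauss map -/

section FrameAlgebra

variable {F h : Mat2}

/-- The Minkowski product of two forms read in a frame of determinant one. -/
lemma mink_frame {Y Z : Mat2} (hF : F.det = 1) (hdet : h.det = 1) (hh : h.IsHermitian)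
    (hY : metricAdj h Y = Y) (hZ : metricAdj h Z = Z) :
    ((mink (toMink (Fᴴ * (h * Y) * F)) (toMink (Fᴴ * (h * Z) * F)) : ℝ) : ℂ) =
      -(1 / 2) * (Y * Z.adjugate).trace := by
  have hu : IsUnit h.det := by rw [hdet]; exact isUnit_one
  rw [mink_toMink (isHermitian_congruence hu hh hY) (isHermitian_congruence hu hh hZ),
    trace_congruence hF, hdet, one_mul]

/-- Congruence by a matrix of determinant one preserves `tr (B₀ adj B₁ B₂ adj B₃)`. -/
lemma trace_congruence_four {Y₀ Y₁ Y₂ Y₃ : Mat2} (hF : F.det = 1) (hdet : h.det = 1) :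
    ((Fᴴ * (h * Y₀) * F) * (Fᴴ * (h * Y₁) * F).adjugate * (Fᴴ * (h * Y₂) * F) *
      (Fᴴ * (h * Y₃) * F).adjugate).trace = (Y₀ * Y₁.adjugate * Y₂ * Y₃.adjugate).trace := by
  have f1 : F * F.adjugate = 1 := by rw [Matrix.mul_adjugate, hF, one_smul]
  have f2 : Fᴴ.adjugate * Fᴴ = 1 := by
    rw [Matrix.adjugate_mul, Matrix.det_conjTranspose, hF]; simp
  have f3 : h.adjugate * h = 1 := by rw [Matrix.adjugate_mul, hdet, one_smul]
  have key : ∀ Y Z : Mat2, (Fᴴ * (h * Y) * F) * (Fᴴ * (h * Z) * F).adjugate =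
      (Fᴴ * h) * (Y * Z.adjugate) * (h.adjugate * Fᴴ.adjugate) := fun Y Z => by
    rw [Matrix.adjugate_mul_distrib, Matrix.adjugate_mul_distrib, Matrix.adjugate_mul_distrib]
    generalize F.adjugate = G at *
    generalize Fᴴ.adjugate = G'
    generalize Fᴴ = F'
    generalize h.adjugate = h'
    calc _ = F' * (h * Y) * (F * G) * (Z.adjugate * h' * G') := by simp only [mul_assoc]
      _ = _ := by rw [f1]; simp only [mul_assoc, one_mul]
  have inv : (h.adjugate * Fᴴ.adjugate) * (Fᴴ * h) = 1 := by
    rw [mul_assoc, ← mul_assoc _ Fᴴ h, f2, one_mul, f3]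
  rw [mul_assoc (_ * _), key, key]
  generalize h.adjugate * Fᴴ.adjugate = V at *
  generalize Fᴴ * h = U at *
  generalize Y₀ * Y₁.adjugate = y
  rw [mul_assoc y]
  generalize Y₂ * Y₃.adjugate = y'
  calc _ = ((U * (y * ((V * U) * y'))) * V).trace := by simp only [mul_assoc]
    _ = ((V * U) * (y * y')).trace := by
        rw [inv, one_mul, Matrix.trace_mul_comm, ← mul_assoc, inv]
    _ = _ := by rw [inv, one_mul]

/-- The determinant of four forms read in a frame of determinant one. -/
lemma det_frame {Y₀ Y₁ Y₂ Y₃ : Mat2} (hF : F.det = 1) (hdet : h.det = 1) (hh : h.IsHermitian)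
    (h₀ : metricAdj h Y₀ = Y₀) (h₁ : metricAdj h Y₁ = Y₁) (h₂ : metricAdj h Y₂ = Y₂)
    (h₃ : metricAdj h Y₃ = Y₃) :
    (Matrix.of ![toMink (Fᴴ * (h * Y₀) * F), toMink (Fᴴ * (h * Y₁) * F),
      toMink (Fᴴ * (h * Y₂) * F), toMink (Fᴴ * (h * Y₃) * F)]).det =
      -(1 / 2) * ((Y₀ * Y₁.adjugate * Y₂ * Y₃.adjugate).trace).im := by
  have hu : IsUnit h.det := by rw [hdet]; exact isUnit_one
  rw [det_toMink (isHermitian_congruence hu hh h₀) (isHermitian_congruence hu hh h₁)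
    (isHermitian_congruence hu hh h₂) (isHermitian_congruence hu hh h₃),
    trace_congruence_four hF hdet]

open scoped MatrixOrder in
/-- The square of the norm of an endomorphism for a positive definite metric. -/
lemma trace_mul_metricAdj_nonneg (hh : h.PosDef) (Y : Mat2) :
    0 ≤ ((Y * metricAdj h Y).trace).re ∧ (((Y * metricAdj h Y).trace).re = 0 → Y = 0) := by
  obtain ⟨B, hB⟩ : ∃ B : Mat2, h = Bᴴ * B :=
    CStarAlgebra.nonneg_iff_eq_star_mul_self.mp hh.posSemidef.nonneg
  have hBu : IsUnit B.det := by
    have h1 := hh.det_pos.ne'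
    rw [hB, Matrix.det_mul] at h1
    exact isUnit_iff_ne_zero.2 (right_ne_zero_of_mul h1)
  have hB1 : B⁻¹ * B = 1 := Matrix.nonsing_inv_mul _ hBu
  have hB2 : B * B⁻¹ = 1 := Matrix.mul_nonsing_inv _ hBu
  set Z : Mat2 := B * Y * B⁻¹ with hZ
  have hhi : h⁻¹ = B⁻¹ * (B⁻¹)ᴴ := by
    rw [hB, Matrix.mul_inv_rev, Matrix.conjTranspose_nonsing_inv]
  have htr : (Y * metricAdj h Y).trace = (Z * Zᴴ).trace := by
    rw [metricAdj, hhi, hZ, Matrix.conjTranspose_mul, Matrix.conjTranspose_mul, hB]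
    calc _ = (Y * B⁻¹ * (B⁻¹)ᴴ * Yᴴ * Bᴴ * B).trace := by simp only [mul_assoc]
      _ = _ := by rw [Matrix.trace_mul_comm]; simp only [mul_assoc]
  have hnn : 0 ≤ (Z * Zᴴ).trace := (Matrix.posSemidef_self_mul_conjTranspose Z).trace_nonneg
  rw [htr]
  refine ⟨(Complex.le_def.1 hnn).1, fun h0 => ?_⟩
  have hZ0 : Z = 0 := by
    rw [← Matrix.trace_mul_conjTranspose_self_eq_zero_iff]
    exact Complex.ext h0 (Complex.le_def.1 hnn).2.symm
  calc Y = (B⁻¹ * B) * Y * (B⁻¹ * B) := by rw [hB1, one_mul, mul_one]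
    _ = B⁻¹ * Z * B := by rw [hZ]; simp only [mul_assoc]
    _ = 0 := by rw [hZ0, mul_zero, zero_mul]

end FrameAlgebra

section Fibre

variable {H P φ : Mat2} {t : ℂ}

/-- The matrix `(t, α; 0, -t)` of a Higgs field with respect to `L ⊕ L^⊥`. -/
lemma eq_add_of_eigen (hP : P * P = P) (he : φ * P = t • P)
    (hc : (1 - P) * φ = -(t • (1 - P))) :
    φ = t • (P - (1 - P)) + P * φ * (1 - P) := by
  have h1 : φ = φ * P + (P * φ * (1 - P) + ((1 - P) * φ) * (1 - P)) := by noncomm_ring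
  have h2 : (1 - P) * (1 - P) = 1 - P := by
    rw [mul_sub, mul_one, sub_mul, one_mul, hP, sub_self, sub_zero]
  conv_lhs => rw [h1, he, hc, neg_mul, Matrix.smul_mul, h2]
  module

lemma trace_mul_reflection (htr : P.trace = 1) (he : φ * P = t • P) (hφ : φ.trace = 0) :
    (φ * (P - (1 - P))).trace = 2 * t := by
  have : φ * (P - (1 - P)) = φ * P + φ * P - φ := by noncomm_ring
  rw [this, he, Matrix.trace_sub, Matrix.trace_add, Matrix.trace_smul, htr, hφ, smul_eq_mul]
  ring

/-- A trace-free endomorphism with eigenvalue `t` squares to `t²`. -/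
lemma sq_of_eigen (hP0 : P ≠ 0) (he : φ * P = t • P) (hφ : φ.trace = 0) :
    φ * φ = (t ^ 2) • (1 : Mat2) := by
  have h1 := mul_add_mul_of_trace_eq_zero hφ hφ
  have h2 : (φ * φ + φ * φ) * P = (2 * t ^ 2) • P := by
    rw [add_mul, mul_assoc, he, Matrix.mul_smul, he]; module
  rw [h1, Matrix.smul_mul, one_mul] at h2
  have h3 : (φ * φ).trace = 2 * t ^ 2 := by
    have := sub_eq_zero.2 h2
    rw [← sub_smul] at this
    exact sub_eq_zero.1 ((smul_eq_zero.1 this).resolve_right hP0)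
  rw [h3] at h1
  have h4 : (2 : ℂ) • (φ * φ) = (2 : ℂ) • ((t ^ 2) • (1 : Mat2)) := by
    rw [two_smul, h1]; module
  exact smul_right_injective Mat2 (two_ne_zero (α := ℂ)) h4

/-- The orientation of `(f, N, f_x, f_y)` is determined by the norm of the off-diagonal part of the
Higgs field. -/
lemma orientation_trace (hu : IsUnit H.det) (hP : P * P = P) (hPa : metricAdj H P = P)
    (htr : P.trace = 1)
    (he : φ * P = t • P) (hc : (1 - P) * φ = -(t • (1 - P))) (hφ : φ.trace = 0) :
    ((P - (1 - P)) * ((φ + metricAdj H φ) * (φ - metricAdj H φ))).trace =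
      -2 * ((P * φ * (1 - P)) * metricAdj H (P * φ * (1 - P))).trace := by
  have hP0 : P ≠ 0 := by rintro rfl; simp at htr
  have hsq := sq_of_eigen hP0 he hφ
  have hsq' : metricAdj H φ * metricAdj H φ = (conj t ^ 2) • (1 : Mat2) := by
    rw [← metricAdj_mul hu, hsq, metricAdj_smul, metricAdj_one hu, map_pow]
  have hS : (P - (1 - P)).trace = 0 := by
    rw [Matrix.trace_sub, Matrix.trace_sub, htr]; simp; norm_num
  have hQ : metricAdj H (1 - P) = 1 - P := by rw [metricAdj_sub, metricAdj_one hu, hPa]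
  have hφeq := eq_add_of_eigen hP he hc
  set α := P * φ * (1 - P) with hα
  set S := P - (1 - P) with hSdef
  have hSa : metricAdj H S = S := by rw [hSdef, metricAdj_sub, hPa, hQ]
  have m3 : (1 - P) * P = 0 := by rw [sub_mul, one_mul, hP, sub_self]
  have m4 : P * (1 - P) = 0 := by rw [mul_sub, mul_one, hP, sub_self]
  have m5 : (1 - P) * (1 - P) = 1 - P := by rw [mul_sub, m3, mul_one, sub_zero]
  have s1 : S * α = α := by
    calc S * α = (P * P) * φ * (1 - P) - ((1 - P) * P) * φ * (1 - P) := by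
          rw [hα, hSdef]; noncomm_ring
      _ = α := by rw [hP, m3]; simp [hα]
  have s2 : α * S = -α := by
    calc α * S = P * φ * ((1 - P) * P) - P * φ * ((1 - P) * (1 - P)) := by
          rw [hα, hSdef]; noncomm_ring
      _ = -α := by rw [m3, m5]; simp [hα]
  have s3 : φ * S - S * φ = -2 * α := by
    rw [hφeq, add_mul, mul_add, s1, s2, Matrix.smul_mul, Matrix.mul_smul]
    noncomm_ring
  have hψeq : metricAdj H φ = conj t • S + metricAdj H α := by
    conv_lhs => rw [hφeq, metricAdj_add, metricAdj_smul, hSa]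
  have hα0 : (S * α).trace = 0 := by rw [s1, hα]; exact trace_mul_mul_one_sub hP _
  calc (S * ((φ + metricAdj H φ) * (φ - metricAdj H φ))).trace
      = (S * (φ * φ)).trace - (S * (metricAdj H φ * metricAdj H φ)).trace
        + (S * (metricAdj H φ * φ)).trace - (S * φ * metricAdj H φ).trace := by
        rw [← Matrix.trace_sub, ← Matrix.trace_add, ← Matrix.trace_sub]; congr 1; noncomm_ring
    _ = (metricAdj H φ * (φ * S)).trace - (metricAdj H φ * (S * φ)).trace := by
        rw [hsq, hsq', Matrix.mul_smul, Matrix.mul_smul, mul_one, Matrix.trace_smul,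
          Matrix.trace_smul, hS, Matrix.trace_mul_comm S, Matrix.trace_mul_comm (S * φ), mul_assoc]
        simp
    _ = (metricAdj H φ * (-2 * α)).trace := by rw [← Matrix.trace_sub, ← mul_sub, s3]
    _ = -2 * (metricAdj H φ * α).trace := by
        rw [show metricAdj H φ * (-2 * α) = (-2 : ℂ) • (metricAdj H φ * α) by
          rw [neg_smul, two_smul]; noncomm_ring, Matrix.trace_smul, smul_eq_mul]
    _ = _ := by
        rw [hψeq, add_mul, Matrix.trace_add, Matrix.smul_mul, Matrix.trace_smul, hα0, smul_zero,
          zero_add, Matrix.trace_mul_comm]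

end Fibre

/-- A positive definite metric in a frame has positive trace: the map lands in the upper sheet. -/
lemma IsSU2Solution.associatedMap_zero_pos {M X : Type*} [TopologicalSpace M] [ChartedSpace ℂ M]
    {A Φ : OneForm M Mat2} {H : M → Mat2} {π : X → M} {F : X → Mat2} (hsol : IsSU2Solution A Φ H)
    (hF : ∀ y, (F y).det = 1) (y : X) :
    0 < associatedMap π H F y 0 := by
  have hu : IsUnit (F y) := by
    rw [Matrix.isUnit_iff_isUnit_det, hF]; exact isUnit_one
  have h1 : ((F y)ᴴ * H (π y) * F y).PosDef :=
    (hsol.posDef (π y)).conjTranspose_mul_mul_same (Matrix.mulVec_injective_of_isUnit hu)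
  have h2 := h1.trace_pos
  have h3 := (Complex.lt_def.1 h2).1
  rw [Matrix.trace_fin_two, Complex.add_re] at h3
  have : associatedMap π H F y 0 = ((metricInFrame π H F y 0 0).re +
    (metricInFrame π H F y 1 1).re) / 2 := rfl
  rw [this]
  exact half_pos h3

section GaussMap

variable {M X : Type*} [TopologicalSpace M] [ChartedSpace ℂ M]
  [TopologicalSpace X] [ChartedSpace ℂ X]
  {A Φ : OneForm M Mat2} {θ : OneForm M ℂ} {H : M → Mat2} {L : M → Submodule ℂ (Fin 2 → ℂ)}
  {π : X → M} {F : X → Mat2} {c : OpenPartialHomeomorph X ℂ} {z : ℂ}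

lemma OneForm.IsType10.inChart_eq {W : Type*} [AddCommGroup W] [Module ℝ W] [Module ℂ W]
    [IsScalarTower ℝ ℂ W] {α : OneForm X W} (hα : α.IsType10) (hc : c ∈ atlas ℂ X)
    (hz : z ∈ c.target) (e : ℂ) : α.inChart c z e = e • α.dz c z := by
  rw [α.inChart_eq_dz_add_dzbar, hα c hc z hz, smul_zero, add_zero]

/-- A solution with its eigenline and a parallel frame, read at one point of a chart: `h` is the
metric, `P` the projection onto the eigenline, `φ dz` the Higgs field and `t dz` the eigenvalue. -/
structure EigenFibre (h P φ : Mat2) (t : ℂ) : Prop where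
  posDef : h.PosDef
  det_metric : h.det = 1
  idem : P * P = P
  selfAdj : metricAdj h P = P
  trace_proj : P.trace = 1
  eigen : φ * P = t • P
  coeigen : (1 - P) * φ = -(t • (1 - P))
  trace_higgs : φ.trace = 0

namespace EigenFibre

variable {h P φ : Mat2} {t : ℂ}

lemma isUnit_det (D : EigenFibre h P φ t) : IsUnit h.det := by
  rw [D.det_metric]; exact isUnit_one

lemma sq_reflection (D : EigenFibre h P φ t) : (P - (1 - P)) * (P - (1 - P)) = 1 := by
  have : (P - (1 - P)) * (P - (1 - P)) =
      (P * P - P) + (P * P - P) + (P * P - P) + (P * P - P) + 1 := by noncomm_ring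
  rw [this, D.idem, sub_self]; simp

lemma trace_reflection (D : EigenFibre h P φ t) : (P - (1 - P)).trace = 0 := by
  rw [Matrix.trace_sub, Matrix.trace_sub, D.trace_proj]; simp; norm_num

lemma metricAdj_reflection (D : EigenFibre h P φ t) :
    metricAdj h (P - (1 - P)) = P - (1 - P) := by
  rw [metricAdj_sub, metricAdj_sub, metricAdj_one D.isUnit_det, D.selfAdj]

lemma trace_adj (D : EigenFibre h P φ t) : (metricAdj h φ).trace = 0 := by
  rw [trace_metricAdj D.isUnit_det, D.trace_higgs, map_zero]

/-- The self-adjoint endomorphism `-2 (Φ + Φ^*)(e)`, for `Φ = φ dz`. In a parallel frame `F`, the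
derivative of `F^* h F` in the direction `e` is `F^* h (-2 (Φ + Φ^*)(e)) F`. -/
abbrev deriv (h φ : Mat2) (e : ℂ) : Mat2 :=
  (-2 : ℂ) • (e • φ + conj e • metricAdj h φ)

lemma trace_deriv (D : EigenFibre h P φ t) (e : ℂ) : (deriv h φ e).trace = 0 := by
  simp [D.trace_higgs, D.trace_adj]

lemma metricAdj_deriv (D : EigenFibre h P φ t) (e : ℂ) :
    metricAdj h (deriv h φ e) = deriv h φ e := by
  rw [metricAdj_smul, metricAdj_add, metricAdj_smul, metricAdj_smul,
    metricAdj_metricAdj D.isUnit_det D.posDef.isHermitian, Complex.conj_conj, add_comm,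
    map_neg, map_ofNat]

lemma adjugate_deriv (D : EigenFibre h P φ t) (e : ℂ) :
    (deriv h φ e).adjugate = -deriv h φ e := adjugate_of_trace_eq_zero (D.trace_deriv e)

/-- The induced bilinear form of the metric in a parallel frame. -/
lemma mink_deriv (D : EigenFibre h P φ t) {F : Mat2} (hF : F.det = 1) (e e' : ℂ) :
    ((mink (toMink (Fᴴ * (h * deriv h φ e) * F)) (toMink (Fᴴ * (h * deriv h φ e') * F)) : ℝ) : ℂ)
      = 2 * ((e • φ + conj e • metricAdj h φ) * (e' • φ + conj e' • metricAdj h φ)).trace := by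
  rw [mink_frame hF D.det_metric D.posDef.isHermitian (D.metricAdj_deriv e) (D.metricAdj_deriv e'),
    D.adjugate_deriv, deriv, deriv, mul_neg, Matrix.trace_neg, Matrix.smul_mul, Matrix.mul_smul,
    Matrix.trace_smul, Matrix.trace_smul, smul_eq_mul, smul_eq_mul]
  ring

/-- The contraction `⟨df, N⟩ = η + η̄` for `η = -2 t dz`. -/
lemma mink_deriv_reflection (D : EigenFibre h P φ t) {F : Mat2} (hF : F.det = 1) (e : ℂ) :
    ((mink (toMink (Fᴴ * (h * deriv h φ e) * F)) (toMink (Fᴴ * (h * (P - (1 - P))) * F)) : ℝ) : ℂ)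
      = -2 * (e * t) + conj (-2 * (e * t)) := by
  have h1 := trace_mul_reflection D.trace_proj D.eigen D.trace_higgs
  have h2 : (metricAdj h φ * (P - (1 - P))).trace = conj (2 * t) := by
    rw [← h1, Matrix.trace_mul_comm φ, ← trace_metricAdj D.isUnit_det,
      metricAdj_mul D.isUnit_det, D.metricAdj_reflection]
  rw [mink_frame hF D.det_metric D.posDef.isHermitian (D.metricAdj_deriv e) D.metricAdj_reflection,
    adjugate_of_trace_eq_zero D.trace_reflection, deriv, mul_neg, Matrix.trace_neg,
    Matrix.smul_mul, add_mul, Matrix.smul_mul, Matrix.smul_mul, Matrix.trace_smul,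
    Matrix.trace_add, Matrix.trace_smul, Matrix.trace_smul, h1, h2]
  simp only [smul_eq_mul, map_mul, map_neg, map_ofNat]
  ring

lemma mink_reflection_one (D : EigenFibre h P φ t) {F : Mat2} (hF : F.det = 1) :
    mink (toMink (Fᴴ * (h * (P - (1 - P))) * F)) (toMink (Fᴴ * (h * 1) * F)) = 0 := by
  have := mink_frame hF D.det_metric D.posDef.isHermitian D.metricAdj_reflection
    (metricAdj_one D.isUnit_det)
  rw [Matrix.adjugate_one, mul_one (P - (1 - P)), D.trace_reflection, mul_zero] at this
  exact_mod_cast this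

lemma mink_reflection_self (D : EigenFibre h P φ t) {F : Mat2} (hF : F.det = 1) :
    mink (toMink (Fᴴ * (h * (P - (1 - P))) * F)) (toMink (Fᴴ * (h * (P - (1 - P))) * F)) = 1 := by
  have := mink_frame hF D.det_metric D.posDef.isHermitian D.metricAdj_reflection
    D.metricAdj_reflection
  rw [adjugate_of_trace_eq_zero D.trace_reflection, mul_neg, D.sq_reflection, Matrix.trace_neg,
    Matrix.trace_one, Fintype.card_fin] at this
  have h2 : -(1 / 2 : ℂ) * -((2 : ℕ) : ℂ) = 1 := by norm_num
  rw [h2] at this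
  exact_mod_cast this

/-- The coefficient of the Hopf differential is `2 tr φ² = 4 t²`. -/
lemma hopf_deriv (D : EigenFibre h P φ t) {F : Mat2} (hF : F.det = 1) {p q : Fin 4 → ℝ}
    (hp : p = toMink (Fᴴ * (h * deriv h φ 1) * F))
    (hq : q = toMink (Fᴴ * (h * deriv h φ Complex.I) * F)) :
    (1 / 4 : ℂ) * (((mink p p - mink q q : ℝ) : ℂ) - 2 * Complex.I * ((mink p q : ℝ) : ℂ)) =
      4 * t ^ 2 := by
  have hP0 : P ≠ 0 := by
    rintro rfl; simpa using D.trace_proj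
  have hsq : (φ * φ).trace = 2 * t ^ 2 := by
    rw [sq_of_eigen hP0 D.eigen D.trace_higgs, Matrix.trace_smul, Matrix.trace_one]
    simp [mul_comm]
  subst hp hq
  rw [Complex.ofReal_sub, D.mink_deriv hF, D.mink_deriv hF, D.mink_deriv hF]
  simp only [map_one, one_smul, Complex.conj_I, add_mul, mul_add, Matrix.trace_add,
    Matrix.smul_mul, Matrix.mul_smul, Matrix.trace_smul, smul_eq_mul, hsq]
  rw [Matrix.trace_mul_comm (metricAdj h φ) φ]
  ring_nf
  simp only [Complex.I_sq]
  ring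

/-- `det (f, N, f_x, f_y)` is four times the squared norm of the part of the Higgs field that maps
`L^⊥` to `L`. -/
lemma det_deriv (D : EigenFibre h P φ t) {F : Mat2} (hF : F.det = 1) :
    (Matrix.of ![toMink (Fᴴ * (h * 1) * F), toMink (Fᴴ * (h * (P - (1 - P))) * F),
      toMink (Fᴴ * (h * deriv h φ 1) * F), toMink (Fᴴ * (h * deriv h φ Complex.I) * F)]).det =
      4 * ((P * φ * (1 - P) * metricAdj h (P * φ * (1 - P))).trace).re := by
  rw [det_frame hF D.det_metric D.posDef.isHermitian (metricAdj_one D.isUnit_det)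
    D.metricAdj_reflection (D.metricAdj_deriv 1) (D.metricAdj_deriv Complex.I),
    adjugate_of_trace_eq_zero D.trace_reflection, D.adjugate_deriv]
  have h1 : 1 * -(P - (1 - P)) * deriv h φ 1 * -deriv h φ Complex.I = (4 * Complex.I) •
      ((P - (1 - P)) * ((φ + metricAdj h φ) * (φ - metricAdj h φ))) := by
    have h2 : deriv h φ 1 = (-2 : ℂ) • (φ + metricAdj h φ) := by simp [deriv]
    have h3 : deriv h φ Complex.I = (-2 * Complex.I) • (φ - metricAdj h φ) := by
      simp only [deriv, Complex.conj_I]; module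
    rw [h2, h3, one_mul]
    generalize P - (1 - P) = S
    generalize φ + metricAdj h φ = u
    generalize φ - metricAdj h φ = v
    simp only [mul_neg, neg_mul, neg_neg, Matrix.mul_smul, Matrix.smul_mul, smul_smul, mul_assoc]
    congr 1
    ring
  rw [h1, Matrix.trace_smul, orientation_trace D.isUnit_det D.idem D.selfAdj D.trace_proj D.eigen
    D.coeigen D.trace_higgs, smul_eq_mul]
  simp
  ring

/-- Where the Higgs field is diagonal for `L ⊕ L^⊥`, the metric in the frame varies by a real
multiple of `θ + θ̄`, which has a non-trivial kernel. -/
lemma exists_deriv_eq_zero (D : EigenFibre h P φ t) (h0 : P * φ * (1 - P) = 0) :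
    ∃ e : ℂ, e ≠ 0 ∧ deriv h φ e = 0 := by
  have hφ := eq_add_of_eigen D.idem D.eigen D.coeigen
  rw [h0, add_zero] at hφ
  have hd : ∀ e : ℂ, deriv h φ e = (-2 * (e * t + conj (e * t))) • (P - (1 - P)) := fun e => by
    have hψ : metricAdj h φ = conj t • (P - (1 - P)) := by
      conv_lhs => rw [hφ, metricAdj_smul, D.metricAdj_reflection]
    rw [deriv, hψ]
    conv_lhs => rw [hφ]
    rw [map_mul]
    module
  by_cases ht : t = 0
  · exact ⟨1, one_ne_zero, by rw [hd, ht]; simp⟩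
  · -- for this direction `e`, the number `e * t` is purely imaginary
    refine ⟨Complex.I * t⁻¹, mul_ne_zero Complex.I_ne_zero (inv_ne_zero ht), ?_⟩
    rw [hd, mul_assoc, inv_mul_cancel₀ ht]
    simp

end EigenFibre

variable [IsManifold 𝓘(ℂ) ω X] [IsManifold 𝓘(ℂ) ω M]

namespace IsSU2Solution

/-- A solution with its eigenline, pulled back to `X` and read at a point of a chart. -/
lemma eigenFibre (hsol : IsSU2Solution A Φ H) (hθ10 : θ.IsType10)
    (hL : IsHolomorphicEigenline A Φ θ L) (hπ : ContMDiff 𝓘(ℂ) 𝓘(ℂ) ω π) (hc : c ∈ atlas ℂ X)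
    (hz : z ∈ c.target) :
    EigenFibre (H (π (c.symm z))) (projL H L (π (c.symm z))) ((Φ.pullback π).dz c z)
      ((θ.pullback π).dz c z) := by
  have hφ : (Φ.pullback π).dz c z = (Φ.pullback π).inChart c z 1 := by
    rw [(hsol.type_higgs.pullback hπ).inChart_eq hc hz, one_smul]
  have ht : (θ.pullback π).dz c z = (θ.pullback π).inChart c z 1 := by
    rw [(hθ10.pullback hπ).inChart_eq hc hz, one_smul]
  rw [hφ, ht]
  exact ⟨hsol.posDef _, hsol.det_metric _, hsol.projL_mul_self hL _, hsol.metricAdj_projL hL _,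
    hsol.trace_projL hL _, hL.higgs_mul_projL _ _, hsol.projPerp_mul_higgs hL _ _,
    hsol.trace_higgs _ _⟩

lemma fderiv_associatedMap (hsol : IsSU2Solution A Φ H) (hπ : ContMDiff 𝓘(ℂ) 𝓘(ℂ) ω π)
    (hF : IsParallelFrame π A Φ H F) (hc : c ∈ atlas ℂ X) (hz : z ∈ c.target) (e : ℂ) :
    fderiv ℝ (associatedMap π H F ∘ c.symm) z e =
      toMink ((F (c.symm z))ᴴ * (H (π (c.symm z)) *
        EigenFibre.deriv (H (π (c.symm z))) ((Φ.pullback π).dz c z) e) * F (c.symm z)) := by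
  have h1 := matSmooth_iff_chart.1 hF.smooth c hc z hz
  have h2 := matSmooth_iff_chart.1 (hsol.smooth_metric.comp_holomorphic hπ) c hc z hz
  have hB : MatDiffAt (fun w => metricInFrame π H F (c.symm w)) z :=
    ((h1.conjTranspose.mul h2).mul h1).matDiffAt
  refine (fderiv_toMink hB e).trans ?_
  rw [matFderiv_metricInFrame hπ hsol.smooth_metric hsol.unitary hsol.isUnit_det hsol.hermitian hF
    hc hz]
  have h3 : ((Φ.adj H).pullback π).inChart c z e =
      metricAdj (H (π (c.symm z))) ((Φ.pullback π).inChart c z e) := rfl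
  rw [h3, (hsol.type_higgs.pullback hπ).inChart_eq hc hz, metricAdj_smul]

/-- The metric `h ⊕ (-h)` in a parallel frame is the oblique Gauß map of the metric `h`. -/
theorem isObliqueGaussMap (hsol : IsSU2Solution A Φ H) (hθ : θ.Smooth) (hθ10 : θ.IsType10)
    (hL : IsHolomorphicEigenline A Φ θ L) (hπ : ContMDiff 𝓘(ℂ) 𝓘(ℂ) ω π)
    (hF : IsParallelFrame π A Φ H F)
    (hf : ContMDiff 𝓘(ℝ, ℂ) 𝓘(ℝ, Fin 4 → ℝ) ∞ (associatedMap π H F)) :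
    IsObliqueGaussMap (associatedMap π H F) (associatedMap π (twistMetric H L) F)
      ((-2 : ℝ) • θ.pullback π) := by
  have hη : ∀ (c : OpenPartialHomeomorph X ℂ) (z e : ℂ),
      ((-2 : ℝ) • θ.pullback π).inChart c z e = -2 * (θ.pullback π).inChart c z e := fun c z e => by
    have : ((-2 : ℝ) • θ.pullback π).inChart c z e = (-2 : ℝ) • (θ.pullback π).inChart c z e := rfl
    rw [this, Complex.real_smul]; push_cast; rfl
  have hf0 : ∀ y, associatedMap π H F y = toMink ((F y)ᴴ * (H (π y) * 1) * F y) := fun y => by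
    rw [associatedMap, metricInFrame_eq]
  have hN : ∀ y, associatedMap π (twistMetric H L) F y =
      toMink ((F y)ᴴ * (H (π y) * (projL H L (π y) - (1 - projL H L (π y)))) * F y) :=
    fun y => rfl
  have hfib : ∀ y, ∃ φ t, EigenFibre (H (π y)) (projL H L (π y)) φ t := fun y => by
    obtain ⟨c, hc, z, hz, -, rfl, -⟩ := exists_inChart y 0
    exact ⟨_, _, hsol.eigenFibre hθ10 hL hπ hc hz⟩
  have hor : ∀ c ∈ atlas ℂ X, ∀ z ∈ c.target,
      orientationDet c (associatedMap π H F) (associatedMap π (twistMetric H L) F) z =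
        4 * ((projL H L (π (c.symm z)) * (Φ.pullback π).dz c z * (1 - projL H L (π (c.symm z))) *
          metricAdj (H (π (c.symm z))) (projL H L (π (c.symm z)) * (Φ.pullback π).dz c z *
            (1 - projL H L (π (c.symm z))))).trace).re := fun c hc z hz => by
    rw [orientationDet, partialX, partialY, hsol.fderiv_associatedMap hπ hF hc hz,
      hsol.fderiv_associatedMap hπ hF hc hz, hf0, hN]
    exact (hsol.eigenFibre hθ10 hL hπ hc hz).det_deriv (hF.det _)
  refine ⟨?_, ?_, ?_, ?_, ?_, ?_, ?_, ?_⟩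
  · intro c hc e
    simp only [hη]
    exact contDiffOn_const.mul (hθ.pullback hπ c hc e)
  · intro c hc z hz
    have h0 := hθ10.pullback hπ c hc z hz
    rw [OneForm.dzbar, smul_eq_mul, smul_eq_mul] at h0 ⊢
    rw [hη, hη]
    linear_combination (-2) * h0
  · intro c hc z hz
    have h1 : ((-2 : ℝ) • θ.pullback π).dz c z = -2 * (θ.pullback π).dz c z := by
      simp only [OneForm.dz, hη, smul_eq_mul]; ring
    rw [h1, hopf, partialX, partialY, (hsol.eigenFibre hθ10 hL hπ hc hz).hopf_deriv (hF.det _)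
      (hsol.fderiv_associatedMap hπ hF hc hz 1) (hsol.fderiv_associatedMap hπ hF hc hz Complex.I)]
    ring
  · intro y
    obtain ⟨φ, t, D⟩ := hfib y
    rw [hN, hf0]
    exact D.mink_reflection_one (hF.det y)
  · intro y v
    obtain ⟨c, hc, z, hz, e, rfl, hform⟩ := exists_inChart y v
    rw [hform _ (differential _), hform _ ((-2 : ℝ) • θ.pullback π), hη,
      inChart_differential hc hz ((hf _).mdifferentiableAt (by simp)), hN,
      (hθ10.pullback hπ).inChart_eq hc hz]
    have h := (hsol.eigenFibre hθ10 hL hπ hc hz).mink_deriv_reflection (hF.det (c.symm z)) e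
    rw [← hsol.fderiv_associatedMap hπ hF hc hz e] at h
    exact h
  · intro y
    obtain ⟨φ, t, D⟩ := hfib y
    rw [hN]
    exact D.mink_reflection_self (hF.det y)
  · intro c hc z hz
    rw [hor c hc z hz]
    have := (trace_mul_metricAdj_nonneg (hsol.posDef (π (c.symm z))) (projL H L (π (c.symm z)) *
      (Φ.pullback π).dz c z * (1 - projL H L (π (c.symm z))))).1
    positivity
  · intro c hc z hz hinj
    have hnn := trace_mul_metricAdj_nonneg (hsol.posDef (π (c.symm z))) (projL H L (π (c.symm z)) *
      (Φ.pullback π).dz c z * (1 - projL H L (π (c.symm z))))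
    rw [hor c hc z hz]
    refine mul_pos four_pos (lt_of_le_of_ne hnn.1 fun h0 => ?_)
    -- otherwise the Higgs field is diagonal for `L ⊕ L^⊥`, and `df` has a kernel
    obtain ⟨e, he, hde⟩ := (hsol.eigenFibre hθ10 hL hπ hc hz).exists_deriv_eq_zero (hnn.2 h0.symm)
    have h1 := hsol.fderiv_associatedMap hπ hF hc hz e
    rw [hde, mul_zero, mul_zero, zero_mul] at h1
    have h2 : toMink 0 = 0 := by simpa using toMink_smul 0 0
    have h3 := (inChart_differential hc hz ((hf (c.symm z)).mdifferentiableAt (by simp)) e).trans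
      (h1.trans h2)
    -- the coordinate vector `e` is a non-zero tangent vector in the kernel of `df`
    have h4 : mfderiv 𝓘(ℝ, ℂ) 𝓘(ℝ, ℂ) (c.symm : ℂ → X) z e = 0 :=
      hinj (h3.trans (map_zero _).symm)
    have h5 := mfderiv_comp z ((contMDiffAt_chart hc (c.map_target hz)).mdifferentiableAt (by simp))
      ((contMDiffAt_chart_symm hc hz).mdifferentiableAt (by simp))
    have h6 : (c ∘ c.symm : ℂ → ℂ) =ᶠ[𝓝 z] id := by
      filter_upwards [c.open_target.mem_nhds hz] with w hw
      simp [c.right_inv hw]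
    rw [h6.mfderiv_eq, mfderiv_id] at h5
    have h7 := congrArg (fun l => l e) h5
    refine he (h7.trans ?_)
    change mfderiv 𝓘(ℝ, ℂ) 𝓘(ℝ, ℂ) (c : X → ℂ) (c.symm z)
      (mfderiv 𝓘(ℝ, ℂ) 𝓘(ℝ, ℂ) (c.symm : ℂ → X) z e) = 0
    rw [h4, map_zero]

end IsSU2Solution

end GaussMap

/-! ### Deck transformations and monodromy -/

/-- Metrics pulled back from `M` are invariant under deck transformations, so in a frame with
monodromy `ρ` they are equivariant. -/
lemma isEquivariant_metricInFrame {M X : Type*} [TopologicalSpace X] {π : X → M} {F : X → Mat2}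
    {ρ : deckGroup π →* Matrix.SpecialLinearGroup (Fin 2) ℂ}
    (hρ : ∀ (γ : deckGroup π) (y : X),
      F (γ.1 y) = F y * ((ρ γ⁻¹ : Matrix.SpecialLinearGroup (Fin 2) ℂ) : Mat2)) (H : M → Mat2) :
    IsEquivariant π ρ (metricInFrame π H F) := by
  intro γ y
  rw [metricInFrame, metricInFrame, hρ, γ.2 y, Matrix.conjTranspose_mul]
  simp only [mul_assoc]

section Deck

variable {M X : Type*} [TopologicalSpace M] [ChartedSpace ℂ M]
  [TopologicalSpace X] [ChartedSpace ℂ X]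
  {A Φ : OneForm M Mat2} {H : M → Mat2} {π : X → M} {F G : X → Mat2}

/-- A deck transformation is holomorphic, since locally it is `π⁻¹ ∘ π`. -/
lemma contMDiff_deck (hπ : IsLocalDiffeomorph 𝓘(ℂ) 𝓘(ℂ) ω π) {γ : X → X} (hγ : Continuous γ)
    (hγπ : ∀ y, π (γ y) = π y) : ContMDiff 𝓘(ℂ) 𝓘(ℂ) ω γ := by
  intro y
  have h1 := (hπ (γ y)).localInverse_contMDiffAt
  rw [hγπ y] at h1
  have h2 := h1.comp y (hπ.contMDiff y)
  refine h2.congr_of_eventuallyEq ?_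
  filter_upwards [hγ.continuousAt.eventually (hπ (γ y)).localInverse_eventuallyEq_left] with x hx
  rw [Function.comp_apply, ← hγπ x]
  exact hx.symm

lemma OneForm.pullback_pullback {Y : Type*} [TopologicalSpace Y] [ChartedSpace ℂ Y] {W : Type*}
    [AddCommGroup W] [Module ℝ W] [Module ℂ W] {κ : Y → X} (hκ : ContMDiff 𝓘(ℂ) 𝓘(ℂ) ω κ)
    (hπ : ContMDiff 𝓘(ℂ) 𝓘(ℂ) ω π) (α : OneForm M W) :
    (α.pullback π).pullback κ = α.pullback (fun y => π (κ y)) := by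
  funext y
  ext v
  have h := mfderiv_comp (g := π) y
    ((contMDiffAt_real_of_complex (hπ (κ y))).mdifferentiableAt (by simp))
    ((contMDiffAt_real_of_complex (hκ y)).mdifferentiableAt (by simp))
  exact (congrArg (fun l : ℂ →L[ℝ] ℂ => (α (π (κ y)) : ℂ →ₗ[ℝ] W) (l v)) h).symm

/-- Parallel frames are permuted by deck transformations, as the connection comes from `M`. -/
lemma IsParallelFrame.comp_deck (hF : IsParallelFrame π A Φ H F)
    (hπ : ContMDiff 𝓘(ℂ) 𝓘(ℂ) ω π) {γ : X → X} (hγ : ContMDiff 𝓘(ℂ) 𝓘(ℂ) ω γ)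
    (hγπ : ∀ y, π (γ y) = π y) : IsParallelFrame π A Φ H (fun y => F (γ y)) := by
  refine ⟨hF.smooth.comp_holomorphic hγ, fun y => hF.det _, fun y v => ?_⟩
  rw [matDifferential_comp hF.smooth hγ]
  have h := OneForm.pullback_pullback hγ hπ (A + Φ + Φ.adj H)
  rw [funext hγπ] at h
  rw [← h]
  exact hF.parallel _ _

variable [IsManifold 𝓘(ℂ) ω X]

/-- A matrix-valued function with vanishing derivatives in all charts is constant. -/
lemma const_of_matFderiv_eq_zero [PreconnectedSpace X] {K : X → Mat2} (hK : MatSmooth K)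
    (h0 : ∀ c ∈ atlas ℂ X, ∀ z ∈ c.target, ∀ e, matFderiv e (fun w => K (c.symm w)) z = 0)
    (y y' : X) : K y = K y' := by
  ext i j
  have hloc : IsLocallyConstant (fun x => K x i j) := by
    rw [IsLocallyConstant.iff_eventually_eq]
    intro x
    set c := chartAt ℂ x
    have hc : c ∈ atlas ℂ X := chart_mem_atlas ℂ x
    have hx : x ∈ c.source := mem_chart_source ℂ x
    obtain ⟨r, hr, hball⟩ := Metric.isOpen_iff.1 c.open_target (c x) (c.map_source hx)
    have hd : ∀ w ∈ c.target, DifferentiableAt ℝ (fun w => K (c.symm w) i j) w := fun w hw =>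
      (matSmooth_iff_chart.1 hK c hc w hw).matDiffAt i j
    have h1 : ∀ᶠ x' in 𝓝 x, c x' ∈ Metric.ball (c x) r :=
      (c.continuousAt hx).eventually (Metric.ball_mem_nhds _ hr)
    filter_upwards [h1, c.open_source.mem_nhds hx] with x' hx' hxs
    have h2 := Metric.isOpen_ball.is_const_of_fderiv_eq_zero (𝕜 := ℝ)
      (convex_ball (c x) r).isPreconnected
      (fun w hw => (hd w (hball hw)).differentiableWithinAt)
      (fun w hw => ContinuousLinearMap.ext fun e =>
        congrFun (congrFun (h0 c hc w (hball hw) e) i) j) hx' (Metric.mem_ball_self hr)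
    simpa only [c.left_inv hxs, c.left_inv hx] using h2
  exact hloc.apply_eq_of_preconnectedSpace y y'

/-- Two parallel frames differ by a constant element of `SL(2, ℂ)`. -/
lemma IsParallelFrame.exists_eq_mul [ConnectedSpace X] (hF : IsParallelFrame π A Φ H F)
    (hG : IsParallelFrame π A Φ H G) :
    ∃ K : Matrix.SpecialLinearGroup (Fin 2) ℂ, ∀ y, G y = F y * (K : Mat2) := by
  have hu : ∀ y, IsUnit (F y).det := fun y => by rw [hF.det]; exact isUnit_one
  have hFs := matSmooth_iff_chart.1 hF.smooth
  have hGs := matSmooth_iff_chart.1 hG.smooth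
  have hKs : MatSmooth (fun y => (F y)⁻¹ * G y) := matSmooth_iff_chart.2 fun c hc z hz =>
    ((hFs c hc z hz).inv (hu _).ne_zero).mul (hGs c hc z hz)
  have hconst := const_of_matFderiv_eq_zero hKs fun c hc z hz e => by
    have hK := (matSmooth_iff_chart.1 hKs c hc z hz).matDiffAt
    have h1 := matFderiv_mul (hFs c hc z hz).matDiffAt hK e
    have h2 : (fun w => F (c.symm w) * ((F (c.symm w))⁻¹ * G (c.symm w))) =
        fun w => G (c.symm w) :=
      funext fun w => Matrix.mul_nonsing_inv_cancel_left _ _ (hu _)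
    rw [h2, hF.matFderiv_eq hc hz, hG.matFderiv_eq hc hz, neg_mul, mul_assoc _ (F (c.symm z)),
      Matrix.mul_nonsing_inv_cancel_left _ _ (hu _)] at h1
    -- what remains of the product rule for `F * (F⁻¹ * G) = G` is `F * d(F⁻¹ * G) = 0`
    have h3 := left_eq_add.1 h1
    rw [← Matrix.nonsing_inv_mul_cancel_left _ (matFderiv e _ z) (hu (c.symm z)), h3, mul_zero]
  obtain ⟨y₀⟩ := (inferInstance : Nonempty X)
  have hdet : ((F y₀)⁻¹ * G y₀).det = 1 := by
    rw [Matrix.det_mul, Matrix.det_nonsing_inv, hF.det, hG.det]; simp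
  refine ⟨⟨(F y₀)⁻¹ * G y₀, hdet⟩, fun y => ?_⟩
  change G y = F y * ((F y₀)⁻¹ * G y₀)
  rw [← hconst y y₀, Matrix.mul_nonsing_inv_cancel_left _ _ (hu _)]

/-- The monodromy representation of a parallel frame on the universal covering. -/
theorem IsParallelFrame.exists_monodromy (hF : IsParallelFrame π A Φ H F)
    (hπ : IsUniversalCovering π) :
    ∃ ρ : deckGroup π →* Matrix.SpecialLinearGroup (Fin 2) ℂ, ∀ (γ : deckGroup π) (y : X),
      F (γ.1 y) = F y * ((ρ γ⁻¹ : Matrix.SpecialLinearGroup (Fin 2) ℂ) : Mat2) := by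
  have := hπ.simplyConnected
  have hK : ∀ γ : deckGroup π, ∃ K : Matrix.SpecialLinearGroup (Fin 2) ℂ,
      ∀ y, F (γ.1 y) = F y * (K : Mat2) := fun γ =>
    hF.exists_eq_mul (hF.comp_deck hπ.localBiholomorphic.contMDiff
      (contMDiff_deck hπ.localBiholomorphic γ.1.continuous γ.2) γ.2)
  choose K hK using hK
  obtain ⟨y₀⟩ := (inferInstance : Nonempty X)
  have hu : IsUnit (F y₀).det := by rw [hF.det]; exact isUnit_one
  have huniq : ∀ C D : Matrix.SpecialLinearGroup (Fin 2) ℂ,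
      F y₀ * (C : Mat2) = F y₀ * (D : Mat2) → C = D := fun C D h => by
    apply Subtype.ext
    have := congrArg ((F y₀)⁻¹ * ·) h
    simpa only [Matrix.nonsing_inv_mul_cancel_left _ _ hu] using this
  refine ⟨MonoidHom.mk' (fun γ => K γ⁻¹) fun γ δ => huniq _ _ ?_, fun γ y => ?_⟩
  · -- both sides are `F (δ⁻¹ (γ⁻¹ y₀))`
    rw [← hK, Matrix.SpecialLinearGroup.coe_mul, ← mul_assoc, ← hK, ← hK, mul_inv_rev]
    rfl
  · rw [MonoidHom.mk'_apply, inv_inv, hK]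

end Deck

end SelfDuality

end

open SelfDuality in
theorem mainTheorem6
    {M : Type*} [TopologicalSpace M] [T2Space M] [ConnectedSpace M] [ChartedSpace ℂ M]
    [IsManifold 𝓘(ℂ) ω M]
    (A Φ : OneForm M Mat2) (H : M → Mat2) (hsol : IsSU2Solution A Φ H)
    (θ : OneForm M ℂ) (hθ : θ.Smooth) (hθ10 : θ.IsType10)
    (hdet : ∀ x v, (Φ x v).det = -(θ x v) ^ 2)
    (L : M → Submodule ℂ (Fin 2 → ℂ)) (hL : IsHolomorphicEigenline A Φ θ L) :
    IsSU11Solution (twistConn A Φ H L) (twistHiggs A θ H L) (twistMetric H L) ∧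
    ∀ {X : Type*} [TopologicalSpace X] [T2Space X] [ChartedSpace ℂ X] [IsManifold 𝓘(ℂ) ω X]
      (π : X → M), IsUniversalCovering π →
      ∀ F : X → Mat2,
        (IsParallelFrame π A Φ H F ↔
          IsParallelFrame π (twistConn A Φ H L) (twistHiggs A θ H L) (twistMetric H L) F) ∧
        (IsParallelFrame π A Φ H F →
          (IsHarmonicInto (-1) (associatedMap π H F) ∧ ∀ y, 0 < associatedMap π H F y 0) ∧
          IsHarmonicInto 1 (associatedMap π (twistMetric H L) F) ∧
          (∃ ρ : deckGroup π →* Matrix.SpecialLinearGroup (Fin 2) ℂ,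
            (∀ (γ : deckGroup π) (y : X),
              F (γ.1 y) = F y * ((ρ γ⁻¹ : Matrix.SpecialLinearGroup (Fin 2) ℂ) : Mat2)) ∧
            IsEquivariant π ρ (metricInFrame π H F) ∧
            IsEquivariant π ρ (metricInFrame π (twistMetric H L) F)) ∧
          IsObliqueGaussMap (associatedMap π H F) (associatedMap π (twistMetric H L) F)
            ((-2 : ℝ) • θ.pullback π)) := by
  have hS := hsol.isSU11Solution_twist hθ hθ10 hL
  refine ⟨hS, fun π hcov F => ?_⟩
  have hiff : IsParallelFrame π A Φ H F ↔
      IsParallelFrame π (twistConn A Φ H L) (twistHiggs A θ H L) (twistMetric H L) F :=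
    ⟨fun h => ⟨h.smooth, h.det, by rw [hsol.twist_add_eq hL]; exact h.parallel⟩,
      fun h => ⟨h.smooth, h.det, by rw [← hsol.twist_add_eq hL]; exact h.parallel⟩⟩
  refine ⟨hiff, fun hF => ?_⟩
  have hπ : ContMDiff 𝓘(ℂ) 𝓘(ℂ) ω π := hcov.localBiholomorphic.contMDiff
  have hf := hsol.toIsSelfDual.isHarmonicInto hπ (ε := -1) (by norm_num)
    (fun x => by rw [hsol.det_metric]; norm_num) hF
  obtain ⟨ρ, hρ⟩ := hF.exists_monodromy hcov
  exact ⟨⟨hf, hsol.associatedMap_zero_pos hF.det⟩,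
    hS.toIsSelfDual.isHarmonicInto hπ one_ne_zero
      (fun x => by rw [hS.det_metric]; norm_num) (hiff.1 hF),
    ⟨ρ, hρ, isEquivariant_metricInFrame hρ _, isEquivariant_metricInFrame hρ _⟩,
    hsol.isObliqueGaussMap hθ hθ10 hL hπ hF hf.smooth⟩
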